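/- Let $\mathbb C_+=\{z\in\mathbb C:\Re z>0\}$. For $w_1,w_2\in\mathbb C_+$ put $w=(w_1+w_2)/2$ and, for $|\Im z|<\Re w$, let $$G(z)=G(w_1,w_2;z)=\exp\Big(i\int_0^\infty\Big(\frac{\sin(2yz)}{2\sinh(w_1y)\sinh(w_2y)}-\frac{z}{w_1w_2y}\Big)\frac{dy}{y}\Big)$$ be the hyperbolic gamma function; write $G(z\pm a)=G(z+a)G(z-a)$. For $\gamma=(\gamma_0,\gamma_1,\gamma_2,\gamma_3)\in\mathbb C^4$ define $\rho,\sigma,\tau,\upsilon$ by $\gamma_0=-\rho+\sigma$, $\gamma_1=\rho+\sigma$, $\gamma_2=-\tau-\upsilon$, $\gamma_3=\tau-\upsilon$, and the dual parameters by $$\hat\gamma=\tfrac12(\gamma_0+\gamma_1+\gamma_2+\gamma_3,\ \gamma_0+\gamma_1-\gamma_2-\gamma_3,\ \gamma_0-\gamma_1+\gamma_2-\gamma_3,\ \gamma_0-\gamma_1-\gamma_2+\gamma_3).$$ Let $$\psi(\gamma;x,\lambda)=\int_{\mathbb R}\frac{G(z+x+\frac{\lambda}{2}-\frac{iw}{2}\pm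 i\tau)\,G(z-\frac{\lambda}{2}-\frac{iw}{2}\pm i\sigma)}{G(z+x-\frac{\lambda}{2}+\frac{iw}{2}\pm i\rho)\,G(z+\frac{\lambda}{2}+\frac{iw}{2}\pm i\upsilon)}\,dz,$$ $$\Delta(\gamma;x)=\frac{G(x+i\gamma_2)G(x+i\gamma_3)}{G(x-i\gamma_0)G(x-i\gamma_1)},\qquad N(\gamma)=\prod_{j=1}^3G(i\gamma_0+i\gamma_j+iw),$$ $$S(\gamma;x,\lambda)=\frac{N(\gamma)\,\psi(\gamma;x,\lambda)}{\sqrt{w_1w_2}\,\Delta(\gamma;x)\,\Delta(\hat\gamma;\lambda)}.$$ These formulas are used on the nonempty open set $U$ of all $(w_1,w_2,\gamma,x,\lambda)\in\mathcal O=\mathbb C_+^2\times\mathbb C^6$ with $|\Im x|<\frac12\Re w-\max(|\Re\rho|,|\Re\sigma|,|\Re\tau|,|\Re\upsilon|)-\frac12|\Im\lambda|$ and $|\Re(\gamma_0+\gamma_j+w)|<\Re w$ for $j=1,2,3$, where all arguments of $G$ lie in the strip $|\Im z|<\Re w$ and the integral converges. **Theorem.** $S$ extends from $U$ to a meromorphic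 function on $\mathcal O$, which is not identically zero. It is a simultaneous eigenfunction of two Askey–Wilson second order difference operators: as identities between meromorphic functions on $\mathcal O$ (valid at every point where all the functions occurring in them are holomorphic, and these points are dense in $\mathcal O$), $$\mathcal L^x_\gamma S(\gamma;x,\lambda)=v(w_1,w_2,\gamma;\lambda)\,S(\gamma;x,\lambda),\qquad \widetilde{\mathcal L}^x_\gamma S(\gamma;x,\lambda)=v(w_2,w_1,\gamma;\lambda)\,S(\gamma;x,\lambda).$$ Here $$\mathcal L^x_\gamma f(x)=A(w_1,w_2,\gamma;x)\big(f(x+iw_1)-f(x)\big)+A(w_1,w_2,\gamma;-x)\big(f(x-iw_1)-f(x)\big),$$ $$A(w_1,w_2,\gamma;x)=\frac{\prod_{j=0}^3\big(1-e^{2\pi(iw+i\gamma_j+x)/w_2}\big)}{(1-e^{4\pi x/w_2})(1-e^{4\pi(x+iw)/w_2})},$$ $$v(w_1,w_2,\gamma;\lambda)=-2e^{\pi iw_1/w_2+2\pi i\hat\gamma_0/w_2}\big(\cosh(2\pi\lambda/w_2)+\cosh(\pi iw_1/w_2+2\pi i\hat\gamma_0/w_2)\big),$$ and $\widetilde{\mathcal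 L}^x_\gamma$ (step $iw_2$) is $\mathcal L^x_\gamma$ (step $iw_1$) with $w_1$ and $w_2$ interchanged. -/

import Mathlib

open Complex Set Filter Topology MeasureTheory
open scoped Matrix

noncomputable section

namespace AskeyWilson

/-! ## Meromorphic functions of several complex variables -/

section Meromorphic

variable {V : Type*} [NormedAddCommGroup V] [NormedSpace ℂ V]

/-- `F` is holomorphic in a neighbourhood of `p`. -/
def HolomorphicAt (F : V → ℂ) (p : V) : Prop :=
  ∀ᶠ q in 𝓝 p, DifferentiableAt ℂ F q

/-- `F` represents a meromorphic function of several variables on `U`: near every point of `U` it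
is a quotient `f / g` of holomorphic functions, with `g` not identically zero. The values of `F` on
the zero set of `g` are unconstrained. -/
def IsMeromorphicOn (F : V → ℂ) (U : Set V) : Prop :=
  ∀ p ∈ U, ∃ r > 0, ∃ f g : V → ℂ,
    DifferentiableOn ℂ f (Metric.ball p r) ∧ DifferentiableOn ℂ g (Metric.ball p r) ∧
    (∃ q ∈ Metric.ball p r, g q ≠ 0) ∧
    ∀ q ∈ Metric.ball p r, g q ≠ 0 → F q = f q / g q

end Meromorphic

/-! ## The hyperbolic gamma function -/

/-- `w = (w₁ + w₂) / 2`. -/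
def wMean (w₁ w₂ : ℂ) : ℂ := (w₁ + w₂) / 2

/-- `g(w₁, w₂; z) = ∫₀^∞ (sin (2yz) / (2 sinh (w₁ y) sinh (w₂ y)) - z / (w₁ w₂ y)) dy / y`,
convergent for `|Im z| < Re w`. -/
def hypG (w₁ w₂ z : ℂ) : ℂ :=
  ∫ y in Ioi (0 : ℝ),
    (Complex.sin (2 * y * z) / (2 * Complex.sinh (w₁ * y) * Complex.sinh (w₂ * y))
      - z / (w₁ * w₂ * y)) / y

/-- The hyperbolic gamma function `G(w₁, w₂; z) = exp (i g(w₁, w₂; z))` on its defining strip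
`|Im z| < Re w`. It is only evaluated on this strip below. -/
def hypGamma (w₁ w₂ z : ℂ) : ℂ := Complex.exp (I * hypG w₁ w₂ z)

/-- `G(z ± a) = G(z + a) G(z - a)`. -/
def hypGammaPM (w₁ w₂ z a : ℂ) : ℂ := hypGamma w₁ w₂ (z + a) * hypGamma w₁ w₂ (z - a)

/-! ## Parameters

The parameters `γ₀ = -ρ + σ`, `γ₁ = ρ + σ`, `γ₂ = -τ - υ`, `γ₃ = τ - υ`, solved for
`ρ, σ, τ, υ`. -/

def parRho (γ : Fin 4 → ℂ) : ℂ := (γ 1 - γ 0) / 2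

def parSigma (γ : Fin 4 → ℂ) : ℂ := (γ 0 + γ 1) / 2

def parTau (γ : Fin 4 → ℂ) : ℂ := (γ 3 - γ 2) / 2

def parUpsilon (γ : Fin 4 → ℂ) : ℂ := -(γ 2 + γ 3) / 2

/-- The dual parameters `γ̂`. -/
def dualPar (γ : Fin 4 → ℂ) : Fin 4 → ℂ :=
  (1 / 2 : ℂ) • (!![1, 1, 1, 1; 1, 1, -1, -1; 1, -1, 1, -1; 1, -1, -1, 1] *ᵥ γ)

/-! ## The function `S` on the domain of its integral representation -/

/-- The integrand of `ψ`. -/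
def psiIntegrand (w₁ w₂ : ℂ) (γ : Fin 4 → ℂ) (x l z : ℂ) : ℂ :=
  (hypGammaPM w₁ w₂ (z + x + l / 2 - I * wMean w₁ w₂ / 2) (I * parTau γ)
      * hypGammaPM w₁ w₂ (z - l / 2 - I * wMean w₁ w₂ / 2) (I * parSigma γ))
    / (hypGammaPM w₁ w₂ (z + x - l / 2 + I * wMean w₁ w₂ / 2) (I * parRho γ)
      * hypGammaPM w₁ w₂ (z + l / 2 + I * wMean w₁ w₂ / 2) (I * parUpsilon γ))

/-- The matrix coefficient `ψ(γ; x, λ)`. -/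
def psi (w₁ w₂ : ℂ) (γ : Fin 4 → ℂ) (x l : ℂ) : ℂ :=
  ∫ z : ℝ, psiIntegrand w₁ w₂ γ x l z

/-- `Δ(γ; x) = G(x + iγ₂) G(x + iγ₃) / (G(x - iγ₀) G(x - iγ₁))`. -/
def Delta (w₁ w₂ : ℂ) (γ : Fin 4 → ℂ) (x : ℂ) : ℂ :=
  (hypGamma w₁ w₂ (x + I * γ 2) * hypGamma w₁ w₂ (x + I * γ 3))
    / (hypGamma w₁ w₂ (x - I * γ 0) * hypGamma w₁ w₂ (x - I * γ 1))

/-- `N(γ) = ∏_{j=1}^3 G(iγ₀ + iγⱼ + iw)`. -/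
def normN (w₁ w₂ : ℂ) (γ : Fin 4 → ℂ) : ℂ :=
  ∏ j : Fin 3, hypGamma w₁ w₂ (I * γ 0 + I * γ j.succ + I * wMean w₁ w₂)

/-- `N(γ) ψ(γ; x, λ) / (√(w₁ w₂) Δ(γ; x) Δ(γ̂; λ))`, with the principal square root. -/
def sFormula (w₁ w₂ : ℂ) (γ : Fin 4 → ℂ) (x l : ℂ) : ℂ :=
  normN w₁ w₂ γ * psi w₁ w₂ γ x l
    / ((w₁ * w₂) ^ (1 / 2 : ℂ) * Delta w₁ w₂ γ x * Delta w₁ w₂ (dualPar γ) l)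

/-- The variables `(w₁, w₂, γ, x, λ)`. -/
abbrev Params : Type := ℂ × ℂ × (Fin 4 → ℂ) × ℂ × ℂ

/-- The domain `ℂ₊² × ℂ⁶`. -/
def bigDomain : Set Params := {p | 0 < p.1.re ∧ 0 < p.2.1.re}

/-- `ξ = max (|Re ρ|, |Re σ|, |Re τ|, |Re υ|)`. -/
def xi (γ : Fin 4 → ℂ) : ℝ :=
  max (max |(parRho γ).re| |(parSigma γ).re|) (max |(parTau γ).re| |(parUpsilon γ).re|)

/-- `ζ = Re w / 2 - ξ - |Im (λ / 2)|`. -/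
def zeta (w₁ w₂ : ℂ) (γ : Fin 4 → ℂ) (l : ℂ) : ℝ :=
  (wMean w₁ w₂).re / 2 - xi γ - |(l / 2).im|

/-- The nonempty open convex set on which `S` is given by its explicit formula: the integral
defining `ψ` has its pole sequences on the correct sides of the real line (`|Im x| < ζ`), and the
arguments of `G` in `N(γ)` lie in the strip. All other arguments of `G` then lie in the strip,
too. -/
def baseDomain : Set Params :=
  {(w₁, w₂, γ, x, l) | 0 < w₁.re ∧ 0 < w₂.re ∧ |x.im| < zeta w₁ w₂ γ l ∧
    ∀ j : Fin 3, |(I * γ 0 + I * γ j.succ + I * wMean w₁ w₂).im| < (wMean w₁ w₂).re}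

/-- `S` is (a representative of) the meromorphic function `S(γ; x, λ)`: the meromorphic
continuation of the explicit formula to the connected domain `ℂ₊² × ℂ⁶`. -/
def IsAskeyWilsonS (S : Params → ℂ) : Prop :=
  IsMeromorphicOn S bigDomain ∧
    ∀ w₁ w₂ γ x l, (w₁, w₂, γ, x, l) ∈ baseDomain →
      S (w₁, w₂, γ, x, l) = sFormula w₁ w₂ γ x l

/-! ## The Askey-Wilson second order difference operator -/

/-- The denominator of the coefficient `A(w₁, w₂, γ; x)`. -/
def coeffDen (w₁ w₂ x : ℂ) : ℂ :=
  (1 - Complex.exp (4 * Real.pi * x / w₂))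
    * (1 - Complex.exp (4 * Real.pi * (x + I * wMean w₁ w₂) / w₂))

/-- The coefficient `A(w₁, w₂, γ; x)`. -/
def coeffA (w₁ w₂ : ℂ) (γ : Fin 4 → ℂ) (x : ℂ) : ℂ :=
  (∏ j : Fin 4, (1 - Complex.exp (2 * Real.pi * (I * wMean w₁ w₂ + I * γ j + x) / w₂)))
    / coeffDen w₁ w₂ x

/-- The Askey-Wilson second order difference operator with step `i w₁`. The operator with step
`i w₂` is obtained by interchanging `w₁` and `w₂`. -/
def awOperator (w₁ w₂ : ℂ) (γ : Fin 4 → ℂ) (f : ℂ → ℂ) (x : ℂ) : ℂ :=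
  coeffA w₁ w₂ γ x * (f (x + I * w₁) - f x) + coeffA w₁ w₂ γ (-x) * (f (x - I * w₁) - f x)

/-- The eigenvalue `v(w₁, w₂, γ; λ)`. -/
def eigenV (w₁ w₂ : ℂ) (γ : Fin 4 → ℂ) (l : ℂ) : ℂ :=
  -2 * Complex.exp (Real.pi * I * w₁ / w₂ + 2 * Real.pi * I * dualPar γ 0 / w₂)
    * (Complex.cosh (2 * Real.pi * l / w₂)
      + Complex.cosh (Real.pi * I * w₁ / w₂ + 2 * Real.pi * I * dualPar γ 0 / w₂))

/-- The points at which every term of the difference equation with step `i s` is holomorphic; here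
`(s, t)` is `(w₁, w₂)` or `(w₂, w₁)`. -/
def IsRegularPoint (S : Params → ℂ) (s t w₁ w₂ : ℂ) (γ : Fin 4 → ℂ) (x l : ℂ) : Prop :=
  HolomorphicAt S (w₁, w₂, γ, x, l) ∧
  HolomorphicAt S (w₁, w₂, γ, x + I * s, l) ∧
  HolomorphicAt S (w₁, w₂, γ, x - I * s, l) ∧
  coeffDen s t x ≠ 0 ∧ coeffDen s t (-x) ≠ 0

end AskeyWilson

end

/-! Only the step `i w₁` needs an argument. The explicit formula is symmetric in `w₁` and `w₂`
(`sFormula_comm`), so composing a continuation with the interchange of periods gives another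
continuation, and the second equation is the first one for it.

Continuation. The kernel `1 / (2 sinh (w₁ y) sinh (w₂ y))` is a double series of exponentials.
Removing `K²` of its terms and evaluating their contributions by a Frullani integral writes `G` as
`exp (i gTrunc)` times a quotient of polynomials (`hypGamma_eq_trunc`), with `gTrunc` jointly
holomorphic on a strip that is as wide as desired for large `K`. The integrand of `ψ` becomes `E u /
(α β)`: `E` has no zeros and decays exponentially, and the zeros of `α` lie below the contour, those
of `β` above it. A Bézout identity `a α + b β = R` with `R` free of the integration variable splits
`R ψ` into two integrals, each with poles on one side only. Their contours are moved far away in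
opposite directions, where the integrals are holomorphic on a whole bounded convex parameter domain
(`exists_psi_continuation`). No residues are computed. The domains exhaust `ℂ₊² × ℂ⁶`, and the
resulting quotients agree by the identity theorem.

Difference equation. An integral formula for the logarithm of `cosh` shows that `G(z + i w₁) / G(z)`
is a constant times a `sinh` (`hypGamma_add`). Hence the integrands of `ψ` at `x + i w₁`, `x` and `x
- i w₁` differ by trigonometric factors, and creative telescoping applies: `tel_identity` supplies
an explicit certificate making a linear combination of the three equal to `T(z + i w₁) - T(z)`.
Since `T` is holomorphic and decays between the two contours, that combination integrates to zero
(`psi_difference`). Conjugation by `Δ` turns this into the Askey-Wilson equation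
(`awOperator_sFormula`). The argument is run only near one point, `refPoint`; with all denominators
cleared the equation is an identity of holomorphic functions on convex sets and therefore persists
(`sDefect_eq_zero`). Uniqueness of the continuation (`IsAskeyWilsonS.mul_sDen`) transfers it to
every representative `S`.

Nonvanishing. For suitable real periods the integrand at `x = λ = 0` is a squared modulus, so `ψ` is
positive there (`psi_posPoint_ne_zero`). -/

noncomputable section

namespace AskeyWilson

/-! ### Identity theorem on convex sets, Cauchy estimate, and holomorphic parameter integrals. -/

section General

variable {V : Type*} [NormedAddCommGroup V] [NormedSpace ℂ V]

/-- One variable suffices: the complex line `p + ζ (q - p)` meets `D` in a convex, hence connected,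
open set of parameters containing `0` and `1`. -/
theorem eqOn_zero_of_convex [NormedSpace ℝ V] [IsScalarTower ℝ ℂ V] {D : Set V} (hD : IsOpen D)
    (hc : Convex ℝ D) {f : V → ℂ} (hf : DifferentiableOn ℂ f D) {p : V} (hp : p ∈ D)
    (h0 : ∀ᶠ q in 𝓝 p, f q = 0) : ∀ q ∈ D, f q = 0 := by
  intro q hq
  set L : ℂ → V := fun ζ => p + ζ • (q - p) with hL
  have hLd : Differentiable ℂ L := by fun_prop
  have hUo : IsOpen (L ⁻¹' D) := hD.preimage hLd.continuous
  have hUc : Convex ℝ (L ⁻¹' D) := by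
    intro x hx y hy a b ha hb hab
    have h := hc hx hy ha hb hab
    have e : a • L x + b • L y = L (a • x + b • y) := by
      have h1 : a • p + b • p = p := by rw [← add_smul, hab, one_smul]
      calc a • L x + b • L y = (a • p + b • p) + (a • x • (q - p) + b • y • (q - p)) := by
            simp only [hL, smul_add]; abel
        _ = L (a • x + b • y) := by rw [h1]; simp only [hL, add_smul, smul_assoc]
    rw [mem_preimage, ← e]; exact h
  have han : AnalyticOnNhd ℂ (f ∘ L) (L ⁻¹' D) :=
    (hf.comp hLd.differentiableOn (fun _ h => h)).analyticOnNhd hUo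
  have hL0 : L 0 = p := by simp [hL]
  have hL1 : L 1 = q := by simp [hL]
  have hev : (f ∘ L) =ᶠ[𝓝 0] 0 := by
    have ht : Tendsto L (𝓝 0) (𝓝 p) := by
      have := hLd.continuous.tendsto 0
      rwa [hL0] at this
    exact ht.eventually h0
  have := han.eqOn_zero_of_preconnected_of_eventuallyEq_zero hUc.isPreconnected
    (z₀ := 0) (by rw [mem_preimage, hL0]; exact hp) hev (x := 1)
    (by rw [mem_preimage, hL1]; exact hq)
  simpa [hL1] using this

theorem frequently_ne_zero_of_convex [NormedSpace ℝ V] [IsScalarTower ℝ ℂ V] {D : Set V}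
    (hD : IsOpen D) (hc : Convex ℝ D) {g : V → ℂ} (hg : DifferentiableOn ℂ g D)
    (h : ∃ q ∈ D, g q ≠ 0) {p : V} (hp : p ∈ D) : ∃ᶠ q in 𝓝 p, g q ≠ 0 := by
  intro hev
  obtain ⟨q, hq, hne⟩ := h
  exact hne (eqOn_zero_of_convex hD hc hg hp (by simpa using hev) q hq)

/-- In a direction `v` this is the one-variable Cauchy estimate for `ζ ↦ f (q + ζ v)` on the disc of
radius `r / ‖v‖`. -/
theorem norm_fderiv_le_of_bound {f : V → ℂ} {U : Set V} (hU : IsOpen U)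
    (hf : DifferentiableOn ℂ f U) {q : V} {r C : ℝ} (hr : 0 < r) (hball : Metric.closedBall q r ⊆ U)
    (hC : ∀ x ∈ U, ‖f x‖ ≤ C) : ‖fderiv ℂ f q‖ ≤ C / r := by
  have hqU : q ∈ U := hball (Metric.mem_closedBall_self hr.le)
  have hC0 : 0 ≤ C := (norm_nonneg _).trans (hC q hqU)
  refine ContinuousLinearMap.opNorm_le_bound _ (by positivity) fun v => ?_
  rcases eq_or_ne v 0 with rfl | hv
  · simp
  have hv' : 0 < ‖v‖ := norm_pos_iff.2 hv
  set L : ℂ → V := fun ζ => q + ζ • v with hL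
  have hLd : Differentiable ℂ L := by fun_prop
  have hL0 : L 0 = q := by simp [hL]
  have hmem : ∀ ζ ∈ Metric.closedBall (0 : ℂ) (r / ‖v‖), L ζ ∈ U := by
    intro ζ hζ
    apply hball
    rw [mem_closedBall_zero_iff, le_div_iff₀ hv'] at hζ
    simpa [hL, norm_smul] using hζ
  have hd : HasDerivAt (f ∘ L) (fderiv ℂ f q v) 0 := by
    have h1 : HasFDerivAt f (fderiv ℂ f q) (L 0) := by
      rw [hL0]; exact (hf.differentiableAt (hU.mem_nhds hqU)).hasFDerivAt
    have h2 : HasDerivAt L v 0 := by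
      simpa [hL] using ((hasDerivAt_id (0 : ℂ)).smul_const v).const_add q
    exact h1.comp_hasDerivAt _ h2
  have hdiff : DifferentiableOn ℂ (f ∘ L) (Metric.closedBall 0 (r / ‖v‖)) :=
    hf.comp hLd.differentiableOn hmem
  have hr' : 0 < r / ‖v‖ := by positivity
  have := norm_deriv_le_of_forall_mem_sphere_norm_le hr' (f := f ∘ L) (c := 0) (C := C)
    (by
      have hcl : closure (Metric.ball (0 : ℂ) (r / ‖v‖)) = Metric.closedBall 0 (r / ‖v‖) :=
        closure_ball _ hr'.ne'
      exact DifferentiableOn.diffContOnCl (by rwa [hcl]))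
    (fun z hz => hC _ (hmem z (Metric.sphere_subset_closedBall hz)))
  rw [hd.deriv] at this
  calc ‖fderiv ℂ f q v‖ ≤ C / (r / ‖v‖) := this
    _ = C / r * ‖v‖ := by field_simp

/-- An integral of holomorphic functions with an integrable bound is holomorphic in the
parameter. -/
theorem differentiableOn_integral [FiniteDimensional ℂ V] {α : Type*} [MeasurableSpace α]
    {μ : Measure α} {F : V → α → ℂ} {U : Set V} (hU : IsOpen U) {b : α → ℝ} (hb : Integrable b μ)
    (hm : ∀ p ∈ U, AEStronglyMeasurable (F p) μ)
    (hd : ∀ᵐ a ∂μ, DifferentiableOn ℂ (fun p => F p a) U)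
    (hbd : ∀ᵐ a ∂μ, ∀ p ∈ U, ‖F p a‖ ≤ b a) :
    DifferentiableOn ℂ (fun p => ∫ a, F p a ∂μ) U := by
  intro p hp
  obtain ⟨R, hR, hRU⟩ := Metric.isOpen_iff.1 hU p hp
  set r := R / 3 with hr
  have hr0 : 0 < r := by positivity
  have hballq : ∀ q ∈ Metric.ball p r, Metric.closedBall q r ⊆ U := by
    intro q hq x hx
    apply hRU
    rw [Metric.mem_ball] at hq ⊢
    rw [Metric.mem_closedBall] at hx
    linarith [dist_triangle x q p]
  have hbr : Metric.ball p r ⊆ U := fun q hq => hballq q hq (Metric.mem_closedBall_self hr0.le)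
  -- Differentiation under the integral sign requires the derivative to be measurable in `a`. Its
  -- coordinates in a basis are pointwise limits of measurable difference quotients with increments
  -- `v / (n + N + 1)`, where `N > ‖v‖ / r` keeps the increments inside the ball.
  have hmeas : AEStronglyMeasurable (fun a => fderiv ℂ (fun q => F q a) p) μ := by
    let B := Module.finBasis ℂ V
    have hrep : ∀ L : V →L[ℂ] ℂ, L = ∑ i, L (B i) • (B.coord i).toContinuousLinearMap := by
      intro L
      ext v
      calc L v = L (∑ i, B.repr v i • B i) := by rw [B.sum_repr]
        _ = _ := by rw [map_sum]; simp [mul_comm]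
    have happ : ∀ v : V, AEStronglyMeasurable (fun a => fderiv ℂ (fun q => F q a) p v) μ := by
      intro v
      obtain ⟨N, hN⟩ := exists_nat_gt (‖v‖ / r)
      have hc : Tendsto (fun n : ℕ => ‖((n + N + 1 : ℕ) : ℂ)‖) atTop atTop := by
        simp only [Complex.norm_natCast]
        exact tendsto_natCast_atTop_atTop.comp
          (tendsto_atTop_mono (fun n => by simp only [id]; omega) tendsto_id)
      refine aestronglyMeasurable_of_tendsto_ae atTop
        (f := fun (n : ℕ) a => ((n + N + 1 : ℕ) : ℂ) •
          (F (p + ((n + N + 1 : ℕ) : ℂ)⁻¹ • v) a - F p a)) (fun n => ?_) ?_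
      · refine (((hm (p + ((n + N + 1 : ℕ) : ℂ)⁻¹ • v) ?_).sub (hm p hp)).const_smul
          ((n + N + 1 : ℕ) : ℂ)).congr (Eventually.of_forall fun _ => rfl)
        apply hbr
        rw [Metric.mem_ball, dist_eq_norm, add_sub_cancel_left, norm_smul, norm_inv,
          Complex.norm_natCast, inv_mul_lt_iff₀ (by positivity)]
        rw [div_lt_iff₀ hr0] at hN
        push_cast
        nlinarith [Nat.cast_nonneg (α := ℝ) n]
      · filter_upwards [hd] with a ha
        exact (ha.differentiableAt (hU.mem_nhds hp)).hasFDerivAt.lim v hc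
    have : (fun a => fderiv ℂ (fun q => F q a) p) = fun a => ∑ i,
        (fderiv ℂ (fun q => F q a) p (B i)) • (B.coord i).toContinuousLinearMap := by
      funext a; exact hrep _
    rw [this]
    exact Finset.aestronglyMeasurable_fun_sum _ fun i _ => (happ (B i)).smul_const _
  have key := hasFDerivAt_integral_of_dominated_of_fderiv_le (𝕜 := ℂ) (μ := μ) (F := F)
    (F' := fun q a => fderiv ℂ (fun q => F q a) q) (x₀ := p) (bound := fun a => b a / r)
    (s := Metric.ball p r)
    (Metric.ball_mem_nhds p hr0)
    (by filter_upwards [Metric.ball_mem_nhds p hr0] with q hq using hm q (hbr hq))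
    (Integrable.mono' hb (hm p hp) (by filter_upwards [hbd] with a ha using ha p hp))
    hmeas
    (by
      filter_upwards [hd, hbd] with a ha hba q hq
      exact norm_fderiv_le_of_bound hU ha hr0 (hballq q hq) hba)
    (hb.div_const r)
    (by
      filter_upwards [hd] with a ha q hq
      exact (ha.differentiableAt (hU.mem_nhds (hbr hq))).hasFDerivAt)
  exact key.differentiableAt.differentiableWithinAt

end General

/-! ### Horizontal contours and inverse quadratic decay. -/

theorem integrable_of_bound_inv_one_add_sq {f : ℝ → ℂ} (hf : AEStronglyMeasurable f volume) {C : ℝ}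
    (hC : ∀ x, ‖f x‖ ≤ C / (1 + x ^ 2)) : Integrable f := by
  refine Integrable.mono' (g := fun x => C * (1 + x ^ 2)⁻¹)
    (integrable_inv_one_add_sq.const_mul C) hf (Eventually.of_forall fun x => ?_)
  simpa [div_eq_mul_inv] using hC x

/-- Shifting a horizontal contour of integration. -/
theorem integral_horizontal_eq {f : ℂ → ℂ} {a b C : ℝ} (hab : a ≤ b)
    (hf : DifferentiableOn ℂ f {z | z.im ∈ Icc a b})
    (hC : ∀ z : ℂ, z.im ∈ Icc a b → ‖f z‖ ≤ C / (1 + z.re ^ 2)) :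
    ∫ x : ℝ, f (x + a * I) = ∫ x : ℝ, f (x + b * I) := by
  have hint : ∀ y ∈ Icc a b, Integrable fun x : ℝ => f (x + y * I) := by
    intro y hy
    refine integrable_of_bound_inv_one_add_sq (C := C) ?_ fun x => ?_
    · refine Continuous.aestronglyMeasurable ?_
      refine hf.continuousOn.comp_continuous (by fun_prop) fun x => ?_
      simpa using hy
    · simpa using hC (x + y * I) (by simpa using hy)
  -- Cauchy's theorem on the rectangle with vertices at real parts `-R` and `R`; the vertical sides
  -- are `O(1 / (1 + R²))`.
  have hrect : ∀ R : ℝ, (∫ x in (-R)..R, f (x + a * I)) - (∫ x in (-R)..R, f (x + b * I))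
      = -(I • ∫ y in a..b, f (R + y * I)) + I • ∫ y in a..b, f ((-R : ℝ) + y * I) := by
    intro R
    have := Complex.integral_boundary_rect_eq_zero_of_differentiableOn f (-R + a * I) (R + b * I)
      (hf.mono ?_)
    · simp at this
      simp only [ofReal_neg, smul_eq_mul]
      linear_combination this
    · intro z hz
      have := hz.2
      simpa [uIcc_of_le hab] using this
  have hvert : ∀ R : ℝ, ‖∫ y in a..b, f (R + y * I)‖ ≤ C / (1 + R ^ 2) * |b - a| := by
    intro R
    refine intervalIntegral.norm_integral_le_of_norm_le_const fun y hy => ?_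
    rw [uIoc_of_le hab] at hy
    simpa using hC (R + y * I) (by simpa using ⟨hy.1.le, hy.2⟩)
  have hlim0 : Tendsto (fun R : ℝ => C / (1 + R ^ 2) * |b - a|) atTop (𝓝 0) := by
    have h : Tendsto (fun R : ℝ => 1 + R ^ 2) atTop atTop :=
      tendsto_atTop_add_const_left _ _ (tendsto_pow_atTop two_ne_zero)
    simpa using (h.const_div_atTop C).mul_const |b - a|
  have hv1 : Tendsto (fun R : ℝ => ∫ y in a..b, f (R + y * I)) atTop (𝓝 0) :=
    squeeze_zero_norm hvert hlim0
  have hv2 : Tendsto (fun R : ℝ => ∫ y in a..b, f ((-R : ℝ) + y * I)) atTop (𝓝 0) :=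
    squeeze_zero_norm (fun R => by simpa using hvert (-R)) hlim0
  have hA := intervalIntegral_tendsto_integral (hint a ⟨le_rfl, hab⟩) tendsto_neg_atTop_atBot
    tendsto_id
  have hB := intervalIntegral_tendsto_integral (hint b ⟨hab, le_rfl⟩) tendsto_neg_atTop_atBot
    tendsto_id
  have h1 := hA.sub hB
  have h2 : Tendsto (fun R : ℝ => -(I • ∫ y in a..b, f (R + y * I))
      + I • ∫ y in a..b, f ((-R : ℝ) + y * I)) atTop (𝓝 0) := by
    simpa using (hv1.const_smul I).neg.add (hv2.const_smul I)
  have h3 : (fun R : ℝ => (∫ x in (-R)..(id R), f (x + a * I)) - (∫ x in (-R)..(id R), f (x + b * I)))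
      = fun R : ℝ => -(I • ∫ y in a..b, f (R + y * I)) + I • ∫ y in a..b, f ((-R : ℝ) + y * I) :=
    funext fun R => hrect R
  rw [h3] at h1
  exact sub_eq_zero.1 (tendsto_nhds_unique h1 h2)

/-! ### Elementary estimates -/

/-- Subtracting the second order Taylor polynomials of `exp u` and `exp (-u)` leaves exactly `2u`,
so only the two cubic remainders survive. -/
theorem norm_sinh_sub_le (u : ℂ) : ‖sinh u - u‖ ≤ ‖u‖ ^ 3 * Real.exp ‖u‖ := by
  have h1 := Complex.norm_exp_sub_sum_le_norm_mul_exp u 3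
  have h2 := Complex.norm_exp_sub_sum_le_norm_mul_exp (-u) 3
  rw [norm_neg] at h2
  have e : sinh u - u = ((exp u - ∑ m ∈ Finset.range 3, u ^ m / m.factorial)
      - (exp (-u) - ∑ m ∈ Finset.range 3, (-u) ^ m / m.factorial)) / 2 := by
    simp [Complex.sinh, Finset.sum_range_succ]
    ring
  rw [e, norm_div, div_le_iff₀ (by norm_num)]
  refine (norm_sub_le _ _).trans ?_
  simp only [Complex.norm_ofNat]
  linarith

theorem norm_sin_sub_le (u : ℂ) : ‖sin u - u‖ ≤ ‖u‖ ^ 3 * Real.exp ‖u‖ := by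
  have h := norm_sinh_sub_le (u * I)
  rw [Complex.sinh_mul_I, ← sub_mul, norm_mul, norm_mul, norm_I, mul_one, mul_one] at h
  exact h

theorem norm_exp_sub_one_le' (u : ℂ) : ‖exp u - 1‖ ≤ ‖u‖ * Real.exp ‖u‖ := by
  simpa using Complex.norm_exp_sub_sum_le_norm_mul_exp u 1

theorem sinh_re_le_norm_sinh (u : ℂ) : Real.sinh u.re ≤ ‖sinh u‖ := by
  rw [Complex.sinh, norm_div, Complex.norm_ofNat, Real.sinh_eq]
  have := norm_sub_norm_le (exp u) (exp (-u))
  rw [Complex.norm_exp, Complex.norm_exp, neg_re] at this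
  linarith

theorem norm_sin_le_exp (u : ℂ) : ‖sin u‖ ≤ Real.exp |u.im| := by
  rw [Complex.sin, norm_div, norm_mul, norm_I, mul_one, Complex.norm_ofNat, div_le_iff₀ two_pos]
  refine (norm_sub_le _ _).trans ?_
  rw [Complex.norm_exp, Complex.norm_exp]
  have h1 : Real.exp ((-u * I).re) ≤ Real.exp |u.im| :=
    Real.exp_le_exp.2 (by simpa using le_abs_self u.im)
  have h2 : Real.exp ((u * I).re) ≤ Real.exp |u.im| :=
    Real.exp_le_exp.2 (by simpa using neg_le_abs u.im)
  linarith

theorem norm_cos_le_exp (u : ℂ) : ‖cos u‖ ≤ Real.exp |u.im| := by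
  rw [Complex.cos, norm_div, Complex.norm_ofNat, div_le_iff₀ two_pos]
  refine (norm_add_le _ _).trans ?_
  rw [Complex.norm_exp, Complex.norm_exp]
  have h1 : Real.exp ((-u * I).re) ≤ Real.exp |u.im| :=
    Real.exp_le_exp.2 (by simpa using le_abs_self u.im)
  have h2 : Real.exp ((u * I).re) ≤ Real.exp |u.im| :=
    Real.exp_le_exp.2 (by simpa using neg_le_abs u.im)
  linarith

theorem one_add_sq_le_exp {δ y : ℝ} (hδ : 0 < δ) (hy : 0 ≤ y) :
    1 + y ^ 2 ≤ (1 + 2 / δ ^ 2) * Real.exp (δ * y) := by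
  have h := Real.quadratic_le_exp_of_nonneg (mul_nonneg hδ.le hy)
  have h1 : 1 ≤ Real.exp (δ * y) := Real.one_le_exp (by positivity)
  have h2 : y ^ 2 ≤ 2 / δ ^ 2 * Real.exp (δ * y) := by
    rw [div_mul_eq_mul_div, le_div_iff₀ (by positivity)]
    nlinarith [mul_nonneg hδ.le hy]
  linarith

theorem exp_neg_le_inv_one_add_sq {δ y : ℝ} (hδ : 0 < δ) (hy : 0 ≤ y) :
    Real.exp (-(δ * y)) ≤ (1 + 2 / δ ^ 2) / (1 + y ^ 2) := by
  rw [le_div_iff₀ (by positivity), Real.exp_neg, inv_mul_le_iff₀ (Real.exp_pos _), mul_comm]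
  exact one_add_sq_le_exp hδ hy

theorem inv_sinh_le {m y : ℝ} (hm : 0 < m) (hy : 1 ≤ y) :
    (Real.sinh (m * y))⁻¹ ≤ 2 / (1 - Real.exp (-(2 * m))) * Real.exp (-(m * y)) := by
  have h0 : Real.exp (-(2 * m)) < 1 := Real.exp_lt_one_iff.2 (by linarith)
  have h1 : Real.exp (-(2 * (m * y))) ≤ Real.exp (-(2 * m)) :=
    Real.exp_le_exp.2 (by nlinarith)
  have h2 : Real.sinh (m * y) = Real.exp (m * y) * (1 - Real.exp (-(2 * (m * y)))) / 2 := by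
    rw [Real.sinh_eq, mul_sub, ← Real.exp_add]
    ring_nf
  have h3 : Real.exp (m * y) * (1 - Real.exp (-(2 * m))) / 2 ≤ Real.sinh (m * y) := by
    rw [h2]; gcongr
  have hpos : 0 < Real.exp (m * y) * (1 - Real.exp (-(2 * m))) / 2 := by
    have := Real.exp_pos (m * y)
    have : 0 < 1 - Real.exp (-(2 * m)) := by linarith
    positivity
  calc (Real.sinh (m * y))⁻¹ ≤ (Real.exp (m * y) * (1 - Real.exp (-(2 * m))) / 2)⁻¹ :=
        inv_anti₀ hpos h3
    _ = _ := by rw [Real.exp_neg (m * y)]; field_simp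

/-! ### The truncated kernel -/

/-- The kernel `1 / (2 sinh (w₁ y) sinh (w₂ y))` with the first `K²` terms of its expansion in
exponentials removed. -/
def kap (K : ℕ) (w₁ w₂ : ℂ) (y : ℝ) : ℂ :=
  (1 - (1 - exp (-(2 * K * y * w₁))) * (1 - exp (-(2 * K * y * w₂))))
    / (2 * sinh (w₁ * y) * sinh (w₂ * y))

/-- The counterterm does not depend on `K`: the removed exponentials are bounded at `y = 0`, so the
kernel keeps its singularity `1 / (2 w₁ w₂ y²)` there, whereas its decay at infinity improves with
`K`. -/
def gInt (K : ℕ) (w₁ w₂ z : ℂ) (y : ℝ) : ℂ :=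
  (sin (2 * y * z) * kap K w₁ w₂ y - z / (w₁ * w₂ * y)) / y

/-- The truncated version of `hypG`. -/
def gTrunc (K : ℕ) (w₁ w₂ z : ℂ) : ℂ := ∫ y in Ioi (0 : ℝ), gInt K w₁ w₂ z y

theorem gTrunc_zero (w₁ w₂ z : ℂ) : gTrunc 0 w₁ w₂ z = hypG w₁ w₂ z := by
  simp [gTrunc, hypG, gInt, kap, div_eq_mul_inv]

theorem gTrunc_neg (K : ℕ) (w₁ w₂ z : ℂ) : gTrunc K w₁ w₂ (-z) = -gTrunc K w₁ w₂ z := by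
  rw [gTrunc, gTrunc, ← integral_neg]
  congr 1
  funext y
  simp only [gInt, mul_neg, Complex.sin_neg]
  ring

theorem norm_kap_le {K : ℕ} {k m₁ m₂ : ℝ} (hm₁ : 0 < m₁) (hm₂ : 0 < m₂) (hk : 0 ≤ k)
    (hk₁ : k ≤ K * m₁) (hk₂ : k ≤ K * m₂) {w₁ w₂ : ℂ} (h₁ : m₁ ≤ w₁.re) (h₂ : m₂ ≤ w₂.re) {y : ℝ}
    (hy : 0 < y) : ‖kap K w₁ w₂ y‖
      ≤ 3 / 2 * Real.exp (-(2 * k * y)) * (Real.sinh (m₁ * y))⁻¹ * (Real.sinh (m₂ * y))⁻¹ := by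
  have hs : ∀ {m : ℝ} {w : ℂ}, m ≤ w.re → Real.sinh (m * y) ≤ ‖sinh (w * y)‖ := by
    intro m w h
    refine le_trans ?_ (sinh_re_le_norm_sinh _)
    rw [Real.sinh_le_sinh]
    simpa using mul_le_mul_of_nonneg_right h hy.le
  have hspos : ∀ {m : ℝ}, 0 < m → 0 < Real.sinh (m * y) := fun hm =>
    Real.sinh_pos_iff.2 (by positivity)
  have he : ∀ {m : ℝ} {w : ℂ}, m ≤ w.re → k ≤ K * m →
      ‖exp (-(2 * K * y * w))‖ ≤ Real.exp (-(2 * k * y)) := by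
    intro m w h hkm
    rw [Complex.norm_exp]
    refine Real.exp_le_exp.2 ?_
    have e : (-(2 * (K : ℂ) * (y : ℂ) * w)).re = -(2 * K * y * w.re) := by
      have : (2 * (K : ℂ) * (y : ℂ) * w) = ((2 * K * y : ℝ) : ℂ) * w := by push_cast; ring
      rw [neg_re, this, re_ofReal_mul]
    rw [e]
    have : k ≤ K * w.re := hkm.trans (mul_le_mul_of_nonneg_left h (Nat.cast_nonneg _))
    nlinarith
  have e1 := he h₁ hk₁
  have e2 := he h₂ hk₂
  have hE1 : Real.exp (-(2 * k * y)) ≤ 1 := Real.exp_le_one_iff.2 (by nlinarith)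
  have hnum : ‖1 - (1 - exp (-(2 * K * y * w₁))) * (1 - exp (-(2 * K * y * w₂)))‖
      ≤ 3 * Real.exp (-(2 * k * y)) := by
    have : 1 - (1 - exp (-(2 * K * y * w₁))) * (1 - exp (-(2 * K * y * w₂)))
      = exp (-(2 * K * y * w₁)) + exp (-(2 * K * y * w₂))
        - exp (-(2 * K * y * w₁)) * exp (-(2 * K * y * w₂)) := by ring
    rw [this]
    refine (norm_sub_le _ _).trans ?_
    rw [norm_mul]
    have := norm_add_le (exp (-(2 * K * y * w₁))) (exp (-(2 * K * y * w₂)))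
    have h3 : ‖exp (-(2 * K * y * w₁))‖ * ‖exp (-(2 * K * y * w₂))‖
        ≤ Real.exp (-(2 * k * y)) * 1 :=
      mul_le_mul e1 (e2.trans hE1) (norm_nonneg _) (Real.exp_pos _).le
    linarith
  rw [kap, norm_div, norm_mul, norm_mul, Complex.norm_ofNat]
  calc _ ≤ 3 * Real.exp (-(2 * k * y)) / (2 * Real.sinh (m₁ * y) * Real.sinh (m₂ * y)) := by
        have := hspos hm₁
        have := hspos hm₂
        gcongr
        · exact hs h₁
        · exact hs h₂
    _ = _ := by
        have := (hspos hm₁).ne'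
        have := (hspos hm₂).ne'
        field_simp

/-- The number `k` is the gain from truncation, and `C` is uniform in `K` and `k`. Against `sin
(2yz)`, which grows like `exp (2 |Im z| y)`, this decay allows `2 |Im z| < m₁ + m₂ + 2k`. -/
theorem exists_norm_kap_le {m₁ m₂ : ℝ} (hm₁ : 0 < m₁) (hm₂ : 0 < m₂) : ∃ C, 0 ≤ C ∧
    ∀ {K : ℕ} {k : ℝ}, 0 ≤ k → k ≤ K * m₁ → k ≤ K * m₂ → ∀ {w₁ w₂ : ℂ}, m₁ ≤ w₁.re → m₂ ≤ w₂.re →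
      ∀ {y : ℝ}, 1 ≤ y → ‖kap K w₁ w₂ y‖ ≤ C * Real.exp (-((m₁ + m₂ + 2 * k) * y)) := by
  have p1 : 0 < 1 - Real.exp (-(2 * m₁)) := by
    have : Real.exp (-(2 * m₁)) < 1 := Real.exp_lt_one_iff.2 (by linarith)
    linarith
  have p2 : 0 < 1 - Real.exp (-(2 * m₂)) := by
    have : Real.exp (-(2 * m₂)) < 1 := Real.exp_lt_one_iff.2 (by linarith)
    linarith
  refine ⟨3 / 2 * (2 / (1 - Real.exp (-(2 * m₁)))) * (2 / (1 - Real.exp (-(2 * m₂)))),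
    by positivity, ?_⟩
  intro K k hk hk₁ hk₂ w₁ w₂ h₁ h₂ y hy
  have hy0 : 0 < y := by linarith
  refine (norm_kap_le hm₁ hm₂ hk hk₁ hk₂ h₁ h₂ hy0).trans ?_
  have i1 := inv_sinh_le hm₁ hy
  have i2 := inv_sinh_le hm₂ hy
  have s1 : 0 < Real.sinh (m₁ * y) := Real.sinh_pos_iff.2 (by positivity)
  have s2 : 0 < Real.sinh (m₂ * y) := Real.sinh_pos_iff.2 (by positivity)
  calc _ ≤ 3 / 2 * Real.exp (-(2 * k * y)) * (2 / (1 - Real.exp (-(2 * m₁))) * Real.exp (-(m₁ * y)))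
        * (2 / (1 - Real.exp (-(2 * m₂))) * Real.exp (-(m₂ * y))) := by gcongr
    _ = 3 / 2 * (2 / (1 - Real.exp (-(2 * m₁)))) * (2 / (1 - Real.exp (-(2 * m₂))))
        * (Real.exp (-(2 * k * y)) * Real.exp (-(m₁ * y)) * Real.exp (-(m₂ * y))) := by ring
    _ = _ := by
      rw [← Real.exp_add, ← Real.exp_add]
      congr 2
      ring

/-- Near `y = 0` the truncated integrand vanishes to first order, uniformly on bounded sets. -/
theorem exists_norm_small_le (K : ℕ) {B m : ℝ} (hB : 0 ≤ B) (hm : 0 < m) : ∃ C, 0 ≤ C ∧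
    ∀ {w₁ w₂ z : ℂ}, ‖w₁‖ ≤ B → ‖w₂‖ ≤ B → ‖z‖ ≤ B → m ≤ w₁.re → m ≤ w₂.re →
      ∀ {y : ℝ}, 0 < y → y ≤ 1 →
        ‖sin (2 * y * z) * kap K w₁ w₂ y - z / (w₁ * w₂ * y)‖ ≤ C * y := by
  set c := 8 * B ^ 3 * Real.exp (2 * B) with hc
  set d := 2 * K * B * Real.exp (2 * K * B) with hd
  have hc0 : 0 ≤ c := by positivity
  have hd0 : 0 ≤ d := by positivity
  refine ⟨(B ^ 2 * c + 4 * B ^ 2 * c + 2 * B * c ^ 2) / (2 * m ^ 4)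
    + (2 * B + c) * d ^ 2 / (2 * m ^ 2), by positivity, ?_⟩
  intro w₁ w₂ z hw₁ hw₂ hz h₁ h₂ y hy hy1
  have hyn : ‖(y : ℂ)‖ = y := by simp [abs_of_pos hy]
  have hs : ∀ {w : ℂ}, m ≤ w.re → m * y ≤ ‖sinh (w * y)‖ := by
    intro w h
    refine le_trans ?_ (sinh_re_le_norm_sinh _)
    refine le_trans ?_ (Real.self_le_sinh_iff.2 ?_)
    · simpa using mul_le_mul_of_nonneg_right h hy.le
    · simpa using mul_nonneg (hm.le.trans h) hy.le
  have hwn : ∀ {w : ℂ}, m ≤ w.re → m ≤ ‖w‖ := fun h => h.trans (re_le_norm _)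
  have he : ∀ {w : ℂ}, ‖w‖ ≤ B → ‖sinh (w * y) - w * y‖ ≤ c * y ^ 3 := by
    intro w hw
    refine (norm_sinh_sub_le _).trans ?_
    have hn : ‖w * y‖ ≤ B * y := by rw [norm_mul, hyn]; gcongr
    have hn' : ‖w * y‖ ≤ 2 * B := by nlinarith
    calc ‖w * y‖ ^ 3 * Real.exp ‖w * y‖ ≤ (B * y) ^ 3 * Real.exp (2 * B) := by gcongr
      _ = B ^ 3 * Real.exp (2 * B) * y ^ 3 := by ring
      _ ≤ c * y ^ 3 := by
        have : 0 ≤ B ^ 3 * Real.exp (2 * B) := by positivity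
        have : 0 ≤ y ^ 3 := by positivity
        rw [hc]
        gcongr
        have : 0 ≤ B ^ 3 := by positivity
        linarith
  have he1 : ‖sin (2 * y * z) - 2 * y * z‖ ≤ c * y ^ 3 := by
    refine (norm_sin_sub_le _).trans ?_
    have hn : ‖2 * (y : ℂ) * z‖ ≤ 2 * y * B := by
      rw [norm_mul, norm_mul, hyn, Complex.norm_ofNat]; gcongr
    have hn' : ‖2 * (y : ℂ) * z‖ ≤ 2 * B := hn.trans (by nlinarith)
    calc ‖2 * (y : ℂ) * z‖ ^ 3 * Real.exp ‖2 * (y : ℂ) * z‖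
        ≤ (2 * y * B) ^ 3 * Real.exp (2 * B) := by gcongr
      _ = c * y ^ 3 := by rw [hc]; ring
  have hE : ∀ {w : ℂ}, ‖w‖ ≤ B → ‖1 - exp (-(2 * K * y * w))‖ ≤ d * y := by
    intro w hw
    rw [norm_sub_rev]
    refine (norm_exp_sub_one_le' _).trans ?_
    have hn : ‖-(2 * (K : ℂ) * y * w)‖ ≤ 2 * K * y * B := by
      rw [norm_neg, norm_mul, norm_mul, norm_mul, hyn, Complex.norm_ofNat, Complex.norm_natCast]
      gcongr
    have hn' : ‖-(2 * (K : ℂ) * y * w)‖ ≤ 2 * K * B := hn.trans (by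
      have : (0 : ℝ) ≤ 2 * K * B := by positivity
      nlinarith)
    calc _ ≤ (2 * K * y * B) * Real.exp (2 * K * B) := by gcongr
      _ = d * y := by rw [hd]; ring
  have hs1 := hs h₁
  have hs2 := hs h₂
  have hmy : 0 < m * y := by positivity
  have s1 : sinh (w₁ * y) ≠ 0 := norm_pos_iff.1 (hmy.trans_le hs1)
  have s2 : sinh (w₂ * y) ≠ 0 := norm_pos_iff.1 (hmy.trans_le hs2)
  have hw1 : w₁ ≠ 0 := norm_pos_iff.1 (hm.trans_le (hwn h₁))
  have hw2 : w₂ ≠ 0 := norm_pos_iff.1 (hm.trans_le (hwn h₂))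
  have hy' : (y : ℂ) ≠ 0 := ofReal_ne_zero.2 hy.ne'
  -- In the first fraction the leading terms of `sin` and of the product of the `sinh` have
  -- cancelled: its numerator is `O(y⁴)` over a denominator of size `y³`. The second fraction is the
  -- effect of truncation, `O(y³)` over `y²`.
  have hsplit : sin (2 * y * z) * kap K w₁ w₂ y - z / (w₁ * w₂ * y)
      = (w₁ * w₂ * y * (sin (2 * y * z) - 2 * y * z)
          - 2 * z * (w₁ * y * (sinh (w₂ * y) - w₂ * y) + w₂ * y * (sinh (w₁ * y) - w₁ * y)
            + (sinh (w₁ * y) - w₁ * y) * (sinh (w₂ * y) - w₂ * y)))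
          / (2 * sinh (w₁ * y) * sinh (w₂ * y) * (w₁ * w₂ * y))
        - (2 * y * z + (sin (2 * y * z) - 2 * y * z)) *
          ((1 - exp (-(2 * K * y * w₁))) * (1 - exp (-(2 * K * y * w₂))))
          / (2 * sinh (w₁ * y) * sinh (w₂ * y)) := by
    rw [kap]
    clear_value c d
    generalize sinh (w₁ * y) = S₁ at s1 ⊢
    generalize sinh (w₂ * y) = S₂ at s2 ⊢
    field_simp
    ring
  rw [hsplit]
  refine (norm_sub_le _ _).trans ?_
  set e1 := sin (2 * y * z) - 2 * y * z
  set e2 := sinh (w₁ * y) - w₁ * y with he2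
  set e3 := sinh (w₂ * y) - w₂ * y with he3
  have b2 : ‖e2‖ ≤ c * y ^ 3 := he hw₁
  have b3 : ‖e3‖ ≤ c * y ^ 3 := he hw₂
  refine (add_le_add (b := (B ^ 2 * c + 4 * B ^ 2 * c + 2 * B * c ^ 2) / (2 * m ^ 4) * y)
    (d := (2 * B + c) * d ^ 2 / (2 * m ^ 2) * y) ?_ ?_).trans_eq (add_mul _ _ _).symm
  · rw [norm_div, div_le_iff₀ (norm_pos_iff.2 (by simp [s1, s2, hw1, hw2, hy.ne']))]
    have hnum : ‖w₁ * w₂ * y * e1 - 2 * z * (w₁ * y * e3 + w₂ * y * e2 + e2 * e3)‖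
        ≤ (B ^ 2 * c + 4 * B ^ 2 * c + 2 * B * c ^ 2) * y ^ 4 := by
      refine (norm_sub_le _ _).trans ?_
      have a1 : ‖w₁ * w₂ * y * e1‖ ≤ B * B * y * (c * y ^ 3) := by
        rw [norm_mul, norm_mul, norm_mul, hyn]; gcongr
      have a2 : ‖w₁ * y * e3 + w₂ * y * e2 + e2 * e3‖
          ≤ B * y * (c * y ^ 3) + B * y * (c * y ^ 3) + (c * y ^ 3) * (c * y ^ 3) := by
        refine (norm_add₃_le).trans ?_
        simp only [norm_mul, hyn]
        gcongr
      have a3 : ‖2 * z * (w₁ * y * e3 + w₂ * y * e2 + e2 * e3)‖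
          ≤ 2 * B * (B * y * (c * y ^ 3) + B * y * (c * y ^ 3) + (c * y ^ 3) * (c * y ^ 3)) := by
        rw [norm_mul, norm_mul, Complex.norm_ofNat]
        gcongr
      have hy6 : y ^ 6 ≤ y ^ 4 := pow_le_pow_of_le_one hy.le hy1 (by norm_num)
      have : 2 * B * c ^ 2 * y ^ 6 ≤ 2 * B * c ^ 2 * y ^ 4 := by gcongr
      nlinarith
    refine hnum.trans ?_
    have hden : 2 * (m * y) * (m * y) * (m * m * y)
        ≤ ‖2 * sinh (w₁ * y) * sinh (w₂ * y) * (w₁ * w₂ * y)‖ := by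
      simp only [norm_mul, hyn, Complex.norm_ofNat]
      have := hwn h₁
      have := hwn h₂
      gcongr
    calc _ = (B ^ 2 * c + 4 * B ^ 2 * c + 2 * B * c ^ 2) / (2 * m ^ 4) * y
          * (2 * (m * y) * (m * y) * (m * m * y)) := by field_simp
      _ ≤ _ := by gcongr
  · rw [norm_div, div_le_iff₀ (norm_pos_iff.2 (by simp [s1, s2]))]
    have hnum : ‖(2 * y * z + e1) *
        ((1 - exp (-(2 * K * y * w₁))) * (1 - exp (-(2 * K * y * w₂))))‖
        ≤ ((2 * B + c) * y) * ((d * y) * (d * y)) := by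
      rw [norm_mul, norm_mul]
      have a1 : ‖2 * y * z + e1‖ ≤ (2 * B + c) * y := by
        refine (norm_add_le _ _).trans ?_
        have : ‖2 * (y : ℂ) * z‖ ≤ 2 * y * B := by
          rw [norm_mul, norm_mul, hyn, Complex.norm_ofNat]; gcongr
        have hy3 : y ^ 3 ≤ y ^ 1 := pow_le_pow_of_le_one hy.le hy1 (by norm_num)
        have : c * y ^ 3 ≤ c * y ^ 1 := by gcongr
        nlinarith
      have := hE hw₁
      have := hE hw₂
      gcongr
    refine hnum.trans ?_
    have hden : 2 * (m * y) * (m * y) ≤ ‖2 * sinh (w₁ * y) * sinh (w₂ * y)‖ := by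
      simp only [norm_mul, Complex.norm_ofNat]
      gcongr
    calc _ = (2 * B + c) * d ^ 2 / (2 * m ^ 2) * y * (2 * (m * y) * (m * y)) := by field_simp
      _ ≤ _ := by gcongr

/-- The range is split at `y = 1`: below it the first-order vanishing at the origin absorbs the
factor `1 / y`, above it the exponential decay dominates and the counterterm is `O(1 / y²)`. The
bound is uniform on bounded sets of parameters, which gives both integrability and holomorphy of
`gTrunc`. -/
theorem exists_norm_gInt_le (K : ℕ) {B m₁ m₂ k δ : ℝ} (hB : 0 ≤ B) (hm₁ : 0 < m₁) (hm₂ : 0 < m₂)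
    (hk : 0 ≤ k) (hk₁ : k ≤ K * m₁) (hk₂ : k ≤ K * m₂) (hδ : 0 < δ) : ∃ C, 0 ≤ C ∧
    ∀ {w₁ w₂ z : ℂ}, ‖w₁‖ ≤ B → ‖w₂‖ ≤ B → ‖z‖ ≤ B → m₁ ≤ w₁.re → m₂ ≤ w₂.re →
      2 * |z.im| + δ ≤ m₁ + m₂ + 2 * k → ∀ {y : ℝ}, 0 < y →
        ‖gInt K w₁ w₂ z y‖ ≤ C / (1 + y ^ 2) := by
  obtain ⟨C₁, hC₁, h1⟩ := exists_norm_small_le K hB (lt_min hm₁ hm₂)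
  obtain ⟨C₂, hC₂, h2⟩ := exists_norm_kap_le hm₁ hm₂
  set C₃ := B / (m₁ * m₂) with hC₃
  have hC₃0 : 0 ≤ C₃ := by positivity
  refine ⟨2 * C₁ + C₂ * (1 + 2 / δ ^ 2) + 2 * C₃, by positivity, ?_⟩
  intro w₁ w₂ z hw₁ hw₂ hz hr₁ hr₂ him y hy
  have hyn : ‖(y : ℂ)‖ = y := by simp [abs_of_pos hy]
  have hD : 0 ≤ C₂ * (1 + 2 / δ ^ 2) := by positivity
  rw [gInt, norm_div, hyn]
  rcases le_total y 1 with hy1 | hy1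
  · have := h1 hw₁ hw₂ hz ((min_le_left _ _).trans hr₁) ((min_le_right _ _).trans hr₂) hy hy1
    rw [div_le_iff₀ hy]
    refine this.trans ?_
    rw [div_mul_eq_mul_div, le_div_iff₀ (by positivity)]
    have : y ^ 2 ≤ 1 := by nlinarith
    nlinarith [mul_nonneg hC₁ hy.le, mul_nonneg hD hy.le, mul_nonneg hC₃0 hy.le]
  · have hk' := h2 hk hk₁ hk₂ hr₁ hr₂ hy1
    have hsin : ‖sin (2 * y * z)‖ ≤ Real.exp (2 * |z.im| * y) := by
      refine (norm_sin_le_exp _).trans (Real.exp_le_exp.2 (le_of_eq ?_))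
      have : (2 * (y : ℂ) * z).im = 2 * y * z.im := by
        rw [show (2 * (y : ℂ) * z) = ((2 * y : ℝ) : ℂ) * z by push_cast; ring, im_ofReal_mul]
      rw [this, abs_mul, abs_of_pos (by positivity : 0 < 2 * y)]
      ring
    have hA : ‖sin (2 * y * z) * kap K w₁ w₂ y‖ ≤ C₂ * ((1 + 2 / δ ^ 2) / (1 + y ^ 2)) := by
      rw [norm_mul]
      calc _ ≤ Real.exp (2 * |z.im| * y) * (C₂ * Real.exp (-((m₁ + m₂ + 2 * k) * y))) := by gcongr
        _ = C₂ * Real.exp (-((m₁ + m₂ + 2 * k - 2 * |z.im|) * y)) := by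
          rw [mul_left_comm, ← Real.exp_add]; congr 2; ring
        _ ≤ C₂ * Real.exp (-(δ * y)) := by
          gcongr; linarith
        _ ≤ _ := by gcongr; exact exp_neg_le_inv_one_add_sq hδ hy.le
    have hZ : ‖z / (w₁ * w₂ * y)‖ ≤ C₃ / y := by
      rw [norm_div, norm_mul, norm_mul, hyn, hC₃, div_div]
      have := hr₁.trans (re_le_norm _)
      have := hr₂.trans (re_le_norm _)
      gcongr
    have hinv : C₃ / y / y ≤ 2 * C₃ / (1 + y ^ 2) := by
      rw [div_div, div_le_div_iff₀ (by positivity) (by positivity)]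
      have : 1 ≤ y * y := by nlinarith
      nlinarith
    have hDy : C₂ * ((1 + 2 / δ ^ 2) / (1 + y ^ 2)) / y ≤ C₂ * ((1 + 2 / δ ^ 2) / (1 + y ^ 2)) :=
      div_le_self (by positivity) hy1
    calc _ ≤ (C₂ * ((1 + 2 / δ ^ 2) / (1 + y ^ 2)) + C₃ / y) / y := by
          gcongr
          exact (norm_sub_le _ _).trans (add_le_add hA hZ)
      _ = C₂ * ((1 + 2 / δ ^ 2) / (1 + y ^ 2)) / y + C₃ / y / y := by rw [add_div]
      _ ≤ C₂ * ((1 + 2 / δ ^ 2) / (1 + y ^ 2)) + 2 * C₃ / (1 + y ^ 2) := add_le_add hDy hinv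
      _ ≤ 2 * C₁ / (1 + y ^ 2) + (C₂ * ((1 + 2 / δ ^ 2) / (1 + y ^ 2)) + 2 * C₃ / (1 + y ^ 2)) :=
          le_add_of_nonneg_left (by positivity)
      _ = _ := by ring

theorem sinh_mul_ne_zero {w : ℂ} (hw : 0 < w.re) {y : ℝ} (hy : 0 < y) : sinh (w * y) ≠ 0 := by
  refine norm_pos_iff.1 (lt_of_lt_of_le ?_ (sinh_re_le_norm_sinh _))
  rw [Real.sinh_pos_iff]
  simpa using mul_pos hw hy

theorem ne_zero_of_re_pos {w : ℂ} (hw : 0 < w.re) : w ≠ 0 := by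
  rintro rfl
  simp at hw

theorem measurable_gInt (K : ℕ) (w₁ w₂ z : ℂ) : Measurable (gInt K w₁ w₂ z) := by
  unfold gInt kap
  fun_prop

/-- Holomorphy is joint in the two periods and the argument, on a strip of half-width `(m₁ + m₂) / 2
+ k`; this joint form is what the continuation in all parameters needs. -/
theorem differentiableAt_gTrunc (K : ℕ) {m₁ m₂ k : ℝ} (hm₁ : 0 < m₁) (hm₂ : 0 < m₂)
    (hk : 0 ≤ k) (hk₁ : k ≤ K * m₁) (hk₂ : k ≤ K * m₂) {w₁ w₂ z : ℂ} (h₁ : m₁ < w₁.re)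
    (h₂ : m₂ < w₂.re) (hz : 2 * |z.im| < m₁ + m₂ + 2 * k) :
    DifferentiableAt ℂ (fun q : ℂ × ℂ × ℂ => gTrunc K q.1 q.2.1 q.2.2) (w₁, w₂, z) := by
  obtain ⟨δ, hδ, hδ'⟩ : ∃ δ > 0, 2 * |z.im| + δ < m₁ + m₂ + 2 * k :=
    ⟨(m₁ + m₂ + 2 * k - 2 * |z.im|) / 2, by linarith, by linarith⟩
  set B := ‖w₁‖ + ‖w₂‖ + ‖z‖ + 1 with hB
  have hB0 : 0 ≤ B := by positivity
  obtain ⟨C, hC, hb⟩ := exists_norm_gInt_le K hB0 hm₁ hm₂ hk hk₁ hk₂ hδ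
  set U : Set (ℂ × ℂ × ℂ) := {q | ‖q.1‖ < B ∧ ‖q.2.1‖ < B ∧ ‖q.2.2‖ < B ∧ m₁ < q.1.re ∧
    m₂ < q.2.1.re ∧ 2 * |q.2.2.im| + δ < m₁ + m₂ + 2 * k} with hU
  have hUo : IsOpen U := by
    have o1 : IsOpen {q : ℂ × ℂ × ℂ | ‖q.1‖ < B} := isOpen_lt (by fun_prop) (by fun_prop)
    have o2 : IsOpen {q : ℂ × ℂ × ℂ | ‖q.2.1‖ < B} := isOpen_lt (by fun_prop) (by fun_prop)
    have o3 : IsOpen {q : ℂ × ℂ × ℂ | ‖q.2.2‖ < B} := isOpen_lt (by fun_prop) (by fun_prop)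
    have o4 : IsOpen {q : ℂ × ℂ × ℂ | m₁ < q.1.re} := isOpen_lt (by fun_prop) (by fun_prop)
    have o5 : IsOpen {q : ℂ × ℂ × ℂ | m₂ < q.2.1.re} := isOpen_lt (by fun_prop) (by fun_prop)
    have o6 : IsOpen {q : ℂ × ℂ × ℂ | 2 * |q.2.2.im| + δ < m₁ + m₂ + 2 * k} :=
      isOpen_lt (by fun_prop) (by fun_prop)
    exact o1.inter (o2.inter (o3.inter (o4.inter (o5.inter o6))))
  have hmem : (w₁, w₂, z) ∈ U := by
    refine ⟨?_, ?_, ?_, h₁, h₂, hδ'⟩ <;> simp only [hB] <;>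
      linarith [norm_nonneg w₁, norm_nonneg w₂, norm_nonneg z]
  have hint : Integrable (fun y : ℝ => C * (1 + y ^ 2)⁻¹) (volume.restrict (Ioi 0)) :=
    (integrable_inv_one_add_sq.const_mul C).restrict
  refine (differentiableOn_integral (F := fun (q : ℂ × ℂ × ℂ) y => gInt K q.1 q.2.1 q.2.2 y)
    hUo hint (fun p _ => (measurable_gInt _ _ _ _).aestronglyMeasurable) ?_ ?_).differentiableAt
    (hUo.mem_nhds hmem)
  · filter_upwards [self_mem_ae_restrict measurableSet_Ioi] with y hy q hq
    have hy : 0 < y := hy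
    obtain ⟨-, -, -, q1, q2, -⟩ := hq
    have s1 := sinh_mul_ne_zero (hm₁.trans q1) hy
    have s2 := sinh_mul_ne_zero (hm₂.trans q2) hy
    have n1 := ne_zero_of_re_pos (hm₁.trans q1)
    have n2 := ne_zero_of_re_pos (hm₂.trans q2)
    have hy' : (y : ℂ) ≠ 0 := ofReal_ne_zero.2 hy.ne'
    refine DifferentiableAt.differentiableWithinAt ?_
    unfold gInt kap
    fun_prop (disch := simp [s1, s2, n1, n2, hy.ne'])
  · filter_upwards [self_mem_ae_restrict measurableSet_Ioi] with y hy q hq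
    obtain ⟨q1, q2, q3, q4, q5, q6⟩ := hq
    rw [← div_eq_mul_inv]
    exact hb q1.le q2.le q3.le q4.le q5.le q6.le hy

theorem integrableOn_gInt (K : ℕ) {m₁ m₂ k : ℝ} (hm₁ : 0 < m₁) (hm₂ : 0 < m₂)
    (hk : 0 ≤ k) (hk₁ : k ≤ K * m₁) (hk₂ : k ≤ K * m₂) {w₁ w₂ z : ℂ} (h₁ : m₁ ≤ w₁.re)
    (h₂ : m₂ ≤ w₂.re) (hz : 2 * |z.im| < m₁ + m₂ + 2 * k) :
    IntegrableOn (gInt K w₁ w₂ z) (Ioi 0) := by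
  obtain ⟨C, hC, hb⟩ := exists_norm_gInt_le K (B := ‖w₁‖ + ‖w₂‖ + ‖z‖) (by positivity) hm₁ hm₂ hk
    hk₁ hk₂ (δ := m₁ + m₂ + 2 * k - 2 * |z.im|) (by linarith)
  refine Integrable.mono' (g := fun y : ℝ => C * (1 + y ^ 2)⁻¹)
    (integrable_inv_one_add_sq.const_mul C).restrict
    (measurable_gInt _ _ _ _).aestronglyMeasurable ?_
  filter_upwards [self_mem_ae_restrict measurableSet_Ioi] with y hy
  rw [← div_eq_mul_inv]
  exact hb (by linarith [norm_nonneg w₂, norm_nonneg z]) (by linarith [norm_nonneg w₁, norm_nonneg z])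
    (by linarith [norm_nonneg w₁, norm_nonneg w₂]) h₁ h₂ (by linarith) hy

theorem integrableOn_gInt_of_abs_im_lt (K : ℕ) {w₁ w₂ z : ℂ} (h₁ : 0 < w₁.re) (h₂ : 0 < w₂.re)
    (hz : |z.im| < (wMean w₁ w₂).re) : IntegrableOn (gInt K w₁ w₂ z) (Ioi 0) := by
  have e : (wMean w₁ w₂).re = (w₁.re + w₂.re) / 2 := by simp [wMean]
  exact integrableOn_gInt K h₁ h₂ le_rfl (by positivity) (by positivity) le_rfl le_rfl
    (by linarith)

/-! ### A complex Frullani integral -/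

/-- The factor `‖u‖` compensates a division by `y` at the origin while the exponential rate at
infinity stays `|Im u|`. -/
theorem norm_sin_le_mul_exp (u : ℂ) : ‖sin u‖ ≤ 4 * ‖u‖ * Real.exp |u.im| := by
  have h1 : 1 ≤ Real.exp |u.im| := Real.one_le_exp (abs_nonneg _)
  rcases le_total 1 ‖u‖ with h | h
  · refine (norm_sin_le_exp u).trans ?_
    nlinarith [Real.exp_pos |u.im|]
  · have h2 := norm_sin_sub_le u
    have h3 : ‖sin u‖ ≤ ‖sin u - u‖ + ‖u‖ := by
      simpa using norm_add_le (sin u - u) u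
    have h4 : Real.exp ‖u‖ ≤ 3 :=
      (Real.exp_le_exp.2 h).trans (by linarith [Real.exp_one_lt_d9])
    have h5 : ‖u‖ ^ 3 ≤ ‖u‖ := by
      simpa using pow_le_pow_of_le_one (norm_nonneg u) h (by norm_num : 1 ≤ 3)
    have h6 : ‖u‖ ^ 3 * Real.exp ‖u‖ ≤ ‖u‖ * 3 := by gcongr
    nlinarith [norm_nonneg u]

theorem im_two_mul_mul (y : ℝ) (z : ℂ) : (2 * (y : ℂ) * z).im = 2 * y * z.im := by
  rw [show (2 * (y : ℂ) * z) = ((2 * y : ℝ) : ℂ) * z by push_cast; ring, im_ofReal_mul]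

theorem re_two_mul_mul (y : ℝ) (z : ℂ) : (2 * (y : ℂ) * z).re = 2 * y * z.re := by
  rw [show (2 * (y : ℂ) * z) = ((2 * y : ℝ) : ℂ) * z by push_cast; ring, re_ofReal_mul]

theorem integrableOn_exp_neg_mul {δ : ℝ} (hδ : 0 < δ) :
    IntegrableOn (fun y : ℝ => Real.exp (-(δ * y))) (Ioi 0) := by
  simpa only [neg_mul] using integrableOn_exp_mul_Ioi (neg_neg_iff_pos.2 hδ) 0

theorem norm_exp_two_mul (y : ℝ) (A : ℂ) : ‖exp (-(2 * y * A))‖ = Real.exp (-(2 * y * A.re)) := by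
  rw [Complex.norm_exp, neg_re, re_two_mul_mul]

def frInt (A z : ℂ) (y : ℝ) : ℂ := 2 * sin (2 * y * z) * exp (-(2 * y * A)) / y

theorem norm_frInt_le (A z : ℂ) {y : ℝ} (hy : 0 < y) :
    ‖frInt A z y‖ ≤ 16 * ‖z‖ * Real.exp (-(2 * (A.re - |z.im|) * y)) := by
  rw [frInt, norm_div, norm_mul, norm_mul, norm_exp_two_mul, Complex.norm_ofNat,
    Complex.norm_of_nonneg hy.le, div_le_iff₀ hy]
  have h := norm_sin_le_mul_exp (2 * y * z)
  rw [im_two_mul_mul, abs_mul, abs_of_pos (by positivity : 0 < 2 * y), norm_mul, norm_mul,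
    Complex.norm_ofNat, Complex.norm_of_nonneg hy.le] at h
  calc _ ≤ 2 * (4 * (2 * y * ‖z‖) * Real.exp (2 * y * |z.im|)) * Real.exp (-(2 * y * A.re)) := by
        gcongr
    _ = 16 * ‖z‖ * (Real.exp (2 * y * |z.im|) * Real.exp (-(2 * y * A.re))) * y := by ring
    _ = _ := by rw [← Real.exp_add]; ring_nf

theorem measurable_frInt (A z : ℂ) : Measurable (frInt A z) := by
  unfold frInt
  fun_prop

theorem integrableOn_frInt {A z : ℂ} (h : |z.im| < A.re) : IntegrableOn (frInt A z) (Ioi 0) := by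
  refine Integrable.mono'
    ((integrableOn_exp_neg_mul (δ := 2 * (A.re - |z.im|)) (by linarith)).const_mul (16 * ‖z‖))
    (measurable_frInt A z).aestronglyMeasurable ?_
  filter_upwards [self_mem_ae_restrict measurableSet_Ioi] with y hy
  exact norm_frInt_le A z hy

theorem integral_cos_mul_exp {A z : ℂ} (h : |z.im| < A.re) :
    ∫ y in Ioi (0 : ℝ), 4 * cos (2 * y * z) * exp (-(2 * y * A)) = 1 / (A - I * z) + 1 / (A + I * z) := by
  have hp : (-(2 * A) + 2 * I * z).re < 0 := by
    simp; linarith [neg_abs_le z.im]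
  have hq : (-(2 * A) - 2 * I * z).re < 0 := by
    simp; linarith [le_abs_self z.im]
  have e : ∀ y : ℝ, 4 * cos (2 * y * z) * exp (-(2 * y * A))
      = 2 * exp ((-(2 * A) + 2 * I * z) * y) + 2 * exp ((-(2 * A) - 2 * I * z) * y) := by
    intro y
    rw [Complex.cos, show (-(2 * A) + 2 * I * z) * y = 2 * y * z * I + -(2 * y * A) by ring,
      show (-(2 * A) - 2 * I * z) * y = -(2 * y * z) * I + -(2 * y * A) by ring, Complex.exp_add,
      Complex.exp_add]
    ring
  simp_rw [e]
  rw [integral_add ((integrableOn_exp_mul_complex_Ioi hp 0).const_mul 2)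
    ((integrableOn_exp_mul_complex_Ioi hq 0).const_mul 2), integral_const_mul, integral_const_mul,
    integral_exp_mul_complex_Ioi hp, integral_exp_mul_complex_Ioi hq]
  have n1 : A - I * z ≠ 0 := by
    intro h0
    apply hp.ne
    rw [show -(2 * A) + 2 * I * z = -2 * (A - I * z) by ring, h0]; simp
  have n2 : A + I * z ≠ 0 := by
    intro h0
    apply hq.ne
    rw [show -(2 * A) - 2 * I * z = -2 * (A + I * z) by ring, h0]; simp
  rw [show -(2 * A) + 2 * I * z = -2 * (A - I * z) by ring,
    show -(2 * A) - 2 * I * z = -2 * (A + I * z) by ring]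
  simp only [ofReal_zero, mul_zero, Complex.exp_zero]
  field_simp

theorem isOpen_strip (a : ℝ) : IsOpen {z : ℂ | |z.im| < a} := isOpen_lt (by fun_prop) (by fun_prop)

theorem convex_strip (a : ℝ) : Convex ℝ {z : ℂ | |z.im| < a} := by
  have : {z : ℂ | |z.im| < a} = Complex.imLm ⁻¹' (Metric.ball 0 a) := by
    ext z; simp [Real.norm_eq_abs]
  rw [this]
  exact (convex_ball 0 a).linear_preimage _

theorem hasDerivAt_integral_frInt {A z : ℂ} (h : |z.im| < A.re) :
    HasDerivAt (fun z => ∫ y in Ioi (0 : ℝ), frInt A z y) (1 / (A - I * z) + 1 / (A + I * z)) z := by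
  set δ := (A.re - |z.im|) / 2 with hδ
  have hδ0 : 0 < δ := by rw [hδ]; linarith
  have key := hasDerivAt_integral_of_dominated_loc_of_deriv_le (𝕜 := ℂ)
    (μ := volume.restrict (Ioi (0 : ℝ))) (F := fun z y => frInt A z y)
    (F' := fun z y => 4 * cos (2 * y * z) * exp (-(2 * y * A))) (x₀ := z)
    (s := {x : ℂ | |x.im| < A.re - δ}) (bound := fun y => 4 * Real.exp (-((2 * δ) * y)))
    ((isOpen_strip _).mem_nhds (by simp only [mem_ofPred_eq]; linarith))
    (Eventually.of_forall fun x => (measurable_frInt A x).aestronglyMeasurable)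
    (integrableOn_frInt h) (by fun_prop) ?_
    ((integrableOn_exp_neg_mul (by linarith)).const_mul 4) ?_
  · rw [← integral_cos_mul_exp h]
    exact key.2
  · filter_upwards [self_mem_ae_restrict measurableSet_Ioi] with y hy x hx
    have hy : 0 < y := hy
    have hx : |x.im| < A.re - δ := hx
    rw [norm_mul, norm_mul, norm_exp_two_mul, Complex.norm_ofNat]
    have hc := norm_cos_le_exp (2 * y * x)
    rw [im_two_mul_mul, abs_mul, abs_of_pos (by positivity : 0 < 2 * y)] at hc
    calc _ ≤ 4 * Real.exp (2 * y * |x.im|) * Real.exp (-(2 * y * A.re)) := by gcongr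
      _ = 4 * Real.exp (2 * y * |x.im| + -(2 * y * A.re)) := by rw [Real.exp_add]; ring
      _ ≤ _ := by gcongr; nlinarith
  · filter_upwards [self_mem_ae_restrict measurableSet_Ioi] with y hy x hx
    have hy' : (y : ℂ) ≠ 0 := ofReal_ne_zero.2 (ne_of_gt hy)
    have h1 : HasDerivAt (fun x : ℂ => 2 * (y : ℂ) * x) (2 * y) x := by
      simpa using (hasDerivAt_id x).const_mul (2 * (y : ℂ))
    have h2 := ((h1.csin.const_mul 2).mul_const (exp (-(2 * y * A)))).div_const (y : ℂ)
    refine h2.congr_deriv ?_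
    field_simp
    ring

theorem one_sub_I_mul_ne_zero {A z : ℂ} (h : |z.im| < A.re) : A - I * z ≠ 0 := by
  refine ne_zero_of_re_pos ?_
  simp; linarith [neg_abs_le z.im]

theorem one_add_I_mul_ne_zero {A z : ℂ} (h : |z.im| < A.re) : A + I * z ≠ 0 := by
  refine ne_zero_of_re_pos ?_
  simp; linarith [le_abs_self z.im]

/-- Exponentiating avoids every choice of logarithm: the derivative of the integral is `1 / (A - iz)
+ 1 / (A + iz)`, so `exp (i ∫) (A - iz) / (A + iz)` has derivative zero on the strip, and its value
at `z = 0` is `1`. -/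
theorem exp_integral_frInt {A z : ℂ} (h : |z.im| < A.re) :
    exp (I * ∫ y in Ioi (0 : ℝ), frInt A z y) = (A + I * z) / (A - I * z) := by
  have hd : ∀ x ∈ {x : ℂ | |x.im| < A.re}, HasDerivAt
      (fun x => exp (I * ∫ y in Ioi (0 : ℝ), frInt A x y) * ((A - I * x) / (A + I * x))) 0 x := by
    intro x hx
    have n1 := one_sub_I_mul_ne_zero hx
    have n2 := one_add_I_mul_ne_zero hx
    have h1 := ((hasDerivAt_integral_frInt hx).const_mul I).cexp
    have h2 : HasDerivAt (fun x => A - I * x) (-I) x := by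
      simpa using ((hasDerivAt_id x).const_mul I).const_sub A
    have h3 : HasDerivAt (fun x => A + I * x) I x := by
      simpa using ((hasDerivAt_id x).const_mul I).const_add A
    refine (h1.mul (h2.fun_div h3 n2)).congr_deriv ?_
    field_simp
    ring
  have h0 : (0 : ℂ) ∈ {x : ℂ | |x.im| < A.re} := by
    simpa using (abs_nonneg _).trans_lt h
  have hc := (isOpen_strip A.re).is_const_of_deriv_eq_zero (convex_strip A.re).isPreconnected
    (fun x hx => (hd x hx).differentiableAt.differentiableWithinAt)
    (fun x hx => (hd x hx).deriv) (x := z) (y := 0) h h0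
  have n1 := one_sub_I_mul_ne_zero h
  have n2 := one_add_I_mul_ne_zero h
  have hA : A ≠ 0 := by simpa using one_sub_I_mul_ne_zero (A := A) (z := 0) h0
  simp [frInt, hA] at hc
  rw [eq_div_iff n1]
  simp only [frInt]
  field_simp at hc
  exact hc

/-! ### The product formula -/

def poleA (w₁ w₂ : ℂ) (i : ℕ × ℕ) : ℂ := (i.1 + 1 / 2) * w₁ + (i.2 + 1 / 2) * w₂

/-- The polynomial in `t` whose zeros are the poles `-i A_{kl}`, `k, l < K`, of `G`. -/
def polePoly (K : ℕ) (w₁ w₂ t : ℂ) : ℂ :=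
  ∏ i ∈ Finset.range K ×ˢ Finset.range K, (poleA w₁ w₂ i - I * t)

theorem re_poleA_ge {w₁ w₂ : ℂ} (h₁ : 0 < w₁.re) (h₂ : 0 < w₂.re) (i : ℕ × ℕ) :
    (wMean w₁ w₂).re ≤ (poleA w₁ w₂ i).re := by
  have e1 : (wMean w₁ w₂).re = (w₁.re + w₂.re) / 2 := by simp [wMean]
  have e2 : (poleA w₁ w₂ i).re = (i.1 + 1 / 2) * w₁.re + (i.2 + 1 / 2) * w₂.re := by
    have : poleA w₁ w₂ i = ((i.1 + 1 / 2 : ℝ) : ℂ) * w₁ + ((i.2 + 1 / 2 : ℝ) : ℂ) * w₂ := by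
      simp [poleA]
    rw [this, add_re, re_ofReal_mul, re_ofReal_mul]
  rw [e1, e2]
  have : (0 : ℝ) ≤ i.1 * w₁.re := by positivity
  have : (0 : ℝ) ≤ i.2 * w₂.re := by positivity
  linarith

theorem sum_exp_mul_sinh (K : ℕ) (v : ℂ) :
    (∑ k ∈ Finset.range K, exp (-((2 * k + 1) * v))) * (2 * sinh v) = 1 - exp (-(2 * K * v)) := by
  induction K with
  | zero => simp
  | succ K ih =>
    rw [Finset.sum_range_succ, add_mul, ih]
    have e1 : exp (-((2 * K + 1) * v)) * (2 * sinh v)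
        = exp (-(2 * K * v)) - exp (-(2 * (K + 1) * v)) := by
      rw [Complex.sinh, show -((2 * (K : ℂ) + 1) * v) = -(2 * K * v) + -v by ring,
        show -(2 * ((K : ℂ) + 1) * v) = -(2 * K * v) + -v + -v by ring, Complex.exp_add,
        Complex.exp_add, Complex.exp_add]
      have : exp v * exp (-v) = 1 := by rw [← Complex.exp_add]; simp
      linear_combination exp (-(2 * K * v)) * this
    rw [e1]
    push_cast
    ring

/-- By `sum_exp_mul_sinh` each quotient `(1 - exp (-2K y wⱼ)) / (2 sinh (wⱼ y))` is a finite
geometric sum, and the product of the two sums runs over a square of `K²` index pairs. -/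
theorem kap_zero_sub_kap (K : ℕ) {w₁ w₂ : ℂ} (h₁ : 0 < w₁.re) (h₂ : 0 < w₂.re) {y : ℝ} (hy : 0 < y) :
    kap 0 w₁ w₂ y - kap K w₁ w₂ y
      = ∑ i ∈ Finset.range K ×ˢ Finset.range K, 2 * exp (-(2 * y * poleA w₁ w₂ i)) := by
  have s1 := sinh_mul_ne_zero h₁ hy
  have s2 := sinh_mul_ne_zero h₂ hy
  have e1 := sum_exp_mul_sinh K (w₁ * y)
  have e2 := sum_exp_mul_sinh K (w₂ * y)
  have hs : ∑ i ∈ Finset.range K ×ˢ Finset.range K, 2 * exp (-(2 * y * poleA w₁ w₂ i))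
      = 2 * ((∑ k ∈ Finset.range K, exp (-((2 * k + 1) * (w₁ * y))))
        * ∑ k ∈ Finset.range K, exp (-((2 * k + 1) * (w₂ * y)))) := by
    rw [Finset.sum_mul_sum, Finset.sum_product, Finset.mul_sum]
    refine Finset.sum_congr rfl fun k _ => ?_
    rw [Finset.mul_sum]
    refine Finset.sum_congr rfl fun l _ => ?_
    rw [← Complex.exp_add, poleA]
    ring_nf
  rw [hs, kap, kap, show -(2 * (K : ℂ) * y * w₁) = -(2 * K * (w₁ * y)) by ring,
    show -(2 * (K : ℂ) * y * w₂) = -(2 * K * (w₂ * y)) by ring, ← e1, ← e2]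
  simp only [Nat.cast_zero, mul_zero, zero_mul, neg_zero, Complex.exp_zero, sub_self, sub_zero]
  generalize sinh (w₁ * y) = S₁ at s1 ⊢
  generalize sinh (w₂ * y) = S₂ at s2 ⊢
  generalize ∑ k ∈ Finset.range K, exp (-((2 * k + 1) * (w₁ * y))) = T₁
  generalize ∑ k ∈ Finset.range K, exp (-((2 * k + 1) * (w₂ * y))) = T₂
  field_simp
  ring

theorem polePoly_ne_zero {w₁ w₂ t : ℂ} (h₁ : 0 < w₁.re) (h₂ : 0 < w₂.re) (K : ℕ)
    (ht : |t.im| < (wMean w₁ w₂).re) : polePoly K w₁ w₂ t ≠ 0 :=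
  Finset.prod_ne_zero_iff.2 fun i _ =>
    one_sub_I_mul_ne_zero (ht.trans_le (re_poleA_ge h₁ h₂ i))

/-- The hyperbolic gamma function as a quotient whose numerator and denominator are holomorphic in
a wide strip. -/
theorem hypGamma_eq_trunc (K : ℕ) {w₁ w₂ z : ℂ} (h₁ : 0 < w₁.re) (h₂ : 0 < w₂.re)
    (hz : |z.im| < (wMean w₁ w₂).re) : hypGamma w₁ w₂ z
      = exp (I * gTrunc K w₁ w₂ z) * (polePoly K w₁ w₂ (-z) / polePoly K w₁ w₂ z) := by
  have i0 := integrableOn_gInt_of_abs_im_lt 0 h₁ h₂ hz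
  have iK := integrableOn_gInt_of_abs_im_lt K h₁ h₂ hz
  have hlt : ∀ i, |z.im| < (poleA w₁ w₂ i).re := fun i => hz.trans_le (re_poleA_ge h₁ h₂ i)
  -- Each removed exponential contributes one Frullani integral, and hence one linear fraction after
  -- exponentiation.
  have hdiff : hypG w₁ w₂ z - gTrunc K w₁ w₂ z
      = ∑ i ∈ Finset.range K ×ˢ Finset.range K, ∫ y in Ioi (0 : ℝ), frInt (poleA w₁ w₂ i) z y := by
    rw [← gTrunc_zero, gTrunc, gTrunc, ← integral_sub i0 iK,
      ← integral_finsetSum _ fun i _ => integrableOn_frInt (hlt i)]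
    refine setIntegral_congr_fun measurableSet_Ioi fun y hy => ?_
    have hy : 0 < y := hy
    have e := kap_zero_sub_kap K h₁ h₂ hy
    simp only [gInt, frInt]
    rw [← Finset.sum_div, show ∑ i ∈ Finset.range K ×ˢ Finset.range K,
      2 * sin (2 * y * z) * exp (-(2 * y * poleA w₁ w₂ i))
        = sin (2 * y * z) * (kap 0 w₁ w₂ y - kap K w₁ w₂ y) by
          rw [e, Finset.mul_sum]; exact Finset.sum_congr rfl fun i _ => by ring]
    ring
  have e : hypG w₁ w₂ z = gTrunc K w₁ w₂ z
      + ∑ i ∈ Finset.range K ×ˢ Finset.range K, ∫ y in Ioi (0 : ℝ), frInt (poleA w₁ w₂ i) z y := by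
    rw [← hdiff]; ring
  rw [hypGamma, e, mul_add, Complex.exp_add, Finset.mul_sum, Complex.exp_sum, polePoly, polePoly,
    ← Finset.prod_div_distrib]
  congr 1
  refine Finset.prod_congr rfl fun i _ => ?_
  rw [exp_integral_frInt (hlt i)]
  ring

/-! ### The logarithm of the hyperbolic cosine as an integral -/

def jInt (w z : ℂ) (y : ℝ) : ℂ := (cos (2 * y * z) / sinh (w * y) - 1 / (w * y)) / y

def jFun (w z : ℂ) : ℂ := ∫ y in Ioi (0 : ℝ), jInt w z y

/-- The addition formula for the sine produces `sinh (w₁ y)`, which cancels the same factor in the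
kernel. This is why the difference with step `i w₁` depends on `w₂` alone. -/
theorem gInt_sub_gInt {w₁ w₂ : ℂ} (h₁ : 0 < w₁.re) (h₂ : 0 < w₂.re) (z : ℂ) {y : ℝ} (hy : 0 < y) :
    gInt 0 w₁ w₂ (z + I * w₁ / 2) y - gInt 0 w₁ w₂ (z - I * w₁ / 2) y = I * jInt w₂ z y := by
  have s1 := sinh_mul_ne_zero h₁ hy
  have s2 := sinh_mul_ne_zero h₂ hy
  have n1 := ne_zero_of_re_pos h₁
  have n2 := ne_zero_of_re_pos h₂
  have hy' : (y : ℂ) ≠ 0 := ofReal_ne_zero.2 hy.ne'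
  have e : sin (2 * y * (z + I * w₁ / 2)) - sin (2 * y * (z - I * w₁ / 2))
      = 2 * I * cos (2 * y * z) * sinh (w₁ * y) := by
    rw [show 2 * (y : ℂ) * (z + I * w₁ / 2) = 2 * y * z + w₁ * y * I by ring,
      show 2 * (y : ℂ) * (z - I * w₁ / 2) = 2 * y * z - w₁ * y * I by ring, Complex.sin_add,
      Complex.sin_sub, Complex.sin_mul_I]
    ring
  have e' : sin (2 * y * (z + I * w₁ / 2)) = sin (2 * y * (z - I * w₁ / 2))
      + 2 * I * cos (2 * y * z) * sinh (w₁ * y) := by rw [← e]; ring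
  simp only [gInt, kap, jInt, e', Nat.cast_zero, mul_zero, zero_mul, neg_zero, Complex.exp_zero,
    sub_self, sub_zero]
  generalize sinh (w₁ * y) = S₁ at s1 ⊢
  generalize sinh (w₂ * y) = S₂ at s2 ⊢
  generalize cos (2 * y * z) = c
  generalize sin (2 * y * (z - I * w₁ / 2)) = s
  field_simp
  ring

theorem abs_im_add_lt {w₁ w₂ z : ℂ} (h₁ : 0 < w₁.re) (hz : |z.im| < w₂.re / 2) :
    |(z + I * w₁ / 2).im| < (wMean w₁ w₂).re ∧ |(z - I * w₁ / 2).im| < (wMean w₁ w₂).re := by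
  have e : (wMean w₁ w₂).re = (w₁.re + w₂.re) / 2 := by simp [wMean]
  have e1 : (z + I * w₁ / 2).im = z.im + w₁.re / 2 := by simp
  have e2 : (z - I * w₁ / 2).im = z.im - w₁.re / 2 := by simp
  rw [abs_lt] at hz
  rw [e, e1, e2, abs_lt, abs_lt]
  refine ⟨⟨?_, ?_⟩, ?_, ?_⟩ <;> linarith

/-- With both periods equal to `w`, `jInt` is itself a multiple of a difference of two integrable
functions `gInt`. -/
theorem integrableOn_jInt {w z : ℂ} (hw : 0 < w.re) (hz : |z.im| < w.re / 2) :
    IntegrableOn (jInt w z) (Ioi 0) := by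
  have h := abs_im_add_lt (w₁ := w) hw hz
  have i := ((integrableOn_gInt_of_abs_im_lt 0 hw hw h.1).sub
    (integrableOn_gInt_of_abs_im_lt 0 hw hw h.2)).const_mul (-I)
  refine i.congr ?_
  filter_upwards [self_mem_ae_restrict measurableSet_Ioi] with y hy
  rw [Pi.sub_apply, gInt_sub_gInt hw hw z hy, ← mul_assoc, neg_mul, I_mul_I, neg_neg, one_mul]

theorem hypG_sub_hypG {w₁ w₂ z : ℂ} (h₁ : 0 < w₁.re) (h₂ : 0 < w₂.re) (hz : |z.im| < w₂.re / 2) :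
    hypG w₁ w₂ (z + I * w₁ / 2) - hypG w₁ w₂ (z - I * w₁ / 2) = I * jFun w₂ z := by
  have h := abs_im_add_lt h₁ hz
  rw [← gTrunc_zero, ← gTrunc_zero, gTrunc, gTrunc, ← integral_sub
    (integrableOn_gInt_of_abs_im_lt 0 h₁ h₂ h.1) (integrableOn_gInt_of_abs_im_lt 0 h₁ h₂ h.2),
    jFun, ← integral_const_mul]
  exact setIntegral_congr_fun measurableSet_Ioi fun y hy => gInt_sub_gInt h₁ h₂ z hy

theorem div_sinh_le {r ε y : ℝ} (hr : 0 < r) (hε : 0 < ε) (hy : 0 < y) :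
    y / Real.sinh (r * y) ≤ (1 + 2 * r / ε) / r * Real.exp (-((r - ε) * y)) := by
  have hx : 0 < r * y := by positivity
  have h1 : Real.exp (-(2 * (r * y))) * (1 + 2 * (r * y)) ≤ 1 := by
    have := Real.add_one_le_exp (2 * (r * y))
    calc _ ≤ Real.exp (-(2 * (r * y))) * Real.exp (2 * (r * y)) := by gcongr; linarith
      _ = 1 := by rw [← Real.exp_add]; simp
  have h2 : Real.sinh (r * y) = Real.exp (r * y) * (1 - Real.exp (-(2 * (r * y)))) / 2 := by
    rw [Real.sinh_eq, mul_sub, ← Real.exp_add]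
    ring_nf
  have h3 : Real.exp (r * y) * (r * y) ≤ Real.sinh (r * y) * (1 + 2 * (r * y)) := by
    rw [h2]
    have := Real.exp_pos (r * y)
    nlinarith
  have h4 : 1 + 2 * (r * y) ≤ (1 + 2 * r / ε) * Real.exp (ε * y) := by
    have h5 := Real.add_one_le_exp (ε * y)
    have h6 : 1 ≤ Real.exp (ε * y) := Real.one_le_exp (by positivity)
    have h7 : 2 * (r * y) = 2 * r / ε * (ε * y) := by field_simp
    have h8 : 2 * r / ε * (ε * y) ≤ 2 * r / ε * Real.exp (ε * y) := by gcongr; linarith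
    linarith
  rw [div_le_iff₀ (Real.sinh_pos_iff.2 hx)]
  have e1 : Real.exp (-((r - ε) * y)) = Real.exp (ε * y) * (Real.exp (r * y))⁻¹ := by
    rw [← Real.exp_neg, ← Real.exp_add]; ring_nf
  rw [e1]
  have hs := Real.sinh_pos_iff.2 hx
  calc y = Real.exp (r * y) * (r * y) * (Real.exp (r * y))⁻¹ / r := by
        have := (Real.exp_pos (r * y)).ne'
        field_simp
    _ ≤ Real.sinh (r * y) * ((1 + 2 * r / ε) * Real.exp (ε * y)) * (Real.exp (r * y))⁻¹ / r := by
        have := h3.trans (mul_le_mul_of_nonneg_left h4 hs.le)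
        gcongr
    _ = _ := by ring

/-- The partial fraction expansion of the tangent. -/
theorem tendsto_sum_tan {ζ : ℂ} (hx : (1 / 2 - ζ) ∈ Complex.integerComplement) :
    Tendsto (fun N : ℕ => ∑ n ∈ Finset.range N, (1 / (n + 1 / 2 - ζ) - 1 / (n + 1 / 2 + ζ))) atTop
      (𝓝 (Real.pi * tan (Real.pi * ζ))) := by
  have h1 := tendsto_logDeriv_euler_cot_sub hx
  -- The cotangent series at `1/2 - ζ` pairs `-1 / (n + 1/2 + ζ)` with `1 / (n + 3/2 - ζ)`. Passing
  -- to the tangent pairing shifts one index and leaves this boundary term.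
  have h2 : Tendsto (fun N : ℕ => 1 / ((N : ℂ) + 1 / 2 - ζ)) atTop (𝓝 0) := by
    have hN : Tendsto (fun N : ℕ => (N : ℂ) + (1 / 2 - ζ)) atTop (Bornology.cobounded ℂ) :=
      (tendsto_add_const_cobounded _).comp (tendsto_natCast_atTop_cobounded (α := ℂ))
    simpa [add_sub_assoc, Function.comp_def] using tendsto_inv₀_cobounded.comp hN
  have h3 := (h1.const_add (1 / (1 / 2 - ζ))).sub h2
  have e : Real.pi * tan (Real.pi * ζ)
      = 1 / (1 / 2 - ζ) + (Real.pi * cot (Real.pi * (1 / 2 - ζ)) - 1 / (1 / 2 - ζ)) - 0 := by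
    rw [Complex.cot, show (Real.pi : ℂ) * (1 / 2 - ζ) = Real.pi / 2 - Real.pi * ζ by ring,
      Complex.cos_pi_div_two_sub, Complex.sin_pi_div_two_sub, Complex.tan]
    ring
  rw [e]
  refine h3.congr fun N => ?_
  induction N with
  | zero => simp
  | succ N ih =>
    rw [Finset.sum_range_succ, Finset.sum_range_succ, ← ih]
    have e1 : (1 / 2 - ζ - ((N : ℂ) + 1)) = -((N : ℂ) + 1 / 2 + ζ) := by ring
    simp only [cotTerm, e1]
    rw [one_div (-_), inv_neg, ← one_div]
    push_cast
    rw [show (1 / 2 - ζ + ((N : ℂ) + 1)) = (N : ℂ) + 1 + 1 / 2 - ζ by ring]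
    ring

theorem half_sub_mem_integerComplement {w z : ℂ} (hw : 0 < w.re) (hz : |z.im| < w.re / 2) :
    (1 / 2 - I * z / w) ∈ Complex.integerComplement := by
  rintro ⟨n, hn⟩
  have hw0 := ne_zero_of_re_pos hw
  have e : I * z = (1 / 2 - n : ℝ) * w := by
    have : I * z / w = 1 / 2 - n := by rw [hn]; ring
    rw [div_eq_iff hw0] at this
    rw [this]; push_cast; ring
  have e2 : -z.im = (1 / 2 - n) * w.re := by
    have := congrArg Complex.re e
    rw [re_ofReal_mul] at this
    simpa using this
  rw [abs_lt] at hz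
  have h1 : (n : ℝ) < 1 := by
    by_contra h
    push Not at h
    nlinarith
  have h2 : (0 : ℝ) < n := by
    by_contra h
    push Not at h
    nlinarith
  have h1' : n < 1 := by exact_mod_cast h1
  have h2' : 0 < n := by exact_mod_cast h2
  omega

theorem cosh_ne_zero_of_abs_im_lt {w z : ℂ} (hw : 0 < w.re) (hz : |z.im| < w.re / 2) :
    cosh (Real.pi * z / w) ≠ 0 := by
  intro h
  rw [← Complex.cos_mul_I, Complex.cos_eq_zero_iff] at h
  obtain ⟨k, hk⟩ := h
  apply half_sub_mem_integerComplement hw hz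
  refine ⟨-k, ?_⟩
  have hpi : (Real.pi : ℂ) ≠ 0 := ofReal_ne_zero.2 Real.pi_ne_zero
  have : Real.pi * (I * z / w) = Real.pi * ((2 * k + 1) / 2) := by linear_combination hk
  rw [mul_left_cancel₀ hpi this]
  push_cast
  ring

theorem integral_sin_mul_exp {a z : ℂ} (h : 2 * |z.im| < a.re) :
    ∫ y in Ioi (0 : ℝ), 4 * sin (2 * y * z) * exp (-(a * y))
      = 2 / I * (1 / (a - 2 * I * z) - 1 / (a + 2 * I * z)) := by
  have hp : (-(a - 2 * I * z)).re < 0 := by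
    simp; linarith [neg_abs_le z.im]
  have hq : (-(a + 2 * I * z)).re < 0 := by
    simp; linarith [le_abs_self z.im]
  have e : ∀ y : ℝ, 4 * sin (2 * y * z) * exp (-(a * y))
      = 2 / I * exp (-(a - 2 * I * z) * y) - 2 / I * exp (-(a + 2 * I * z) * y) := by
    intro y
    rw [Complex.sin, show -(a - 2 * I * z) * y = 2 * y * z * I + -(a * y) by ring,
      show -(a + 2 * I * z) * y = -(2 * y * z) * I + -(a * y) by ring, Complex.exp_add,
      Complex.exp_add]
    have : (2 : ℂ) / I = -2 * I := by field_simp; simp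
    rw [this]
    ring
  simp_rw [e]
  rw [integral_sub ((integrableOn_exp_mul_complex_Ioi hp 0).const_mul _)
    ((integrableOn_exp_mul_complex_Ioi hq 0).const_mul _), integral_const_mul, integral_const_mul,
    integral_exp_mul_complex_Ioi hp, integral_exp_mul_complex_Ioi hq]
  simp only [ofReal_zero, mul_zero, Complex.exp_zero, neg_div_neg_eq]
  ring

theorem norm_sin_mul_exp_le {a z : ℂ} {y : ℝ} (hy : 0 < y) {c : ℝ} (hc : 0 < c)
    (hca : c + 2 * |z.im| ≤ a.re) :
    ‖4 * sin (2 * y * z) * exp (-(a * y))‖ ≤ 64 * ‖z‖ / c * Real.exp (-(c / 2 * y)) := by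
  have hs := norm_sin_le_mul_exp (2 * y * z)
  rw [im_two_mul_mul, abs_mul, abs_of_pos (by positivity : 0 < 2 * y), norm_mul, norm_mul,
    Complex.norm_ofNat, Complex.norm_of_nonneg hy.le] at hs
  have he : ‖exp (-(a * y))‖ ≤ Real.exp (-((c + 2 * |z.im|) * y)) := by
    rw [Complex.norm_exp]
    refine Real.exp_le_exp.2 ?_
    simp
    nlinarith
  rw [norm_mul, norm_mul, Complex.norm_ofNat]
  have hcy : y ≤ 2 / c * Real.exp (c / 2 * y) := by
    have := Real.add_one_le_exp (c / 2 * y)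
    calc y = 2 / c * (c / 2 * y) := by field_simp
      _ ≤ _ := by gcongr; linarith
  calc _ ≤ 4 * (4 * (2 * y * ‖z‖) * Real.exp (2 * y * |z.im|))
        * Real.exp (-((c + 2 * |z.im|) * y)) := by gcongr
    _ = 32 * ‖z‖ * y * (Real.exp (2 * y * |z.im|) * Real.exp (-((c + 2 * |z.im|) * y))) := by ring
    _ = 32 * ‖z‖ * y * Real.exp (-(c * y)) := by rw [← Real.exp_add]; ring_nf
    _ ≤ 32 * ‖z‖ * (2 / c * Real.exp (c / 2 * y)) * Real.exp (-(c * y)) := by gcongr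
    _ = 64 * ‖z‖ / c * (Real.exp (c / 2 * y) * Real.exp (-(c * y))) := by ring
    _ = _ := by rw [← Real.exp_add]; ring_nf

theorem hasSum_inv_sinh {u : ℂ} (hu : 0 < u.re) :
    HasSum (fun n : ℕ => 2 * exp (-((2 * n + 1) * u))) (1 / sinh u) := by
  have hr : ‖exp (-(2 * u))‖ < 1 := by
    rw [Complex.norm_exp, Real.exp_lt_one_iff]
    simpa using hu
  have h := (hasSum_geometric_of_norm_lt_one hr).mul_left (2 * exp (-u))
  have e : 2 * exp (-u) * (1 - exp (-(2 * u)))⁻¹ = 1 / sinh u := by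
    have h1 : (1 - exp (-(2 * u))) ≠ 0 := by
      intro h0
      have : exp (-(2 * u)) = 1 := by linear_combination -h0
      rw [this] at hr
      simp at hr
    have h2 : exp (-u) * (2 * sinh u) = 1 - exp (-(2 * u)) := by
      rw [Complex.sinh, show -(2 * u) = -u + -u by ring, Complex.exp_add]
      have : exp u * exp (-u) = 1 := by rw [← Complex.exp_add]; simp
      linear_combination this
    have h3 : sinh u ≠ 0 := by
      intro h0
      rw [h0] at h2
      exact h1 (by rw [← h2]; ring)
    rw [← h2]
    have := Complex.exp_ne_zero (-u)
    field_simp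
  rw [e] at h
  refine h.congr_fun fun n => ?_
  rw [← Complex.exp_nat_mul, mul_assoc, ← Complex.exp_add]
  ring_nf

/-- Expanding `1 / sinh` in exponentials and integrating termwise gives the partial fractions of the
tangent at `i z / w`. -/
theorem integral_sin_div_sinh {w z : ℂ} (hw : 0 < w.re) (hz : |z.im| < w.re / 2) :
    ∫ y in Ioi (0 : ℝ), 2 * sin (2 * y * z) / sinh (w * y)
      = Real.pi / w * tanh (Real.pi * z / w) := by
  set F : ℕ → ℝ → ℂ := fun n y => 4 * sin (2 * y * z) * exp (-(((2 * n + 1) * w) * y)) with hF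
  -- With this `δ` the decay of the `n`-th exponential exceeds the growth of the sine by at least
  -- `(n + 1) δ`. As the sine also vanishes at `y = 0`, the `n`-th integral is `O((n + 1)⁻²)`, hence
  -- summable.
  set δ := min (w.re - 2 * |z.im|) w.re with hδ
  have hδ0 : 0 < δ := lt_min (by linarith) hw
  have hre : ∀ n : ℕ, ((2 * n + 1) * w).re = (2 * n + 1) * w.re := by
    intro n
    rw [show ((2 * n + 1 : ℂ) * w) = ((2 * n + 1 : ℝ) : ℂ) * w by push_cast; ring, re_ofReal_mul]
  have hc : ∀ n : ℕ, (n + 1) * δ + 2 * |z.im| ≤ ((2 * n + 1) * w).re := by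
    intro n
    rw [hre]
    have h1 : δ ≤ w.re - 2 * |z.im| := min_le_left _ _
    have h2 : δ ≤ w.re := min_le_right _ _
    have : (0 : ℝ) ≤ n := Nat.cast_nonneg n
    nlinarith
  have hcpos : ∀ n : ℕ, 0 < (n + 1) * δ := fun n => by positivity
  have hb : ∀ n : ℕ, ∀ y : ℝ, 0 < y →
      ‖F n y‖ ≤ 64 * ‖z‖ / ((n + 1) * δ) * Real.exp (-((n + 1) * δ / 2 * y)) :=
    fun n y hy => norm_sin_mul_exp_le hy (hcpos n) (hc n)
  have hmeas : ∀ n, Measurable (F n) := fun n => by simp only [hF]; fun_prop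
  have hintb : ∀ n : ℕ, IntegrableOn
      (fun y : ℝ => 64 * ‖z‖ / ((n + 1) * δ) * Real.exp (-((n + 1) * δ / 2 * y))) (Ioi 0) :=
    fun n => (integrableOn_exp_neg_mul (half_pos (hcpos n))).const_mul _
  have hint : ∀ n, IntegrableOn (F n) (Ioi 0) := by
    intro n
    refine Integrable.mono' (hintb n) (hmeas n).aestronglyMeasurable ?_
    filter_upwards [self_mem_ae_restrict measurableSet_Ioi] with y hy using hb n y hy
  have hsum : Summable fun n => ∫ y in Ioi (0 : ℝ), ‖F n y‖ := by
    have hs : Summable fun n : ℕ => 128 * ‖z‖ / δ ^ 2 * (1 / ((n + 1 : ℕ) : ℝ) ^ 2) :=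
      ((summable_nat_add_iff 1).2 (Real.summable_one_div_nat_pow.2 one_lt_two)).mul_left _
    refine Summable.of_nonneg_of_le (fun n => integral_nonneg fun y => norm_nonneg _) (fun n => ?_) hs
    calc ∫ y in Ioi (0 : ℝ), ‖F n y‖
        ≤ ∫ y in Ioi (0 : ℝ), 64 * ‖z‖ / ((n + 1) * δ) * Real.exp (-((n + 1) * δ / 2 * y)) :=
          setIntegral_mono_on (hint n).norm (hintb n) measurableSet_Ioi fun y hy => hb n y hy
      _ = 128 * ‖z‖ / δ ^ 2 * (1 / ((n + 1 : ℕ) : ℝ) ^ 2) := by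
          rw [integral_const_mul]
          simp_rw [← neg_mul]
          rw [integral_exp_mul_Ioi (neg_neg_iff_pos.2 (half_pos (hcpos n)))]
          have := hcpos n
          have : (0 : ℝ) < n + 1 := by positivity
          push_cast
          simp only [mul_zero, Real.exp_zero]
          field_simp
          ring
  have h1 := (hasSum_integral_of_summable_integral_norm hint hsum).tendsto_sum_nat
  have h2 : ∫ y in Ioi (0 : ℝ), ∑' n, F n y
      = ∫ y in Ioi (0 : ℝ), 2 * sin (2 * y * z) / sinh (w * y) := by
    refine setIntegral_congr_fun measurableSet_Ioi fun y hy => ?_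
    have hy : 0 < y := hy
    have hu : 0 < (w * y).re := by simpa using mul_pos hw hy
    have h := (hasSum_inv_sinh hu).mul_left (2 * sin (2 * y * z))
    simp only [hF]
    rw [div_eq_mul_one_div, ← h.tsum_eq]
    refine tsum_congr fun n => ?_
    rw [show (2 * (n : ℂ) + 1) * w * y = (2 * n + 1) * (w * y) by ring]
    ring
  rw [h2] at h1
  have h3 := (tendsto_sum_tan (half_sub_mem_integerComplement hw hz)).const_mul (1 / (I * w))
  have hw0 := ne_zero_of_re_pos hw
  have e : 1 / (I * w) * (Real.pi * tan (Real.pi * (I * z / w)))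
      = Real.pi / w * tanh (Real.pi * z / w) := by
    rw [show Real.pi * (I * z / w) = Real.pi * z / w * I by ring, Complex.tan_mul_I]
    field_simp
  rw [e] at h3
  refine tendsto_nhds_unique h1 (h3.congr fun N => ?_)
  rw [Finset.mul_sum]
  refine Finset.sum_congr rfl fun n _ => ?_
  have hlt : 2 * |z.im| < ((2 * n + 1) * w).re := by linarith [hc n, hcpos n]
  simp only [hF]
  rw [integral_sin_mul_exp hlt]
  have n1 : (2 * n + 1) * w - 2 * I * z ≠ 0 := by
    refine ne_zero_of_re_pos ?_
    rw [sub_re]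
    have : (2 * I * z).re = -2 * z.im := by simp
    rw [this]
    linarith [neg_abs_le z.im]
  have n2 : (2 * n + 1) * w + 2 * I * z ≠ 0 := by
    refine ne_zero_of_re_pos ?_
    rw [add_re]
    have : (2 * I * z).re = -2 * z.im := by simp
    rw [this]
    linarith [le_abs_self z.im]
  have e1 : (n : ℂ) + 1 / 2 - I * z / w = ((2 * n + 1) * w - 2 * I * z) / (2 * w) := by
    field_simp
  have e2 : (n : ℂ) + 1 / 2 + I * z / w = ((2 * n + 1) * w + 2 * I * z) / (2 * w) := by
    field_simp
  rw [e1, e2]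
  field_simp

theorem hasDerivAt_jFun {w z : ℂ} (hw : 0 < w.re) (hz : |z.im| < w.re / 2) :
    HasDerivAt (jFun w) (-(Real.pi / w * tanh (Real.pi * z / w))) z := by
  set δ := (w.re / 2 - |z.im|) / 2 with hδ
  have hδ0 : 0 < δ := by rw [hδ]; linarith
  have key := hasDerivAt_integral_of_dominated_loc_of_deriv_le (𝕜 := ℂ)
    (μ := volume.restrict (Ioi (0 : ℝ))) (F := fun z y => jInt w z y)
    (F' := fun z y => -(2 * sin (2 * y * z) / sinh (w * y))) (x₀ := z)
    (s := {x : ℂ | |x.im| < w.re / 2 - δ} ∩ {x | ‖x‖ < ‖z‖ + 1})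
    (bound := fun y => 16 * (‖z‖ + 1) * ((1 + 2 * w.re / δ) / w.re) * Real.exp (-(δ * y)))
    (inter_mem ((isOpen_strip _).mem_nhds (by simp only [mem_ofPred_eq]; linarith))
      ((isOpen_lt (by fun_prop) (by fun_prop)).mem_nhds (by simp)))
    (Eventually.of_forall fun x => by
      refine Measurable.aestronglyMeasurable ?_
      unfold jInt
      fun_prop)
    (integrableOn_jInt hw hz)
    (by
      refine Measurable.aestronglyMeasurable ?_
      fun_prop) ?_
    ((integrableOn_exp_neg_mul hδ0).const_mul _) ?_
  · have h := key.2
    rw [integral_neg, integral_sin_div_sinh hw hz] at h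
    exact h
  · filter_upwards [self_mem_ae_restrict measurableSet_Ioi] with y hy x hx
    have hy : 0 < y := hy
    have hx1 : |x.im| < w.re / 2 - δ := hx.1
    have hx2 : ‖x‖ < ‖z‖ + 1 := hx.2
    have hs := norm_sin_le_mul_exp (2 * y * x)
    rw [im_two_mul_mul, abs_mul, abs_of_pos (by positivity : 0 < 2 * y), norm_mul, norm_mul,
      Complex.norm_ofNat, Complex.norm_of_nonneg hy.le] at hs
    have hsh : Real.sinh (w.re * y) ≤ ‖sinh (w * y)‖ := by
      simpa using sinh_re_le_norm_sinh (w * y)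
    have hshp : 0 < Real.sinh (w.re * y) := Real.sinh_pos_iff.2 (by positivity)
    rw [norm_neg, norm_div, norm_mul, Complex.norm_ofNat]
    calc _ ≤ 2 * (4 * (2 * y * (‖z‖ + 1)) * Real.exp (2 * y * |x.im|)) / Real.sinh (w.re * y) := by
          gcongr
          exact hs.trans (by gcongr)
      _ = 16 * (‖z‖ + 1) * (y / Real.sinh (w.re * y)) * Real.exp (2 * y * |x.im|) := by ring
      _ ≤ 16 * (‖z‖ + 1) * ((1 + 2 * w.re / δ) / w.re * Real.exp (-((w.re - δ) * y)))
          * Real.exp (2 * y * |x.im|) := by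
        gcongr
        exact div_sinh_le hw hδ0 hy
      _ = 16 * (‖z‖ + 1) * ((1 + 2 * w.re / δ) / w.re)
          * Real.exp (-((w.re - δ) * y) + 2 * y * |x.im|) := by rw [Real.exp_add]; ring
      _ ≤ _ := by
        gcongr
        nlinarith
  · filter_upwards [self_mem_ae_restrict measurableSet_Ioi] with y hy x hx
    have hy' : (y : ℂ) ≠ 0 := ofReal_ne_zero.2 (ne_of_gt hy)
    have s1 := sinh_mul_ne_zero hw hy
    have h1 : HasDerivAt (fun x : ℂ => 2 * (y : ℂ) * x) (2 * y) x := by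
      simpa using (hasDerivAt_id x).const_mul (2 * (y : ℂ))
    have h2 := ((h1.ccos.div_const (sinh (w * y))).sub_const (1 / (w * y))).div_const (y : ℂ)
    refine h2.congr_deriv ?_
    generalize sinh (w * y) = S at s1 ⊢
    field_simp

/-- The logarithmic derivatives of the two factors are opposite, so the product is constant. The
constant `exp (jFun w 0)` is never evaluated: it drops out of all equations in which gamma functions
are shifted. -/
theorem exp_jFun_mul_cosh {w z : ℂ} (hw : 0 < w.re) (hz : |z.im| < w.re / 2) :
    exp (jFun w z) * cosh (Real.pi * z / w) = exp (jFun w 0) := by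
  have hd : ∀ x ∈ {x : ℂ | |x.im| < w.re / 2}, HasDerivAt
      (fun x => exp (jFun w x) * cosh (Real.pi * x / w)) 0 x := by
    intro x hx
    have h1 : HasDerivAt (fun x : ℂ => Real.pi * x / w) (Real.pi / w) x := by
      simpa using ((hasDerivAt_id x).const_mul (Real.pi : ℂ)).div_const w
    have hc := cosh_ne_zero_of_abs_im_lt hw hx
    refine ((hasDerivAt_jFun hw hx).cexp.mul h1.ccosh).congr_deriv ?_
    rw [Complex.tanh]
    field_simp
    ring
  have h0 : (0 : ℂ) ∈ {x : ℂ | |x.im| < w.re / 2} := by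
    simpa using hw
  have hc := (isOpen_strip (w.re / 2)).is_const_of_deriv_eq_zero
    (convex_strip (w.re / 2)).isPreconnected
    (fun x hx => (hd x hx).differentiableAt.differentiableWithinAt)
    (fun x hx => (hd x hx).deriv) (x := z) (y := 0) hz h0
  simpa using hc

/-- For a real period `cosh (π z / W)` has positive real part on the strip, so the principal
logarithm is holomorphic along it. The growth estimates need `jFun` itself and not only its
exponential. -/
theorem jFun_eq_sub_log {W : ℝ} (hW : 0 < W) {z : ℂ} (hz : |z.im| < W / 2) :
    jFun W z = jFun W 0 - log (cosh (Real.pi * z / W)) := by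
  have hpos : ∀ x ∈ {x : ℂ | |x.im| < W / 2}, 0 < (cosh (Real.pi * x / W)).re := by
    intro x hx
    have hx : |x.im| < W / 2 := hx
    have e : Real.pi * x / W = ((Real.pi * x.re / W : ℝ) : ℂ) + ((Real.pi * x.im / W : ℝ) : ℂ) * I := by
      conv_lhs => rw [← re_add_im x]
      push_cast
      ring
    rw [e, Complex.cosh_add, Complex.cosh_mul_I, Complex.sinh_mul_I, ← ofReal_cosh, ← ofReal_sinh,
      ← ofReal_cos, ← ofReal_sin]
    simp only [add_re, mul_re, ofReal_re, ofReal_im, I_re, I_im, mul_zero, zero_mul, sub_zero,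
      mul_im, add_zero, mul_one]
    refine mul_pos (Real.cosh_pos _) (Real.cos_pos_of_mem_Ioo ?_)
    rw [abs_lt] at hx
    have hpi := Real.pi_pos
    constructor
    · rw [lt_div_iff₀ hW]; nlinarith
    · rw [div_lt_iff₀ hW]; nlinarith
  have hd : ∀ x ∈ {x : ℂ | |x.im| < W / 2}, HasDerivAt
      (fun x => jFun W x + log (cosh (Real.pi * x / W))) 0 x := by
    intro x hx
    have h1 : HasDerivAt (fun x : ℂ => Real.pi * x / W) (Real.pi / W) x := by
      simpa using ((hasDerivAt_id x).const_mul (Real.pi : ℂ)).div_const (W : ℂ)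
    have h2 := h1.ccosh.clog (Or.inl (hpos x hx))
    refine ((hasDerivAt_jFun (w := W) (by simpa using hW) (by simpa using hx)).add h2).congr_deriv ?_
    rw [Complex.tanh]
    ring
  have h0 : (0 : ℂ) ∈ {x : ℂ | |x.im| < W / 2} := by
    simpa using hW
  have hc := (isOpen_strip (W / 2)).is_const_of_deriv_eq_zero
    (convex_strip (W / 2)).isPreconnected
    (fun x hx => (hd x hx).differentiableAt.differentiableWithinAt)
    (fun x hx => (hd x hx).deriv) (x := z) (y := 0) hz h0
  simp at hc
  linear_combination hc

/-! ### The difference equation of the hyperbolic gamma function -/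

/-- The difference formula for `hypG` is used at the midpoint `z + i w₁ / 2`. There `cosh` becomes
`-i sinh` of an argument larger by `π i / 2`, which is where `z + i w` comes from. -/
theorem hypGamma_add {w₁ w₂ z : ℂ} (h₁ : 0 < w₁.re) (h₂ : 0 < w₂.re)
    (hz : |z.im| < (wMean w₁ w₂).re) (hz' : |(z + I * w₁).im| < (wMean w₁ w₂).re) :
    hypGamma w₁ w₂ (z + I * w₁)
      = -I * exp (-jFun w₂ 0) * sinh (Real.pi * (z + I * wMean w₁ w₂) / w₂) * hypGamma w₁ w₂ z := by
  have e : (wMean w₁ w₂).re = (w₁.re + w₂.re) / 2 := by simp [wMean]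
  have e1 : (z + I * w₁).im = z.im + w₁.re := by simp
  rw [e] at hz hz'
  rw [e1] at hz'
  have hu : |(z + I * w₁ / 2).im| < w₂.re / 2 := by
    have : (z + I * w₁ / 2).im = z.im + w₁.re / 2 := by simp
    rw [this]
    rw [abs_lt] at hz hz' ⊢
    constructor <;> linarith
  have h := hypG_sub_hypG h₁ h₂ hu
  rw [show z + I * w₁ / 2 + I * w₁ / 2 = z + I * w₁ by ring,
    show z + I * w₁ / 2 - I * w₁ / 2 = z by ring] at h
  have hj := exp_jFun_mul_cosh h₂ hu
  have hw0 := ne_zero_of_re_pos h₂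
  have hcs : cosh (Real.pi * (z + I * w₁ / 2) / w₂)
      = -I * sinh (Real.pi * (z + I * wMean w₁ w₂) / w₂) := by
    have : Real.pi * (z + I * w₁ / 2) / w₂
        = Real.pi * (z + I * wMean w₁ w₂) / w₂ - Real.pi / 2 * I := by
      rw [wMean]; field_simp; ring
    rw [this, Complex.cosh_sub, Complex.cosh_mul_I, Complex.sinh_mul_I, Complex.cos_pi_div_two,
      Complex.sin_pi_div_two]
    ring
  rw [hcs] at hj
  have e2 : hypG w₁ w₂ (z + I * w₁) = hypG w₁ w₂ z + I * jFun w₂ (z + I * w₁ / 2) := by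
    rw [← h]; ring
  have e3 : exp (-jFun w₂ (z + I * w₁ / 2))
      = exp (-jFun w₂ 0) * (-I * sinh (Real.pi * (z + I * wMean w₁ w₂) / w₂)) := by
    rw [Complex.exp_neg, Complex.exp_neg, ← hj]
    have h3 := Complex.exp_ne_zero (jFun w₂ (z + I * w₁ / 2))
    have h4 := Complex.exp_ne_zero (jFun w₂ 0)
    rw [← hj] at h4
    have h5 := right_ne_zero_of_mul h4
    rw [mul_inv, mul_assoc, inv_mul_cancel₀ h5, mul_one]
  rw [hypGamma, hypGamma, e2, mul_add, Complex.exp_add, ← mul_assoc I I, I_mul_I, neg_one_mul, e3]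
  ring

/-! ### Growth of quotients of hyperbolic gamma functions -/

/-- The multiple of `jInt` is chosen to cancel the counterterm of the difference. What remains
contains `Z` only through `cos (2yZ)`, which is bounded in terms of `y` and `Im Z`; so all growth in
`Re Z` is contained in the explicitly known `jFun`. -/
theorem gInt_sub_sub_jInt (K : ℕ) {w₁ w₂ : ℂ} (h₁ : 0 < w₁.re) (h₂ : 0 < w₂.re) (Z d : ℂ) {W y : ℝ}
    (hW : 0 < W) (hy : 0 < y) :
    gInt K w₁ w₂ (Z + d / 2) y - gInt K w₁ w₂ (Z - d / 2) y - d * W / (w₁ * w₂) * jInt W Z y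
      = cos (2 * y * Z) * (2 * (sin (2 * y * (d / 2)) * kap K w₁ w₂ y)
        - d * W / (w₁ * w₂) / sinh (W * y)) / y := by
  have n1 := ne_zero_of_re_pos h₁
  have n2 := ne_zero_of_re_pos h₂
  have hy' : (y : ℂ) ≠ 0 := ofReal_ne_zero.2 hy.ne'
  have hW' : (W : ℂ) ≠ 0 := ofReal_ne_zero.2 hW.ne'
  have s1 : sinh ((W : ℂ) * y) ≠ 0 := sinh_mul_ne_zero (by simpa using hW) hy
  rw [gInt, gInt, jInt, show 2 * (y : ℂ) * (Z + d / 2) = 2 * y * Z + 2 * y * (d / 2) by ring,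
    show 2 * (y : ℂ) * (Z - d / 2) = 2 * y * Z - 2 * y * (d / 2) by ring, Complex.sin_add,
    Complex.sin_sub]
  generalize sinh ((W : ℂ) * y) = S at s1 ⊢
  generalize kap K w₁ w₂ y = κ
  generalize cos (2 * y * Z) = c
  generalize sin (2 * y * (d / 2)) = s
  field_simp
  ring

theorem norm_inv_sinh_sub_inv_le {x : ℝ} (hx : 0 < x) :
    ‖1 / sinh (x : ℂ) - 1 / x‖ ≤ x * Real.exp x := by
  have hs : x ≤ ‖sinh (x : ℂ)‖ := by
    refine le_trans ?_ (sinh_re_le_norm_sinh _)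
    rw [ofReal_re]
    exact Real.self_le_sinh_iff.2 hx.le
  have hs0 : sinh (x : ℂ) ≠ 0 := norm_pos_iff.1 (hx.trans_le hs)
  have hx0 : (x : ℂ) ≠ 0 := ofReal_ne_zero.2 hx.ne'
  have e : 1 / sinh (x : ℂ) - 1 / x = -(sinh (x : ℂ) - x) / (sinh (x : ℂ) * x) := by
    field_simp
    ring
  have hn : ‖(x : ℂ)‖ = x := Complex.norm_of_nonneg hx.le
  have h := norm_sinh_sub_le (x : ℂ)
  rw [hn] at h
  rw [e, norm_div, norm_neg, norm_mul, hn, div_le_iff₀ (by positivity)]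
  calc _ ≤ x ^ 3 * Real.exp x := h
    _ = x * Real.exp x * (x * x) := by ring
    _ ≤ _ := by gcongr

-- The comparison period `4M + 2` serves two purposes when `|Im Z| ≤ M`: the term with `sinh (W y)`
-- decays at least like `exp (-2y)` after multiplication by the cosine, and `|Im (π Z / W)| ≤ π /
-- 4`, where `log ‖cosh‖` is well controlled.
set_option maxHeartbeats 1000000 in
theorem exists_norm_gInt_sub_le (K : ℕ) {B m₁ m₂ k E M δ : ℝ} (hB : 0 ≤ B) (hm₁ : 0 < m₁)
    (hm₂ : 0 < m₂) (hk : 0 ≤ k) (hk₁ : k ≤ K * m₁) (hk₂ : k ≤ K * m₂) (hM : 0 ≤ M)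
    (hδ : 0 < δ) (hME : 2 * M + E + δ ≤ m₁ + m₂ + 2 * k) : ∃ C, 0 ≤ C ∧
    ∀ {w₁ w₂ d Z : ℂ}, ‖w₁‖ ≤ B → ‖w₂‖ ≤ B → ‖d‖ ≤ 2 * B → m₁ ≤ w₁.re → m₂ ≤ w₂.re →
      |Z.im| ≤ M → |d.im| ≤ E → ∀ {y : ℝ}, 0 < y →
        ‖gInt K w₁ w₂ (Z + d / 2) y - gInt K w₁ w₂ (Z - d / 2) y
          - d * (4 * M + 2 : ℝ) / (w₁ * w₂) * jInt (4 * M + 2 : ℝ) Z y‖ ≤ C / (1 + y ^ 2) := by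
  obtain ⟨C₁, hC₁, h1⟩ := exists_norm_small_le K hB (lt_min hm₁ hm₂)
  obtain ⟨C₂, hC₂, h2⟩ := exists_norm_kap_le hm₁ hm₂
  set W : ℝ := 4 * M + 2 with hW
  have hW0 : 0 < W := by rw [hW]; positivity
  set N := 2 * B * W / (m₁ * m₂) with hN
  have hN0 : 0 ≤ N := by positivity
  set S := 2 / (1 - Real.exp (-(2 * W))) with hS
  have hS0 : 0 ≤ S := by
    have : Real.exp (-(2 * W)) < 1 := Real.exp_lt_one_iff.2 (by linarith)
    exact div_nonneg two_pos.le (by linarith)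
  set D₁ := Real.exp (2 * M) * (2 * C₁ + N * (W * Real.exp W)) with hD₁
  set D₂ := 2 * C₂ * (1 + 2 / δ ^ 2) + N * S * (1 + 2 / 2 ^ 2) with hD₂
  have hD₁0 : 0 ≤ D₁ := by positivity
  have hD₂0 : 0 ≤ D₂ := by positivity
  refine ⟨2 * D₁ + D₂, by positivity, ?_⟩
  intro w₁ w₂ d Z hw₁ hw₂ hd hr₁ hr₂ hZ hdim y hy
  clear_value N S D₁ D₂ W
  rw [gInt_sub_sub_jInt K (hm₁.trans_le hr₁) (hm₂.trans_le hr₂) Z d hW0 hy]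
  have hyn : ‖(y : ℂ)‖ = y := Complex.norm_of_nonneg hy.le
  have hη : ‖d * W / (w₁ * w₂)‖ ≤ N := by
    rw [norm_div, norm_mul, norm_mul, Complex.norm_of_nonneg hW0.le, hN]
    have := hr₁.trans (re_le_norm _)
    have := hr₂.trans (re_le_norm _)
    gcongr
  have hcos : ‖cos (2 * y * Z)‖ ≤ Real.exp (2 * M * y) := by
    refine (norm_cos_le_exp _).trans (Real.exp_le_exp.2 ?_)
    rw [im_two_mul_mul, abs_mul, abs_of_pos (by positivity : 0 < 2 * y)]
    nlinarith
  rw [norm_div, norm_mul, hyn]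
  rcases le_total y 1 with hy1 | hy1
  · have a1 := h1 (z := d / 2) hw₁ hw₂
      (by rw [norm_div, Complex.norm_ofNat]; linarith)
      ((min_le_left _ _).trans hr₁) ((min_le_right _ _).trans hr₂) hy hy1
    have a2 := norm_inv_sinh_sub_inv_le (x := W * y) (by positivity)
    have hxW : W * y ≤ W := by nlinarith
    have a3 : W * y * Real.exp (W * y) ≤ W * Real.exp W * y := by
      calc _ ≤ W * y * Real.exp W := by gcongr
        _ = _ := by ring
    have hy' : (y : ℂ) ≠ 0 := ofReal_ne_zero.2 hy.ne'
    have hW' : (W : ℂ) ≠ 0 := ofReal_ne_zero.2 hW0.ne'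
    have n1 := ne_zero_of_re_pos (hm₁.trans_le hr₁)
    have n2 := ne_zero_of_re_pos (hm₂.trans_le hr₂)
    have e : 2 * (sin (2 * y * (d / 2)) * kap K w₁ w₂ y) - d * W / (w₁ * w₂) / sinh (W * y)
        = 2 * (sin (2 * y * (d / 2)) * kap K w₁ w₂ y - d / 2 / (w₁ * w₂ * y))
          - d * W / (w₁ * w₂) * (1 / sinh ((W * y : ℝ) : ℂ) - 1 / (W * y : ℝ)) := by
      push_cast
      generalize kap K w₁ w₂ y = κ
      field_simp
      ring
    have a4 : ‖2 * (sin (2 * y * (d / 2)) * kap K w₁ w₂ y) - d * W / (w₁ * w₂) / sinh (W * y)‖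
        ≤ (2 * C₁ + N * (W * Real.exp W)) * y := by
      rw [e]
      refine (norm_sub_le _ _).trans ?_
      rw [norm_mul, norm_mul, Complex.norm_ofNat]
      calc _ ≤ 2 * (C₁ * y) + N * (W * Real.exp W * y) := by
            gcongr
            exact a2.trans a3
        _ = _ := by ring
    have a5 : Real.exp (2 * M * y) ≤ Real.exp (2 * M) := Real.exp_le_exp.2 (by nlinarith)
    calc _ ≤ Real.exp (2 * M) * ((2 * C₁ + N * (W * Real.exp W)) * y) / y := by
          gcongr
          exact hcos.trans a5
      _ = D₁ := by rw [hD₁]; field_simp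
      _ ≤ _ := by
        rw [le_div_iff₀ (by positivity)]
        have : y ^ 2 ≤ 1 := by nlinarith
        nlinarith
  · have a1 := h2 hk hk₁ hk₂ hr₁ hr₂ hy1
    have hsin : ‖sin (2 * y * (d / 2))‖ ≤ Real.exp (E * y) := by
      refine (norm_sin_le_exp _).trans (Real.exp_le_exp.2 ?_)
      have : (d / 2).im = d.im / 2 := by simp
      rw [im_two_mul_mul, abs_mul, abs_of_pos (by positivity : 0 < 2 * y), this, abs_div,
        abs_of_pos (two_pos : (0 : ℝ) < 2)]
      nlinarith
    have hsh : Real.sinh (W * y) ≤ ‖sinh ((W : ℂ) * y)‖ := by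
      simpa using sinh_re_le_norm_sinh ((W : ℂ) * y)
    have hshp : 0 < Real.sinh (W * y) := Real.sinh_pos_iff.2 (by positivity)
    have b1 : ‖cos (2 * y * Z)‖ * ‖2 * (sin (2 * y * (d / 2)) * kap K w₁ w₂ y)‖
        ≤ 2 * C₂ * Real.exp (-(δ * y)) := by
      rw [norm_mul, norm_mul, Complex.norm_ofNat]
      calc _ ≤ Real.exp (2 * M * y) * (2 * (Real.exp (E * y)
            * (C₂ * Real.exp (-((m₁ + m₂ + 2 * k) * y))))) := by gcongr
        _ = 2 * C₂ * (Real.exp (2 * M * y) * Real.exp (E * y)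
            * Real.exp (-((m₁ + m₂ + 2 * k) * y))) := by ring
        _ = 2 * C₂ * Real.exp (2 * M * y + E * y + -((m₁ + m₂ + 2 * k) * y)) := by
            rw [Real.exp_add, Real.exp_add]
        _ ≤ _ := by gcongr; nlinarith
    have b2 : ‖cos (2 * y * Z)‖ * ‖d * W / (w₁ * w₂) / sinh (W * y)‖
        ≤ N * S * Real.exp (-(2 * y)) := by
      rw [norm_div, div_eq_mul_inv ‖_‖]
      calc _ ≤ Real.exp (2 * M * y) * (N * (S * Real.exp (-(W * y)))) := by
            gcongr
            rw [hS]
            exact (inv_anti₀ hshp hsh).trans (inv_sinh_le hW0 hy1)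
        _ = N * S * Real.exp (2 * M * y + -(W * y)) := by rw [Real.exp_add]; ring
        _ ≤ _ := by
          gcongr
          rw [hW]
          nlinarith
    have b3 : ‖cos (2 * y * Z)‖ * ‖2 * (sin (2 * y * (d / 2)) * kap K w₁ w₂ y)
        - d * W / (w₁ * w₂) / sinh (W * y)‖ ≤ D₂ / (1 + y ^ 2) := by
      calc _ ≤ ‖cos (2 * y * Z)‖ * (‖2 * (sin (2 * y * (d / 2)) * kap K w₁ w₂ y)‖
            + ‖d * W / (w₁ * w₂) / sinh (W * y)‖) := by
              gcongr
              exact norm_sub_le _ _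
        _ ≤ 2 * C₂ * Real.exp (-(δ * y)) + N * S * Real.exp (-(2 * y)) := by
              rw [mul_add]; exact add_le_add b1 b2
        _ ≤ 2 * C₂ * ((1 + 2 / δ ^ 2) / (1 + y ^ 2)) + N * S * ((1 + 2 / 2 ^ 2) / (1 + y ^ 2)) := by
              gcongr
              · exact exp_neg_le_inv_one_add_sq hδ hy.le
              · exact exp_neg_le_inv_one_add_sq two_pos hy.le
        _ = _ := by rw [hD₂]; ring
    calc _ ≤ ‖cos (2 * y * Z)‖ * ‖2 * (sin (2 * y * (d / 2)) * kap K w₁ w₂ y)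
          - d * W / (w₁ * w₂) / sinh (W * y)‖ := div_le_self (by positivity) hy1
      _ ≤ D₂ / (1 + y ^ 2) := b3
      _ ≤ _ := by gcongr; linarith

theorem abs_log_norm_cosh_sub_le {u : ℂ} (hu : |u.im| ≤ Real.pi / 4) :
    abs (Real.log ‖cosh u‖ - |u.re|) ≤ Real.log 4 := by
  have hup : ‖cosh u‖ ≤ Real.exp |u.re| := by
    rw [← Complex.cos_mul_I]
    simpa using norm_cos_le_exp (u * I)
  have hcos : 1 / 2 ≤ Real.cos u.im := by
    rw [← Real.cos_abs]
    have h1 : Real.cos (Real.pi / 3) ≤ Real.cos |u.im| :=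
      Real.cos_le_cos_of_nonneg_of_le_pi (abs_nonneg _) (by linarith [Real.pi_pos])
        (by linarith [Real.pi_pos])
    rwa [Real.cos_pi_div_three] at h1
  have hre : (cosh u).re = Real.cosh u.re * Real.cos u.im := by
    conv_lhs => rw [← re_add_im u]
    rw [Complex.cosh_add, Complex.cosh_mul_I, Complex.sinh_mul_I, ← ofReal_cosh, ← ofReal_sinh,
      ← ofReal_cos, ← ofReal_sin]
    simp only [add_re, mul_re, ofReal_re, ofReal_im, I_re, I_im, mul_zero, zero_mul, sub_zero,
      mul_im, add_zero, mul_one]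
  have hlow : Real.exp |u.re| / 4 ≤ ‖cosh u‖ := by
    refine le_trans ?_ (re_le_norm _)
    rw [hre, ← Real.cosh_abs, Real.cosh_eq]
    have := Real.exp_pos (-|u.re|)
    have := Real.exp_pos |u.re|
    nlinarith
  have hpos : 0 < ‖cosh u‖ := lt_of_lt_of_le (by positivity) hlow
  have l1 : Real.log ‖cosh u‖ ≤ |u.re| := (Real.log_le_iff_le_exp hpos).2 hup
  have l2 : |u.re| - Real.log 4 ≤ Real.log ‖cosh u‖ := by
    have := Real.log_le_log (by positivity) hlow
    rwa [Real.log_div (Real.exp_pos _).ne' (by norm_num), Real.log_exp] at this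
  have : 0 ≤ Real.log 4 := Real.log_nonneg (by norm_num)
  rw [abs_le]
  constructor <;> linarith

/-- Quotients of hyperbolic gamma functions grow or decay exponentially along horizontal lines. -/
theorem exists_norm_exp_gTrunc_sub_le (K : ℕ) {B m₁ m₂ k E M δ : ℝ} (hB : 0 ≤ B) (hm₁ : 0 < m₁)
    (hm₂ : 0 < m₂) (hk : 0 ≤ k) (hk₁ : k ≤ K * m₁) (hk₂ : k ≤ K * m₂) (hM : 0 ≤ M)
    (hδ : 0 < δ) (hME : 2 * M + E + δ ≤ m₁ + m₂ + 2 * k) : ∃ C,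
    ∀ {w₁ w₂ d Z : ℂ}, ‖w₁‖ ≤ B → ‖w₂‖ ≤ B → ‖d‖ ≤ 2 * B → m₁ ≤ w₁.re → m₂ ≤ w₂.re →
      |Z.im| ≤ M → |d.im| ≤ E →
        ‖exp (I * (gTrunc K w₁ w₂ (Z + d / 2) - gTrunc K w₁ w₂ (Z - d / 2)))‖
          ≤ Real.exp (C + Real.pi * (d / (w₁ * w₂)).im * |Z.re|) := by
  obtain ⟨C, hC, hb⟩ := exists_norm_gInt_sub_le K hB hm₁ hm₂ hk hk₁ hk₂ hM hδ hME
  set W : ℝ := 4 * M + 2 with hW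
  have hW0 : 0 < W := by rw [hW]; positivity
  set N := 2 * B * W / (m₁ * m₂) with hN
  have hN0 : 0 ≤ N := by positivity
  refine ⟨(∫ y in Ioi (0 : ℝ), C * (1 + y ^ 2)⁻¹) + N * ‖jFun W 0‖ + N * Real.pi
    + N * Real.log 4, ?_⟩
  intro w₁ w₂ d Z hw₁ hw₂ hd hr₁ hr₂ hZ hdim
  have hZW : |Z.im| < W / 2 := by rw [hW]; linarith
  have hp1 : 2 * |(Z + d / 2).im| < m₁ + m₂ + 2 * k := by
    have : (Z + d / 2).im = Z.im + d.im / 2 := by simp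
    rw [this]
    have := abs_add_le Z.im (d.im / 2)
    rw [abs_div, abs_of_pos (two_pos : (0 : ℝ) < 2)] at this
    linarith
  have hp2 : 2 * |(Z - d / 2).im| < m₁ + m₂ + 2 * k := by
    have : (Z - d / 2).im = Z.im - d.im / 2 := by simp
    rw [this]
    have := abs_sub Z.im (d.im / 2)
    rw [abs_div, abs_of_pos (two_pos : (0 : ℝ) < 2)] at this
    linarith
  have i1 := integrableOn_gInt K hm₁ hm₂ hk hk₁ hk₂ hr₁ hr₂ hp1
  have i2 := integrableOn_gInt K hm₁ hm₂ hk hk₁ hk₂ hr₁ hr₂ hp2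
  have i3 : IntegrableOn (jInt W Z) (Ioi 0) :=
    integrableOn_jInt (by simpa using hW0) (by simpa using hZW)
  set η := d * W / (w₁ * w₂) with hη
  have hηN : ‖η‖ ≤ N := by
    rw [hη, norm_div, norm_mul, norm_mul, Complex.norm_of_nonneg hW0.le, hN]
    have := hr₁.trans (re_le_norm _)
    have := hr₂.trans (re_le_norm _)
    gcongr
  -- The remainder `R` is bounded uniformly in `Re Z`. The growth comes from `η * jFun W Z`, in
  -- which `log ‖cosh (π Z / W)‖` is `(π / W) |Re Z|` up to a constant; the auxiliary `W` then
  -- cancels against the one in `η`.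
  set R := gTrunc K w₁ w₂ (Z + d / 2) - gTrunc K w₁ w₂ (Z - d / 2) - η * jFun W Z with hR
  have hRn : ‖R‖ ≤ ∫ y in Ioi (0 : ℝ), C * (1 + y ^ 2)⁻¹ := by
    have e : R = ∫ y in Ioi (0 : ℝ), (gInt K w₁ w₂ (Z + d / 2) y - gInt K w₁ w₂ (Z - d / 2) y
        - η * jInt W Z y) := by
      have h := integral_sub (i1.sub i2) (i3.const_mul η)
      simp only [Pi.sub_apply] at h
      rw [h, integral_sub i1 i2, integral_const_mul, hR]
      rfl
    rw [e]
    refine norm_integral_le_of_norm_le (integrable_inv_one_add_sq.const_mul C).restrict ?_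
    filter_upwards [self_mem_ae_restrict measurableSet_Ioi] with y hy
    rw [← div_eq_mul_inv]
    exact hb hw₁ hw₂ hd hr₁ hr₂ hZ hdim hy
  have hg : gTrunc K w₁ w₂ (Z + d / 2) - gTrunc K w₁ w₂ (Z - d / 2)
      = R + η * (jFun W 0 - log (cosh (Real.pi * Z / W))) := by
    rw [← jFun_eq_sub_log hW0 hZW, hR]; ring
  set L := log (cosh (Real.pi * Z / W)) with hL
  have hu : Real.pi * Z / W = ((Real.pi / W : ℝ) : ℂ) * Z := by push_cast; ring
  have him : |(Real.pi * Z / W).im| ≤ Real.pi / 4 := by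
    rw [hu, im_ofReal_mul, abs_mul, abs_of_pos (by positivity), div_mul_eq_mul_div,
      div_le_iff₀ hW0]
    have := Real.pi_pos
    have : |Z.im| ≤ W / 4 := by rw [hW]; linarith
    nlinarith
  have hlog := abs_log_norm_cosh_sub_le him
  have hre : |(Real.pi * Z / W).re| = Real.pi / W * |Z.re| := by
    rw [hu, re_ofReal_mul, abs_mul, abs_of_pos (by positivity)]
  rw [hre] at hlog
  have hLre : L.re = Real.log ‖cosh (Real.pi * Z / W)‖ := Complex.log_re _
  have hLim : |L.im| ≤ Real.pi := by rw [hL, Complex.log_im]; exact abs_arg_le_pi _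
  rw [Complex.norm_exp]
  refine Real.exp_le_exp.2 ?_
  have e1 : (I * (gTrunc K w₁ w₂ (Z + d / 2) - gTrunc K w₁ w₂ (Z - d / 2))).re
      = -R.im - (η * jFun W 0).im + η.re * L.im + η.im * L.re := by
    rw [hg, mul_sub]
    simp
    ring
  rw [e1]
  have b1 : -R.im ≤ ∫ y in Ioi (0 : ℝ), C * (1 + y ^ 2)⁻¹ :=
    (neg_le_abs _).trans ((abs_im_le_norm R).trans hRn)
  have b2 : -(η * jFun W 0).im ≤ N * ‖jFun W 0‖ := by
    refine (neg_le_abs _).trans ((abs_im_le_norm _).trans ?_)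
    rw [norm_mul]; gcongr
  have b3 : η.re * L.im ≤ N * Real.pi := by
    refine (le_abs_self _).trans ?_
    rw [abs_mul]
    have := (abs_re_le_norm η).trans hηN
    gcongr
  have b4 : η.im * (L.re - Real.pi / W * |Z.re|) ≤ N * Real.log 4 := by
    refine (le_abs_self _).trans ?_
    rw [abs_mul, hLre]
    have := (abs_im_le_norm η).trans hηN
    gcongr
  have e2 : η.im * (Real.pi / W * |Z.re|) = Real.pi * (d / (w₁ * w₂)).im * |Z.re| := by
    have : η = (W : ℂ) * (d / (w₁ * w₂)) := by rw [hη]; ring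
    rw [this, im_ofReal_mul]
    field_simp
  linarith

theorem hypGamma_ne_zero (w₁ w₂ z : ℂ) : hypGamma w₁ w₂ z ≠ 0 := Complex.exp_ne_zero _

theorem hypGamma_neg (w₁ w₂ z : ℂ) : hypGamma w₁ w₂ (-z) = (hypGamma w₁ w₂ z)⁻¹ := by
  rw [hypGamma, hypGamma, ← gTrunc_zero, gTrunc_neg, mul_neg, Complex.exp_neg, gTrunc_zero]

theorem differentiableAt_hypGamma {w₁ w₂ z : ℂ} (h₁ : 0 < w₁.re) (h₂ : 0 < w₂.re)
    (hz : |z.im| < (wMean w₁ w₂).re) : DifferentiableAt ℂ (hypGamma w₁ w₂) z := by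
  have e : (wMean w₁ w₂).re = (w₁.re + w₂.re) / 2 := by simp [wMean]
  rw [e] at hz
  -- The lower bounds `(1 + t) / 2 * Re wⱼ` are strictly below `Re wⱼ`, yet their sum still exceeds
  -- `2 |Im z|`, because `t < 1`.
  set t := |z.im| / ((w₁.re + w₂.re) / 2) with ht
  have ht1 : t < 1 := by rw [ht, div_lt_one (by linarith)]; exact hz
  have ht0 : 0 ≤ t := by positivity
  have htz : |z.im| = t * ((w₁.re + w₂.re) / 2) := by rw [ht]; field_simp
  have h := differentiableAt_gTrunc 0 (m₁ := (1 + t) / 2 * w₁.re) (m₂ := (1 + t) / 2 * w₂.re)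
    (k := 0) (by positivity) (by positivity) le_rfl (by simp) (by simp) (w₁ := w₁) (w₂ := w₂)
    (z := z) (by nlinarith) (by nlinarith) (by nlinarith)
  have h' : DifferentiableAt ℂ (fun x => gTrunc 0 w₁ w₂ x) z :=
    h.comp (f := fun x : ℂ => ((w₁, w₂, x) : ℂ × ℂ × ℂ)) z (by fun_prop)
  simp only [gTrunc_zero] at h'
  exact (h'.const_mul I).cexp

/-- This is the preceding estimate recentred at `Z = z + (a + b) / 2`; replacing `|Re Z|` by `|Re
z|` costs only a constant. -/
theorem exists_norm_exp_gTrunc_le (K : ℕ) {B m₁ m₂ k E M δ : ℝ} (hB : 0 ≤ B) (hm₁ : 0 < m₁)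
    (hm₂ : 0 < m₂) (hk : 0 ≤ k) (hk₁ : k ≤ K * m₁) (hk₂ : k ≤ K * m₂) (hM : 0 ≤ M)
    (hδ : 0 < δ) (hME : 2 * M + E + δ ≤ m₁ + m₂ + 2 * k) : ∃ C,
    ∀ {w₁ w₂ a b z : ℂ}, ‖w₁‖ ≤ B → ‖w₂‖ ≤ B → ‖a‖ ≤ B → ‖b‖ ≤ B → m₁ ≤ w₁.re → m₂ ≤ w₂.re →
      |(z + (a + b) / 2).im| ≤ M → |(a - b).im| ≤ E →
        ‖exp (I * (gTrunc K w₁ w₂ (z + a) - gTrunc K w₁ w₂ (z + b)))‖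
          ≤ Real.exp (C + Real.pi * ((a - b) / (w₁ * w₂)).im * |z.re|) := by
  obtain ⟨C, hC⟩ := exists_norm_exp_gTrunc_sub_le K hB hm₁ hm₂ hk hk₁ hk₂ hM hδ hME
  refine ⟨C + Real.pi * (2 * B / (m₁ * m₂)) * B, ?_⟩
  intro w₁ w₂ a b z hw₁ hw₂ ha hb hr₁ hr₂ hZ hd
  have hab : ‖a - b‖ ≤ 2 * B := (norm_sub_le a b).trans (by linarith)
  have h := hC hw₁ hw₂ hab hr₁ hr₂ hZ hd
  rw [show z + (a + b) / 2 + (a - b) / 2 = z + a by ring,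
    show z + (a + b) / 2 - (a - b) / 2 = z + b by ring] at h
  refine h.trans (Real.exp_le_exp.2 ?_)
  have h1 : abs (|(z + (a + b) / 2).re| - |z.re|) ≤ B := by
    refine (abs_abs_sub_abs_le_abs_sub _ _).trans ?_
    have : (z + (a + b) / 2).re - z.re = ((a + b) / 2).re := by simp
    rw [this]
    refine (abs_re_le_norm _).trans ?_
    rw [norm_div, Complex.norm_ofNat]
    linarith [norm_add_le a b]
  have h2 : |((a - b) / (w₁ * w₂)).im| ≤ 2 * B / (m₁ * m₂) := by
    refine (abs_im_le_norm _).trans ?_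
    rw [norm_div, norm_mul]
    have := hr₁.trans (re_le_norm _)
    have := hr₂.trans (re_le_norm _)
    gcongr
  have h3 : ((a - b) / (w₁ * w₂)).im * (|(z + (a + b) / 2).re| - |z.re|)
      ≤ 2 * B / (m₁ * m₂) * B := by
    refine (le_abs_self _).trans ?_
    rw [abs_mul]
    gcongr
  have := mul_le_mul_of_nonneg_left h3 Real.pi_pos.le
  linarith

/-- A product of quotients of hyperbolic gamma functions. -/
def gammaQuot (w₁ w₂ : ℂ) (a b : Fin 4 → ℂ) (z : ℂ) : ℂ :=
  ∏ j, hypGamma w₁ w₂ (z + a j) / hypGamma w₁ w₂ (z + b j)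

theorem abs_im_add_lt_of_mem_Icc {a c z : ℂ} {r α β : ℝ} (hα : |α + a.im| < r)
    (hβ : |β + a.im| < r) (hz : z.im ∈ Icc α β) (hc : c = z + a) : |c.im| < r := by
  subst hc
  rw [abs_lt] at *
  have := hz.1
  have := hz.2
  rw [add_im]
  constructor <;> linarith

theorem differentiableAt_gammaQuot {w₁ w₂ z : ℂ} {a b : Fin 4 → ℂ} (h₁ : 0 < w₁.re)
    (h₂ : 0 < w₂.re) (ha : ∀ j, |(z + a j).im| < (wMean w₁ w₂).re)
    (hb : ∀ j, |(z + b j).im| < (wMean w₁ w₂).re) : DifferentiableAt ℂ (gammaQuot w₁ w₂ a b) z := by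
  unfold gammaQuot
  refine DifferentiableAt.fun_finsetProd fun j _ => ?_
  refine DifferentiableAt.fun_div ?_ ?_ (hypGamma_ne_zero _ _ _)
  · exact (differentiableAt_hypGamma h₁ h₂ (ha j)).comp (f := fun z => z + a j) z (by fun_prop)
  · exact (differentiableAt_hypGamma h₁ h₂ (hb j)).comp (f := fun z => z + b j) z (by fun_prop)

theorem exists_norm_gammaQuot_le {w₁ w₂ : ℂ} {a b : Fin 4 → ℂ} (h₁ : 0 < w₁.re)
    (h₂ : 0 < w₂.re) {α β : ℝ} (hα : ∀ j, |α + (a j).im| < (wMean w₁ w₂).re)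
    (hβ : ∀ j, |β + (a j).im| < (wMean w₁ w₂).re) (hα' : ∀ j, |α + (b j).im| < (wMean w₁ w₂).re)
    (hβ' : ∀ j, |β + (b j).im| < (wMean w₁ w₂).re) : ∃ C, ∀ z : ℂ, z.im ∈ Icc α β →
      ‖gammaQuot w₁ w₂ a b z‖ ≤ Real.exp (C + Real.pi * ((∑ j, (a j - b j)) / (w₁ * w₂)).im * |z.re|) := by
  have e : (wMean w₁ w₂).re = (w₁.re + w₂.re) / 2 := by simp [wMean]
  have hfac : ∀ j, ∃ C, ∀ z : ℂ, z.im ∈ Icc α β →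
      ‖hypGamma w₁ w₂ (z + a j) / hypGamma w₁ w₂ (z + b j)‖
        ≤ Real.exp (C + Real.pi * ((a j - b j) / (w₁ * w₂)).im * |z.re|) := by
    intro j
    set M := max |α + (a j + b j).im / 2| |β + (a j + b j).im / 2| with hM
    -- The absolute values of the midpoint and of half the difference add up to the larger of the
    -- two absolute values.
    have key : ∀ y : ℝ, |y + (a j).im| < (wMean w₁ w₂).re → |y + (b j).im| < (wMean w₁ w₂).re →
        |y + (a j + b j).im / 2| + |(a j - b j).im| / 2 < (wMean w₁ w₂).re := by
      intro y hy1 hy2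
      rw [abs_lt] at hy1 hy2
      rw [add_im, sub_im]
      rcases abs_cases (y + ((a j).im + (b j).im) / 2) with h | h <;>
      rcases abs_cases ((a j).im - (b j).im) with h' | h' <;> linarith [h.1, h'.1]
    have hlt : M + |(a j - b j).im| / 2 < (wMean w₁ w₂).re := by
      rcases max_cases |α + (a j + b j).im / 2| |β + (a j + b j).im / 2| with h | h
      · rw [hM, h.1]; exact key α (hα j) (hα' j)
      · rw [hM, h.1]; exact key β (hβ j) (hβ' j)
    have hM0 : 0 ≤ M := (abs_nonneg _).trans (le_max_left _ _)
    obtain ⟨C, hC⟩ := exists_norm_exp_gTrunc_le 0 (B := ‖w₁‖ + ‖w₂‖ + ‖a j‖ + ‖b j‖) (m₁ := w₁.re)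
      (m₂ := w₂.re) (k := 0) (E := |(a j - b j).im|) (M := M)
      (δ := w₁.re + w₂.re - 2 * M - |(a j - b j).im|) (by positivity) h₁ h₂ le_rfl (by simp)
      (by simp) hM0 (by linarith) (by linarith)
    refine ⟨C, fun z hz => ?_⟩
    have := norm_nonneg w₁
    have := norm_nonneg w₂
    have := norm_nonneg (a j)
    have := norm_nonneg (b j)
    have h := hC (w₁ := w₁) (w₂ := w₂) (a := a j) (b := b j) (z := z) (by linarith) (by linarith)
      (by linarith) (by linarith) le_rfl le_rfl ?_ le_rfl
    · rwa [mul_sub, Complex.exp_sub, gTrunc_zero, gTrunc_zero] at h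
    · have e1 : (z + (a j + b j) / 2).im = z.im + (a j + b j).im / 2 := by simp
      have m1 := le_max_left |α + (a j + b j).im / 2| |β + (a j + b j).im / 2|
      have m2 := le_max_right |α + (a j + b j).im / 2| |β + (a j + b j).im / 2|
      rw [← hM] at m1 m2
      rw [e1]
      rw [abs_le] at m1 m2 ⊢
      constructor <;> linarith [hz.1, hz.2]
  choose C hC using hfac
  refine ⟨∑ j, C j, fun z hz => ?_⟩
  rw [gammaQuot, norm_prod]
  refine (Finset.prod_le_prod (fun j _ => norm_nonneg _) fun j _ => hC j z hz).trans (le_of_eq ?_)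
  rw [← Real.exp_sum, Finset.sum_add_distrib, ← Finset.sum_mul, ← Finset.mul_sum, Finset.sum_div,
    im_sum]

theorem exists_pow_mul_exp_le {A c : ℝ} (hA : 1 ≤ A) (hc : 0 < c) (N : ℕ) : ∃ C, 0 ≤ C ∧
    ∀ s : ℝ, 0 ≤ s → (A + s) ^ N * Real.exp (-(c * s)) ≤ C / (1 + s ^ 2) := by
  refine ⟨(N + 2).factorial / c ^ (N + 2) * Real.exp (c * A), by positivity, fun s hs => ?_⟩
  rw [le_div_iff₀ (by positivity)]
  have h := Real.pow_div_factorial_le_exp (c * (A + s)) (by positivity) (N + 2)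
  have h1 : (1 + s ^ 2) ≤ (A + s) ^ 2 := by nlinarith
  have h2 : (A + s) ^ (N + 2) ≤ (N + 2).factorial / c ^ (N + 2) * Real.exp (c * (A + s)) := by
    rw [mul_pow, div_le_iff₀ (by positivity)] at h
    rw [div_mul_eq_mul_div, le_div_iff₀ (by positivity)]
    linarith
  calc (A + s) ^ N * Real.exp (-(c * s)) * (1 + s ^ 2)
      ≤ (A + s) ^ N * Real.exp (-(c * s)) * (A + s) ^ 2 := by gcongr
    _ = (A + s) ^ (N + 2) * Real.exp (-(c * s)) := by ring
    _ ≤ (N + 2).factorial / c ^ (N + 2) * Real.exp (c * (A + s)) * Real.exp (-(c * s)) := by gcongr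
    _ = _ := by rw [mul_assoc, ← Real.exp_add]; ring_nf

/-! ### A Bézout identity for products of linear factors -/

theorem exists_prod_add_eq {R κ : Type*} [CommRing R] (t : Finset κ) (x : R) (β : κ → R) :
    ∃ v, ∏ j ∈ t, (x + β j) = x * v + ∏ j ∈ t, β j := by
  classical
  induction t using Finset.induction_on with
  | empty => exact ⟨0, by simp⟩
  | insert j t hj ih =>
    obtain ⟨v, hv⟩ := ih
    refine ⟨x * v + ∏ j ∈ t, β j + β j * v, ?_⟩
    rw [Finset.prod_insert hj, Finset.prod_insert hj, hv]
    ring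

/-- The right side is a resultant, which lies in the ideal generated by the two products. In the
application `α i` contains `-iz` and `β j` contains `+iz`, so every sum `α i + β j` is free of `z`:
this is a partial fraction decomposition with coefficients polynomial in all the factors, and it
needs no distinctness of the roots. -/
theorem exists_bezout_prod {R ι κ : Type*} [CommRing R] (s : Finset ι) (t : Finset κ) (α : ι → R)
    (β : κ → R) : ∃ a b : R, a * ∏ i ∈ s, α i + b * ∏ j ∈ t, β j
      = ∏ i ∈ s, ∏ j ∈ t, (α i + β j) := by
  classical
  induction s using Finset.induction_on with
  | empty => exact ⟨1, 0, by simp⟩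
  | insert i s hi ih =>
    obtain ⟨a, b, hab⟩ := ih
    obtain ⟨v, hv⟩ := exists_prod_add_eq t (α i) β
    refine ⟨v * a, α i * v * b + a * ∏ i ∈ s, α i + b * ∏ j ∈ t, β j, ?_⟩
    rw [Finset.prod_insert hi, Finset.prod_insert hi, hv, ← hab]
    ring

/-- Entire functions of polynomial growth. -/
def polyGrowth (V : Type*) [NormedAddCommGroup V] [NormedSpace ℂ V] : Subring (V → ℂ) where
  carrier := {u | Differentiable ℂ u ∧ ∃ (C : ℝ) (N : ℕ), 0 ≤ C ∧ ∀ q, ‖u q‖ ≤ C * (1 + ‖q‖) ^ N}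
  mul_mem' := by
    rintro u v ⟨hu, C, N, hC, hb⟩ ⟨hv, C', N', hC', hb'⟩
    refine ⟨hu.mul hv, C * C', N + N', by positivity, fun q => ?_⟩
    rw [Pi.mul_apply, norm_mul]
    calc _ ≤ (C * (1 + ‖q‖) ^ N) * (C' * (1 + ‖q‖) ^ N') := by
          gcongr
          · exact hb q
          · exact hb' q
      _ = _ := by ring
  one_mem' := ⟨differentiable_const _, 1, 0, zero_le_one, fun q => by simp⟩
  add_mem' := by
    rintro u v ⟨hu, C, N, hC, hb⟩ ⟨hv, C', N', hC', hb'⟩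
    refine ⟨hu.add hv, C + C', N + N', by positivity, fun q => ?_⟩
    have h1 : 1 ≤ 1 + ‖q‖ := by linarith [norm_nonneg q]
    rw [Pi.add_apply]
    calc _ ≤ ‖u q‖ + ‖v q‖ := norm_add_le _ _
      _ ≤ C * (1 + ‖q‖) ^ N + C' * (1 + ‖q‖) ^ N' := add_le_add (hb q) (hb' q)
      _ ≤ C * (1 + ‖q‖) ^ (N + N') + C' * (1 + ‖q‖) ^ (N + N') := by
          gcongr
          · omega
          · omega
      _ = _ := by ring
  zero_mem' := ⟨differentiable_const _, 0, 0, le_rfl, fun q => by simp⟩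
  neg_mem' := by
    rintro u ⟨hu, C, N, hC, hb⟩
    exact ⟨hu.neg, C, N, hC, fun q => by rw [Pi.neg_apply, norm_neg]; exact hb q⟩

theorem mem_polyGrowth_of_norm_le {V : Type*} [NormedAddCommGroup V] [NormedSpace ℂ V] {u : V → ℂ}
    (hu : Differentiable ℂ u) {C : ℝ} (hC : ∀ q, ‖u q‖ ≤ C * ‖q‖) : u ∈ polyGrowth V := by
  refine ⟨hu, |C|, 1, abs_nonneg _, fun q => (hC q).trans ?_⟩
  rw [pow_one]
  calc C * ‖q‖ ≤ |C| * ‖q‖ := by gcongr; exact le_abs_self C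
    _ ≤ _ := by gcongr; linarith

/-! ### The data of the integral as functions of all parameters -/

abbrev pγ (p : Params) : Fin 4 → ℂ := p.2.2.1
abbrev pX (p : Params) : ℂ := p.2.2.2.1
abbrev pL (p : Params) : ℂ := p.2.2.2.2

def numOff (p : Params) : Fin 4 → ℂ :=
  ![pX p + pL p / 2 - I * wMean p.1 p.2.1 / 2 + I * parTau (pγ p),
    pX p + pL p / 2 - I * wMean p.1 p.2.1 / 2 - I * parTau (pγ p),
    -pL p / 2 - I * wMean p.1 p.2.1 / 2 + I * parSigma (pγ p),
    -pL p / 2 - I * wMean p.1 p.2.1 / 2 - I * parSigma (pγ p)]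

def denOff (p : Params) : Fin 4 → ℂ :=
  ![pX p - pL p / 2 + I * wMean p.1 p.2.1 / 2 + I * parRho (pγ p),
    pX p - pL p / 2 + I * wMean p.1 p.2.1 / 2 - I * parRho (pγ p),
    pL p / 2 + I * wMean p.1 p.2.1 / 2 + I * parUpsilon (pγ p),
    pL p / 2 + I * wMean p.1 p.2.1 / 2 - I * parUpsilon (pγ p)]

/-- The arguments of the hyperbolic gamma functions in `1 / Δ`. -/
def deltaArg (γ : Fin 4 → ℂ) (x : ℂ) : Fin 4 → ℂ :=
  ![x - I * γ 0, x - I * γ 1, -(x + I * γ 2), -(x + I * γ 3)]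

/-- The arguments of the hyperbolic gamma functions in `N / (Δ Δ̂)`. -/
def preArg (p : Params) : Fin 3 ⊕ Fin 4 ⊕ Fin 4 → ℂ :=
  Sum.elim (fun j => I * pγ p 0 + I * pγ p j.succ + I * wMean p.1 p.2.1)
    (Sum.elim (deltaArg (pγ p) (pX p)) (deltaArg (dualPar (pγ p)) (pL p)))

theorem dualPar_zero (γ : Fin 4 → ℂ) : dualPar γ 0 = (γ 0 + γ 1 + γ 2 + γ 3) / 2 := by
  simp [dualPar, dotProduct, Fin.sum_univ_four]; ring
theorem dualPar_one (γ : Fin 4 → ℂ) : dualPar γ 1 = (γ 0 + γ 1 - γ 2 - γ 3) / 2 := by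
  simp [dualPar, dotProduct, Fin.sum_univ_four]; ring
theorem dualPar_two (γ : Fin 4 → ℂ) : dualPar γ 2 = (γ 0 - γ 1 + γ 2 - γ 3) / 2 := by
  simp [dualPar, dotProduct, Fin.sum_univ_four]; ring
theorem dualPar_three (γ : Fin 4 → ℂ) : dualPar γ 3 = (γ 0 - γ 1 - γ 2 + γ 3) / 2 := by
  simp [dualPar, dotProduct, Fin.sum_univ_four]; ring

theorem psiIntegrand_eq (p : Params) (z : ℂ) :
    psiIntegrand p.1 p.2.1 (pγ p) (pX p) (pL p) z
      = gammaQuot p.1 p.2.1 (numOff p) (denOff p) z := by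
  simp only [psiIntegrand, gammaQuot, hypGammaPM, Fin.prod_univ_four, numOff, denOff,
    Matrix.cons_val]
  ring_nf

theorem inv_Delta (w₁ w₂ : ℂ) (γ : Fin 4 → ℂ) (x : ℂ) :
    (Delta w₁ w₂ γ x)⁻¹ = ∏ j, hypGamma w₁ w₂ (deltaArg γ x j) := by
  simp only [Delta, Fin.prod_univ_four, deltaArg, Matrix.cons_val, hypGamma_neg, div_eq_mul_inv,
    mul_inv, inv_inv]
  ring

theorem sFormula_eq (p : Params) : sFormula p.1 p.2.1 (pγ p) (pX p) (pL p)
    = (∏ i, hypGamma p.1 p.2.1 (preArg p i)) * ((p.1 * p.2.1) ^ (1 / 2 : ℂ))⁻¹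
      * psi p.1 p.2.1 (pγ p) (pX p) (pL p) := by
  simp only [preArg, Fintype.prod_sum_type, Sum.elim_inl, Sum.elim_inr, ← inv_Delta, sFormula, normN,
    div_eq_mul_inv, mul_inv]
  ring

theorem differentiable_numOff (j : Fin 4) : Differentiable ℂ fun p => numOff p j := by
  unfold numOff wMean parTau parSigma
  fin_cases j <;> simp <;> fun_prop

theorem differentiable_denOff (j : Fin 4) : Differentiable ℂ fun p => denOff p j := by
  unfold denOff wMean parRho parUpsilon
  fin_cases j <;> simp <;> fun_prop

theorem differentiable_preArg (i : Fin 3 ⊕ Fin 4 ⊕ Fin 4) : Differentiable ℂ fun p => preArg p i := by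
  rcases i with i | i | i
  · simp only [preArg, Sum.elim_inl, wMean]
    fun_prop
  · simp only [preArg, Sum.elim_inl, Sum.elim_inr, deltaArg]
    fin_cases i <;> simp <;> fun_prop
  · simp only [preArg, Sum.elim_inr, deltaArg, dualPar_zero, dualPar_one, dualPar_two,
      dualPar_three]
    fin_cases i <;> simp <;> fun_prop

theorem norm_pW₁_le (p : Params) : ‖p.1‖ ≤ ‖p‖ := norm_fst_le p

theorem norm_pW₂_le (p : Params) : ‖p.2.1‖ ≤ ‖p‖ := (norm_fst_le p.2).trans (norm_snd_le p)

theorem norm_pγ_le (p : Params) (j : Fin 4) : ‖pγ p j‖ ≤ ‖p‖ :=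
  (norm_le_pi_norm _ j).trans ((norm_fst_le p.2.2).trans ((norm_snd_le p.2).trans (norm_snd_le p)))

theorem norm_pX_le (p : Params) : ‖pX p‖ ≤ ‖p‖ :=
  (norm_fst_le p.2.2.2).trans ((norm_snd_le p.2.2).trans ((norm_snd_le p.2).trans (norm_snd_le p)))

theorem norm_pL_le (p : Params) : ‖pL p‖ ≤ ‖p‖ :=
  (norm_snd_le p.2.2.2).trans ((norm_snd_le p.2.2).trans ((norm_snd_le p.2).trans (norm_snd_le p)))

theorem norm_wMean_le (p : Params) : ‖wMean p.1 p.2.1‖ ≤ ‖p‖ := by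
  rw [wMean, norm_div, Complex.norm_ofNat]
  linarith [norm_add_le p.1 p.2.1, norm_pW₁_le p, norm_pW₂_le p]

theorem norm_four_le {a b c d x l w t : ℂ} {s : ℝ} (hx : ‖x‖ ≤ s) (hl : ‖l‖ ≤ s) (hw : ‖w‖ ≤ s)
    (ht : ‖t‖ ≤ s) (ha : ‖a‖ ≤ 1) (hb : ‖b‖ ≤ 1 / 2) (hc : ‖c‖ ≤ 1 / 2) (hd : ‖d‖ ≤ 1) :
    ‖a * x + b * l + c * w + d * t‖ ≤ 3 * s := by
  refine (norm_add₄_le).trans ?_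
  simp only [norm_mul]
  have h1 : ‖a‖ * ‖x‖ ≤ 1 * s := by gcongr
  have h2 : ‖b‖ * ‖l‖ ≤ 1 / 2 * s := by gcongr
  have h3 : ‖c‖ * ‖w‖ ≤ 1 / 2 * s := by gcongr
  have h4 : ‖d‖ * ‖t‖ ≤ 1 * s := by gcongr
  linarith

theorem norm_half_add_le {a b : ℂ} {s : ℝ} (ha : ‖a‖ ≤ s) (hb : ‖b‖ ≤ s) : ‖(a + b) / 2‖ ≤ s := by
  rw [norm_div, Complex.norm_ofNat]
  linarith [norm_add_le a b]

theorem norm_half_sub_le {a b : ℂ} {s : ℝ} (ha : ‖a‖ ≤ s) (hb : ‖b‖ ≤ s) : ‖(a - b) / 2‖ ≤ s := by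
  rw [norm_div, Complex.norm_ofNat]
  linarith [norm_sub_le a b]

theorem norm_numOff_le (p : Params) (j : Fin 4) : ‖numOff p j‖ ≤ 3 * ‖p‖ := by
  have hτ : ‖parTau (pγ p)‖ ≤ ‖p‖ := norm_half_sub_le (norm_pγ_le p _) (norm_pγ_le p _)
  have hσ : ‖parSigma (pγ p)‖ ≤ ‖p‖ := norm_half_add_le (norm_pγ_le p _) (norm_pγ_le p _)
  have key := fun (t : ℂ) (ht : ‖t‖ ≤ ‖p‖) (a b c d : ℂ) =>
    norm_four_le (a := a) (b := b) (c := c) (d := d) (norm_pX_le p) (norm_pL_le p) (norm_wMean_le p) ht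
  fin_cases j
  · refine le_of_eq_of_le (congrArg _ ?_) (key _ hτ 1 (1 / 2) (-I / 2) I ?_ ?_ ?_ ?_)
    · simp [numOff]; ring
    all_goals simp
  · refine le_of_eq_of_le (congrArg _ ?_) (key _ hτ 1 (1 / 2) (-I / 2) (-I) ?_ ?_ ?_ ?_)
    · simp [numOff]; ring
    all_goals simp
  · refine le_of_eq_of_le (congrArg _ ?_) (key _ hσ 0 (-1 / 2) (-I / 2) I ?_ ?_ ?_ ?_)
    · simp [numOff]; ring
    all_goals simp
  · refine le_of_eq_of_le (congrArg _ ?_) (key _ hσ 0 (-1 / 2) (-I / 2) (-I) ?_ ?_ ?_ ?_)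
    · simp [numOff]; ring
    all_goals simp

theorem norm_denOff_le (p : Params) (j : Fin 4) : ‖denOff p j‖ ≤ 3 * ‖p‖ := by
  have hρ : ‖parRho (pγ p)‖ ≤ ‖p‖ := norm_half_sub_le (norm_pγ_le p _) (norm_pγ_le p _)
  have hυ : ‖parUpsilon (pγ p)‖ ≤ ‖p‖ := by
    rw [parUpsilon, neg_div, norm_neg]
    exact norm_half_add_le (norm_pγ_le p _) (norm_pγ_le p _)
  have key := fun (t : ℂ) (ht : ‖t‖ ≤ ‖p‖) (a b c d : ℂ) =>
    norm_four_le (a := a) (b := b) (c := c) (d := d) (norm_pX_le p) (norm_pL_le p) (norm_wMean_le p) ht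
  fin_cases j
  · refine le_of_eq_of_le (congrArg _ ?_) (key _ hρ 1 (-1 / 2) (I / 2) I ?_ ?_ ?_ ?_)
    · simp [denOff]; ring
    all_goals simp
  · refine le_of_eq_of_le (congrArg _ ?_) (key _ hρ 1 (-1 / 2) (I / 2) (-I) ?_ ?_ ?_ ?_)
    · simp [denOff]; ring
    all_goals simp
  · refine le_of_eq_of_le (congrArg _ ?_) (key _ hυ 0 (1 / 2) (I / 2) I ?_ ?_ ?_ ?_)
    · simp [denOff]; ring
    all_goals simp
  · refine le_of_eq_of_le (congrArg _ ?_) (key _ hυ 0 (1 / 2) (I / 2) (-I) ?_ ?_ ?_ ?_)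
    · simp [denOff]; ring
    all_goals simp

theorem norm_deltaArg_le {γ : Fin 4 → ℂ} {x : ℂ} {s t : ℝ} (hγ : ∀ j, ‖γ j‖ ≤ s) (hx : ‖x‖ ≤ t)
    (j : Fin 4) : ‖deltaArg γ x j‖ ≤ t + s := by
  have h1 : ∀ i, ‖x - I * γ i‖ ≤ t + s := fun i => by
    refine (norm_sub_le _ _).trans ?_
    rw [norm_mul, norm_I, one_mul]
    linarith [hγ i]
  have h2 : ∀ i, ‖-(x + I * γ i)‖ ≤ t + s := fun i => by
    rw [norm_neg]
    refine (norm_add_le _ _).trans ?_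
    rw [norm_mul, norm_I, one_mul]
    linarith [hγ i]
  fin_cases j
  · exact h1 0
  · exact h1 1
  · exact h2 2
  · exact h2 3

theorem norm_preArg_le (p : Params) (i : Fin 3 ⊕ Fin 4 ⊕ Fin 4) : ‖preArg p i‖ ≤ 3 * ‖p‖ := by
  have hp := norm_nonneg p
  rcases i with i | i | i
  · simp only [preArg, Sum.elim_inl]
    refine (norm_add₃_le).trans ?_
    simp only [norm_mul, norm_I, one_mul]
    linarith [norm_pγ_le p 0, norm_pγ_le p i.succ, norm_wMean_le p]
  · exact (norm_deltaArg_le (norm_pγ_le p) (norm_pX_le p) i).trans (by linarith)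
  · refine (norm_deltaArg_le (s := 2 * ‖p‖) (fun j => ?_) (norm_pL_le p) i).trans (by linarith)
    have h : ∀ a b c d : ℂ, ‖a‖ ≤ ‖p‖ → ‖b‖ ≤ ‖p‖ → ‖c‖ ≤ ‖p‖ → ‖d‖ ≤ ‖p‖ →
        ‖(a + b + c + d) / 2‖ ≤ 2 * ‖p‖ := by
      intro a b c d ha hb hc hd
      rw [norm_div, Complex.norm_ofNat]
      linarith [norm_add₄_le (a := a) (b := b) (c := c) (d := d)]
    have h0 := norm_pγ_le p 0
    have h1 := norm_pγ_le p 1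
    have h2 := norm_pγ_le p 2
    have h3 := norm_pγ_le p 3
    have n1 : ‖-pγ p 1‖ ≤ ‖p‖ := by rwa [norm_neg]
    have n2 : ‖-pγ p 2‖ ≤ ‖p‖ := by rwa [norm_neg]
    have n3 : ‖-pγ p 3‖ ≤ ‖p‖ := by rwa [norm_neg]
    fin_cases j
    · exact le_of_eq_of_le (congrArg _ (dualPar_zero _)) (h _ _ _ _ h0 h1 h2 h3)
    · refine le_of_eq_of_le (congrArg _ ((dualPar_one _).trans ?_)) (h _ _ _ _ h0 h1 n2 n3)
      ring
    · refine le_of_eq_of_le (congrArg _ ((dualPar_two _).trans ?_)) (h _ _ _ _ h0 n1 h2 n3)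
      ring
    · refine le_of_eq_of_le (congrArg _ ((dualPar_three _).trans ?_)) (h _ _ _ _ h0 n1 n2 h3)
      ring

/-- This sum fixes the decay of the integrand: the exponent is `π Im (-4 i w / (w₁ w₂)) = -2π Re (1
/ w₁ + 1 / w₂)` times `|Re z|`, independently of `γ`, `x` and `λ`. -/
theorem sum_numOff_sub_denOff (p : Params) :
    ∑ j, (numOff p j - denOff p j) = -4 * I * wMean p.1 p.2.1 := by
  simp only [Fin.sum_univ_four, numOff, denOff, Matrix.cons_val]
  ring

/-! ### Consequences of the defining inequalities of the base domain -/

theorem abs_re_par_le_xi (γ : Fin 4 → ℂ) : |(parRho γ).re| ≤ xi γ ∧ |(parSigma γ).re| ≤ xi γ ∧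
    |(parTau γ).re| ≤ xi γ ∧ |(parUpsilon γ).re| ≤ xi γ := by
  refine ⟨?_, ?_, ?_, ?_⟩ <;> simp [xi]

/-- The gap `ζ - |Im x|` bounds from below the distance of the arguments from the edge of the strip,
hence the linear factors carrying the poles. -/
theorem abs_im_numOff_le {p : Params} (hp : p ∈ baseDomain) (j : Fin 4) :
    |(numOff p j).im| ≤ (wMean p.1 p.2.1).re - (zeta p.1 p.2.1 (pγ p) (pL p) - |(pX p).im|) := by
  obtain ⟨h₁, h₂, hx, -⟩ := hp
  have hw : 0 < (wMean p.1 p.2.1).re := by simp [wMean]; linarith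
  obtain ⟨-, hσ, hτ, -⟩ := abs_re_par_le_xi (pγ p)
  have hl : (pL p / 2).im = (pL p).im / 2 := by simp
  rw [zeta, hl]
  have k1 := abs_le.1 hσ
  have k2 := abs_le.1 hτ
  have k3 := abs_le.1 (le_refl |(pX p).im|)
  have k4 := abs_le.1 (le_refl |(pL p).im / 2|)
  have hx' := abs_nonneg (pX p).im
  rw [abs_le]
  fin_cases j <;> constructor <;>
    simp [numOff, sub_im, add_im, mul_im] <;> linarith [k1.1, k1.2, k2.1, k2.2, k3.1, k3.2, k4.1, k4.2]

theorem abs_im_denOff_le {p : Params} (hp : p ∈ baseDomain) (j : Fin 4) :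
    |(denOff p j).im| ≤ (wMean p.1 p.2.1).re - (zeta p.1 p.2.1 (pγ p) (pL p) - |(pX p).im|) := by
  obtain ⟨h₁, h₂, hx, -⟩ := hp
  have hw : 0 < (wMean p.1 p.2.1).re := by simp [wMean]; linarith
  obtain ⟨hρ, -, -, hυ⟩ := abs_re_par_le_xi (pγ p)
  have hl : (pL p / 2).im = (pL p).im / 2 := by simp
  rw [zeta, hl]
  have k1 := abs_le.1 hρ
  have k2 := abs_le.1 hυ
  have k3 := abs_le.1 (le_refl |(pX p).im|)
  have k4 := abs_le.1 (le_refl |(pL p).im / 2|)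
  have hx' := abs_nonneg (pX p).im
  rw [abs_le]
  fin_cases j <;> constructor <;>
    simp [denOff, sub_im, add_im, mul_im] <;> linarith [k1.1, k1.2, k2.1, k2.2, k3.1, k3.2, k4.1, k4.2]

theorem gap_pos {p : Params} (hp : p ∈ baseDomain) :
    0 < zeta p.1 p.2.1 (pγ p) (pL p) - |(pX p).im| := sub_pos.2 hp.2.2.1

theorem abs_im_preArg_lt {p : Params} (hp : p ∈ baseDomain) (i : Fin 3 ⊕ Fin 4 ⊕ Fin 4) :
    |(preArg p i).im| < (wMean p.1 p.2.1).re := by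
  obtain ⟨h₁, h₂, hx, hN⟩ := hp
  rcases i with i | i
  · exact hN i
  have hx' : |(pX p).im| < zeta p.1 p.2.1 (pγ p) (pL p) := hx
  have hl : (pL p / 2).im = (pL p).im / 2 := by simp
  rw [zeta, hl] at hx'
  obtain ⟨hρ, hσ, hτ, hυ⟩ := abs_re_par_le_xi (pγ p)
  have k1 := abs_le.1 hρ
  have k2 := abs_le.1 hσ
  have k3 := abs_le.1 hτ
  have k4 := abs_le.1 hυ
  simp only [parRho, parSigma, parTau, parUpsilon] at k1 k2 k3 k4
  have e : ∀ a : ℂ, (a / 2).re = a.re / 2 := fun a => by simp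
  simp only [e, neg_re, add_re, sub_re] at k1 k2 k3 k4
  have k5 := abs_le.1 (le_refl |(pX p).im|)
  have k6 := abs_le.1 (le_refl |(pL p).im / 2|)
  have n5 := abs_nonneg (pX p).im
  have n6 := abs_nonneg ((pL p).im / 2)
  rw [abs_lt]
  rcases i with i | i
  · fin_cases i <;> constructor <;>
      simp [preArg, deltaArg] <;>
      linarith [k1.1, k1.2, k2.1, k2.2, k3.1, k3.2, k4.1, k4.2, k5.1, k5.2]
  · fin_cases i <;> constructor <;>
      simp [preArg, deltaArg, dualPar_zero, dualPar_one, dualPar_two, dualPar_three] <;>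
      linarith [k1.1, k1.2, k2.1, k2.2, k3.1, k3.2, k4.1, k4.2, k6.1, k6.2]

/-! ### Bounded convex subdomains exhausting the domain of continuation -/

def bddDomain (n : ℕ) : Set Params :=
  {p | ‖p‖ < n ∧ 1 / (n : ℝ) < p.1.re ∧ 1 / (n : ℝ) < p.2.1.re}

theorem isOpen_bddDomain (n : ℕ) : IsOpen (bddDomain n) := by
  have h1 : IsOpen {p : Params | ‖p‖ < n} := isOpen_lt (by fun_prop) (by fun_prop)
  have h2 : IsOpen {p : Params | 1 / (n : ℝ) < p.1.re} := isOpen_lt (by fun_prop) (by fun_prop)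
  have h3 : IsOpen {p : Params | 1 / (n : ℝ) < p.2.1.re} := isOpen_lt (by fun_prop) (by fun_prop)
  exact h1.inter (h2.inter h3)

theorem convex_bddDomain (n : ℕ) : Convex ℝ (bddDomain n) := by
  have h1 : Convex ℝ {p : Params | ‖p‖ < n} := by
    have : {p : Params | ‖p‖ < n} = Metric.ball 0 n := by ext; simp
    rw [this]
    exact convex_ball _ _
  have h2 : Convex ℝ {p : Params | 1 / (n : ℝ) < p.1.re} :=
    convex_halfSpace_gt (f := fun p : Params => p.1.re) ⟨fun p q => by simp, fun c p => by simp⟩ _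
  have h3 : Convex ℝ {p : Params | 1 / (n : ℝ) < p.2.1.re} :=
    convex_halfSpace_gt (f := fun p : Params => p.2.1.re) ⟨fun p q => by simp, fun c p => by simp⟩ _
  exact h1.inter (h2.inter h3)

theorem one_le_of_mem_bddDomain {n : ℕ} {p : Params} (hp : p ∈ bddDomain n) : (1 : ℝ) ≤ n := by
  have h : (0 : ℝ) < n := (norm_nonneg p).trans_lt hp.1
  exact_mod_cast h

theorem bddDomain_subset (n : ℕ) : bddDomain n ⊆ bigDomain := fun p hp => by
  have h := one_le_of_mem_bddDomain hp
  have h' : (0 : ℝ) < 1 / n := by positivity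
  exact ⟨h'.trans hp.2.1, h'.trans hp.2.2⟩

theorem exists_forall_mem_bddDomain {p : Params} (hp : p ∈ bigDomain) :
    ∃ n₀ : ℕ, ∀ n ≥ n₀, p ∈ bddDomain n := by
  obtain ⟨a, ha⟩ := exists_nat_gt ‖p‖
  obtain ⟨b, hb⟩ := exists_nat_one_div_lt hp.1
  obtain ⟨c, hc⟩ := exists_nat_one_div_lt hp.2
  refine ⟨a + b + c + 1, fun n hn => ⟨?_, ?_, ?_⟩⟩
  · refine ha.trans_le ?_
    exact_mod_cast (by omega : a ≤ n)
  · refine lt_of_le_of_lt ?_ hb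
    gcongr
    exact_mod_cast (by omega : b + 1 ≤ n)
  · refine lt_of_le_of_lt ?_ hc
    gcongr
    exact_mod_cast (by omega : c + 1 ≤ n)

/-- The truncation level used on `bddDomain n`. -/
def truncLevel (n : ℕ) : ℕ := n * (20 * n + 10)

/-- The part of the integrand without zeros and poles. -/
def expQuot (n : ℕ) (q : Params × ℂ) : ℂ :=
  ∏ j, Complex.exp (I * (gTrunc (truncLevel n) q.1.1 q.1.2.1 (q.2 + numOff q.1 j)
    - gTrunc (truncLevel n) q.1.1 q.1.2.1 (q.2 + denOff q.1 j)))

theorem abs_im_add_le {z a : ℂ} {s t : ℝ} (hz : |z.im| ≤ s) (ha : ‖a‖ ≤ t) : |(z + a).im| ≤ s + t := by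
  rw [add_im]
  exact (abs_add_le _ _).trans (add_le_add hz ((abs_im_le_norm a).trans ha))

theorem differentiableAt_gTrunc_comp {V : Type*} [NormedAddCommGroup V] [NormedSpace ℂ V] {n : ℕ}
    {w₁ w₂ t : V → ℂ} {v : V} (hn : (1 : ℝ) ≤ n) (hw₁ : DifferentiableAt ℂ w₁ v)
    (hw₂ : DifferentiableAt ℂ w₂ v) (ht : DifferentiableAt ℂ t v) (h₁ : 1 / (n : ℝ) < (w₁ v).re)
    (h₂ : 1 / (n : ℝ) < (w₂ v).re) (h : |(t v).im| ≤ 6 * n + 1) :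
    DifferentiableAt ℂ (fun q => gTrunc (truncLevel n) (w₁ q) (w₂ q) (t q)) v := by
  -- As the real parts of the periods exceed `1 / n`, the level `n (20 n + 10)` widens the strip by
  -- `20 n + 10`, more than enough for arguments of imaginary part at most `6 n + 1`.
  have hk : (20 * (n : ℝ) + 10) ≤ truncLevel n * (1 / (n : ℝ)) := by
    rw [truncLevel]
    push_cast
    field_simp
    rfl
  have hn' : (0 : ℝ) < 1 / n := by positivity
  have := differentiableAt_gTrunc (w₁ := w₁ v) (w₂ := w₂ v) (z := t v) (truncLevel n) hn' hn'
    (k := 20 * (n : ℝ) + 10) (by positivity) hk hk h₁ h₂ (by linarith)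
  exact DifferentiableAt.comp (g := fun q : ℂ × ℂ × ℂ => gTrunc (truncLevel n) q.1 q.2.1 q.2.2)
    (f := fun q => (w₁ q, w₂ q, t q)) v this (hw₁.prodMk (hw₂.prodMk ht))

theorem differentiableAt_expQuot {n : ℕ} {q : Params × ℂ} (hp : q.1 ∈ bddDomain n)
    (hz : |q.2.im| ≤ 3 * n + 1) : DifferentiableAt ℂ (expQuot n) q := by
  have hn := one_le_of_mem_bddDomain hp
  have hd : ∀ t : Params → ℂ, Differentiable ℂ t → ‖t q.1‖ ≤ 3 * ‖q.1‖ →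
      DifferentiableAt ℂ (fun q : Params × ℂ => gTrunc (truncLevel n) q.1.1 q.1.2.1 (q.2 + t q.1)) q := by
    intro t ht hb
    have ht' : DifferentiableAt ℂ (fun q : Params × ℂ => q.2 + t q.1) q :=
      differentiableAt_snd.add (DifferentiableAt.comp q (ht q.1) differentiableAt_fst)
    refine differentiableAt_gTrunc_comp hn (by fun_prop) (by fun_prop) ht' hp.2.1 hp.2.2 ?_
    have := abs_im_add_le hz (hb.trans (mul_le_mul_of_nonneg_left hp.1.le (by norm_num)))
    linarith
  have hf : ∀ j ∈ Finset.univ, DifferentiableAt ℂ (fun q : Params × ℂ =>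
      Complex.exp (I * (gTrunc (truncLevel n) q.1.1 q.1.2.1 (q.2 + numOff q.1 j)
        - gTrunc (truncLevel n) q.1.1 q.1.2.1 (q.2 + denOff q.1 j)))) q := by
    intro j _
    apply DifferentiableAt.cexp
    apply DifferentiableAt.const_mul
    exact ((hd (fun p => numOff p j) (differentiable_numOff j) (norm_numOff_le _ j)).fun_sub
      (hd (fun p => denOff p j) (differentiable_denOff j) (norm_denOff_le _ j)))
  unfold expQuot
  simp only [Fin.prod_univ_four]
  have := fun j => hf j (Finset.mem_univ j)
  exact (((this 0).mul (this 1)).mul (this 2)).mul (this 3)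

theorem one_div_le_re_inv {n : ℕ} {w : ℂ} (hn : (1 : ℝ) ≤ n) (h : 1 / (n : ℝ) < w.re) (hw : ‖w‖ ≤ n) :
    1 / (n : ℝ) ^ 3 ≤ (w⁻¹).re := by
  have hn' : (0 : ℝ) < 1 / n := by positivity
  have hw0 : 0 < ‖w‖ := (hn'.trans h).trans_le (re_le_norm w)
  rw [inv_re, normSq_eq_norm_sq]
  calc 1 / (n : ℝ) ^ 3 = (1 / n) / (n : ℝ) ^ 2 := by field_simp
    _ ≤ w.re / ‖w‖ ^ 2 := by
        have := hn'.trans h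
        gcongr

/-- On `bddDomain n` one has `Re (1 / wⱼ) ≥ 1 / n³`, so `expQuot` decays at least like `exp (-4π |Re
z| / n³)`, uniformly in the parameters. This beats every polynomial factor. -/
theorem exists_norm_expQuot_mul_le (n : ℕ) {u : Params × ℂ → ℂ} (hu : u ∈ polyGrowth (Params × ℂ)) :
    ∃ C, 0 ≤ C ∧ ∀ p ∈ bddDomain n, ∀ z : ℂ, |z.im| ≤ 3 * n + 1 →
      ‖expQuot n (p, z) * u (p, z)‖ ≤ C / (1 + z.re ^ 2) := by
  rcases Nat.eq_zero_or_pos n with rfl | hn0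
  · exact ⟨0, le_rfl, fun p hp => absurd hp.1 (not_lt.2 (by simp))⟩
  have hn : (1 : ℝ) ≤ n := by exact_mod_cast hn0
  have hn' : (0 : ℝ) < 1 / n := by positivity
  have hk : (20 * (n : ℝ) + 10) ≤ truncLevel n * (1 / (n : ℝ)) := by
    rw [truncLevel]
    push_cast
    field_simp
    rfl
  obtain ⟨C₁, hC₁⟩ := exists_norm_exp_gTrunc_le (truncLevel n) (B := 3 * n) (m₁ := 1 / n) (m₂ := 1 / n)
    (k := 20 * n + 10) (M := 6 * n + 1) (E := 6 * n) (δ := 1) (by positivity) hn' hn' (by positivity)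
    hk hk (by positivity) one_pos (by linarith)
  obtain ⟨hud, C₂, N, hC₂, hub⟩ := hu
  obtain ⟨C₃, hC₃, hexp⟩ := exists_pow_mul_exp_le (A := 4 * n + 2) (c := 4 * Real.pi / n ^ 3)
    (by linarith) (by positivity) N
  refine ⟨Real.exp (4 * C₁) * C₂ * C₃, by positivity, fun p hp z hz => ?_⟩
  have hpn : ‖p‖ ≤ n := hp.1.le
  have hE : ‖expQuot n (p, z)‖ ≤ Real.exp (4 * C₁) * Real.exp (-(4 * Real.pi / n ^ 3 * |z.re|)) := by
    rw [expQuot, norm_prod]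
    have hj : ∀ j ∈ Finset.univ, ‖Complex.exp (I * (gTrunc (truncLevel n) p.1 p.2.1 (z + numOff p j)
        - gTrunc (truncLevel n) p.1 p.2.1 (z + denOff p j)))‖ ≤
        Real.exp (C₁ + Real.pi * ((numOff p j - denOff p j) / (p.1 * p.2.1)).im * |z.re|) := by
      intro j _
      have ha := (norm_numOff_le p j).trans (mul_le_mul_of_nonneg_left hpn (by norm_num))
      have hb := (norm_denOff_le p j).trans (mul_le_mul_of_nonneg_left hpn (by norm_num))
      refine hC₁ ((norm_pW₁_le p).trans (by linarith)) ((norm_pW₂_le p).trans (by linarith)) ha hb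
        hp.2.1.le hp.2.2.le ?_ ?_
      · refine (abs_im_add_le hz (norm_half_add_le ha hb)).trans (by linarith)
      · refine (abs_im_le_norm _).trans ((norm_sub_le _ _).trans (by linarith))
    refine (Finset.prod_le_prod (fun j _ => norm_nonneg _) hj).trans ?_
    rw [← Real.exp_sum, ← Real.exp_add, Real.exp_le_exp, Finset.sum_add_distrib, ← Finset.sum_mul,
      ← Finset.mul_sum, ← im_sum, ← Finset.sum_div, sum_numOff_sub_denOff]
    have e : -4 * I * wMean p.1 p.2.1 / (p.1 * p.2.1) = -2 * (I * (p.1⁻¹ + p.2.1⁻¹)) := by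
      have h1 : p.1 ≠ 0 := ne_zero_of_re_pos (hn'.trans hp.2.1)
      have h2 : p.2.1 ≠ 0 := ne_zero_of_re_pos (hn'.trans hp.2.2)
      rw [wMean]
      field_simp
      ring
    have e2 : (-2 * (I * (p.1⁻¹ + p.2.1⁻¹))).im = -2 * ((p.1⁻¹).re + (p.2.1⁻¹).re) := by
      simp [mul_im]
    have i1 := one_div_le_re_inv hn hp.2.1 ((norm_pW₁_le p).trans hpn)
    have i2 := one_div_le_re_inv hn hp.2.2 ((norm_pW₂_le p).trans hpn)
    rw [e, e2]
    simp only [Finset.sum_const, Finset.card_univ, Fintype.card_fin, nsmul_eq_mul]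
    have h3 : 4 * Real.pi / n ^ 3 * |z.re| ≤ Real.pi * (2 * ((p.1⁻¹).re + (p.2.1⁻¹).re)) * |z.re| := by
      gcongr
      have : 4 * Real.pi / (n : ℝ) ^ 3 = Real.pi * (2 * (1 / (n : ℝ) ^ 3 + 1 / (n : ℝ) ^ 3)) := by ring
      rw [this]
      gcongr
    push_cast
    linarith
  have hU : ‖u (p, z)‖ ≤ C₂ * ((4 * n + 2) + |z.re|) ^ N := by
    refine (hub _).trans (mul_le_mul_of_nonneg_left (pow_le_pow_left₀ (by positivity) ?_ N) hC₂)
    have hpz : ‖(p, z)‖ ≤ n + (|z.re| + (3 * n + 1)) := by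
      refine (norm_prod_le_iff).2 ⟨?_, ?_⟩
      · have := abs_nonneg z.re
        simp only
        linarith
      · refine (norm_le_abs_re_add_abs_im z).trans ?_
        linarith
    linarith
  rw [norm_mul]
  calc _ ≤ (Real.exp (4 * C₁) * Real.exp (-(4 * Real.pi / n ^ 3 * |z.re|))) *
        (C₂ * ((4 * n + 2) + |z.re|) ^ N) := by gcongr
    _ = Real.exp (4 * C₁) * C₂ * (((4 * n + 2) + |z.re|) ^ N *
        Real.exp (-(4 * Real.pi / n ^ 3 * |z.re|))) := by ring
    _ ≤ Real.exp (4 * C₁) * C₂ * (C₃ / (1 + |z.re| ^ 2)) := by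
        gcongr
        exact hexp _ (abs_nonneg _)
    _ = _ := by rw [sq_abs]; ring

/-! ### Integrals over horizontal lines -/

/-- The integral of `expQuot n * u / v` over the line `Im z = h`. -/
def lineInt (n : ℕ) (u v : Params × ℂ → ℂ) (h : ℝ) (p : Params) : ℂ :=
  ∫ x : ℝ, expQuot n (p, x + h * I) * u (p, x + h * I) / v (p, x + h * I)

theorem norm_div_le_of_le {a b : ℂ} {C s c : ℝ} (hc : 0 < c) (ha : ‖a‖ ≤ C / s)
    (hb : c ≤ ‖b‖) : ‖a / b‖ ≤ C / c / s := by
  rw [norm_div, div_right_comm]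
  have := (norm_nonneg a).trans ha
  gcongr

theorem differentiableAt_expQuot_mul_div {n : ℕ} {u v : Params × ℂ → ℂ} (hu : Differentiable ℂ u)
    (hv : Differentiable ℂ v) {p : Params} (hp : p ∈ bddDomain n) {z : ℂ} (hz : |z.im| ≤ 3 * n + 1)
    (hz0 : v (p, z) ≠ 0) : DifferentiableAt ℂ (fun q => expQuot n q * u q / v q) (p, z) := by
  simp only [div_eq_mul_inv]
  exact
  ((differentiableAt_expQuot (q := (p, z)) hp hz).fun_mul (hu _)).mul ((hv _).inv hz0)

theorem continuous_line {n : ℕ} {u v : Params × ℂ → ℂ} (hu : Differentiable ℂ u)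
    (hv : Differentiable ℂ v) {p : Params} (hp : p ∈ bddDomain n) {h : ℝ} (hh : |h| ≤ 3 * n + 1)
    (hv0 : ∀ z : ℂ, z.im = h → v (p, z) ≠ 0) :
    Continuous fun x : ℝ => expQuot n (p, x + h * I) * u (p, x + h * I) / v (p, x + h * I) := by
  refine continuous_iff_continuousAt.2 fun x => ?_
  have him : ((x : ℂ) + h * I).im = h := by simp
  have := (differentiableAt_expQuot_mul_div hu hv hp (z := x + h * I) (by rwa [him])
    (hv0 _ him)).continuousAt
  exact ContinuousAt.comp (f := fun x : ℝ => (p, (x : ℂ) + h * I)) this (by fun_prop)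

theorem differentiableOn_lineInt {n : ℕ} {u v : Params × ℂ → ℂ} (hu : u ∈ polyGrowth (Params × ℂ))
    (hv : Differentiable ℂ v) {h : ℝ} (hh : |h| ≤ 3 * n + 1)
    (hv1 : ∀ p ∈ bddDomain n, ∀ z : ℂ, z.im = h → 1 ≤ ‖v (p, z)‖) :
    DifferentiableOn ℂ (lineInt n u v h) (bddDomain n) := by
  obtain ⟨C, hC, hb⟩ := exists_norm_expQuot_mul_le n hu
  have him : ∀ x : ℝ, ((x : ℂ) + h * I).im = h := fun x => by simp
  have hre : ∀ x : ℝ, ((x : ℂ) + h * I).re = x := fun x => by simp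
  have h0 : ∀ p ∈ bddDomain n, ∀ z : ℂ, z.im = h → v (p, z) ≠ 0 := fun p hp z hz e => by
    have := hv1 p hp z hz
    rw [e, norm_zero] at this
    linarith
  refine differentiableOn_integral (isOpen_bddDomain n) (b := fun x => C / (1 + x ^ 2)) ?_ ?_ ?_ ?_
  · simpa only [div_eq_mul_inv] using integrable_inv_one_add_sq.const_mul C
  · intro p hp
    exact (continuous_line hu.1 hv hp hh (h0 p hp)).aestronglyMeasurable
  · refine ae_of_all _ fun x p hp => DifferentiableAt.differentiableWithinAt ?_
    have := differentiableAt_expQuot_mul_div hu.1 hv hp (z := x + h * I) (by rwa [him])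
      (h0 p hp _ (him x))
    exact DifferentiableAt.comp (f := fun p : Params => (p, (x : ℂ) + h * I)) p this (by fun_prop)
  · refine ae_of_all _ fun x p hp => ?_
    have := norm_div_le_of_le one_pos (hb p hp (x + h * I) (by rwa [him]))
      (hv1 p hp _ (him x))
    rwa [hre, div_one] at this

theorem integrable_line {n : ℕ} {u v : Params × ℂ → ℂ} (hu : u ∈ polyGrowth (Params × ℂ))
    (hv : Differentiable ℂ v) {p : Params} (hp : p ∈ bddDomain n) {h c : ℝ} (hh : |h| ≤ 3 * n + 1)
    (hc : 0 < c) (hvc : ∀ z : ℂ, z.im = h → c ≤ ‖v (p, z)‖) :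
    Integrable fun x : ℝ => expQuot n (p, x + h * I) * u (p, x + h * I) / v (p, x + h * I) := by
  obtain ⟨C, hC, hb⟩ := exists_norm_expQuot_mul_le n hu
  have him : ∀ x : ℝ, ((x : ℂ) + h * I).im = h := fun x => by simp
  have hre : ∀ x : ℝ, ((x : ℂ) + h * I).re = x := fun x => by simp
  refine integrable_of_bound_inv_one_add_sq (C := C / c)
    (continuous_line hu.1 hv hp hh fun z hz => norm_pos_iff.1
      (hc.trans_le (hvc z hz))).aestronglyMeasurable fun x => ?_
  have := norm_div_le_of_le hc (hb p hp (x + h * I) (by rwa [him]))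
    (hvc _ (him x))
  rwa [hre] at this

theorem lineInt_eq {n : ℕ} {u v : Params × ℂ → ℂ} (hu : u ∈ polyGrowth (Params × ℂ))
    (hv : Differentiable ℂ v) {p : Params} (hp : p ∈ bddDomain n) {h k c : ℝ} (hhk : h ≤ k)
    (hh : |h| ≤ 3 * n + 1) (hk : |k| ≤ 3 * n + 1) (hc : 0 < c)
    (hvc : ∀ z : ℂ, z.im ∈ Icc h k → c ≤ ‖v (p, z)‖) : lineInt n u v h p = lineInt n u v k p := by
  obtain ⟨C, hC, hb⟩ := exists_norm_expQuot_mul_le n hu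
  have him : ∀ z : ℂ, z.im ∈ Icc h k → |z.im| ≤ 3 * n + 1 := fun z hz =>
    abs_le.2 ⟨(abs_le.1 hh).1.trans hz.1, hz.2.trans (abs_le.1 hk).2⟩
  refine integral_horizontal_eq (f := fun z => expQuot n (p, z) * u (p, z) / v (p, z)) (C := C / c)
    hhk (fun z hz => DifferentiableAt.differentiableWithinAt ?_) fun z hz => ?_
  · have := differentiableAt_expQuot_mul_div hu.1 hv hp (him z hz)
      (norm_pos_iff.1 (hc.trans_le (hvc z hz)))
    exact DifferentiableAt.comp (f := fun z : ℂ => (p, z)) z this (by fun_prop)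
  · exact norm_div_le_of_le hc (hb p hp z (him z hz)) (hvc z hz)

/-! ### The linear factors carrying zeros and poles of the integrand -/

/-- With `c = -I` these factors vanish at poles of the gamma function with offset `t q.1 k.1`, with
`c = I` at its zeros. The pair `k.2` numbers the pole or zero. -/
def linFac (c : ℂ) (t : Params → Fin 4 → ℂ) (k : Fin 4 × ℕ × ℕ) (q : Params × ℂ) : ℂ :=
  poleA q.1.1 q.1.2.1 k.2 + c * (q.2 + t q.1 k.1)

def facIdx (n : ℕ) : Finset (Fin 4 × ℕ × ℕ) :=
  Finset.univ ×ˢ (Finset.range (truncLevel n) ×ˢ Finset.range (truncLevel n))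

theorem linFac_mem {c : ℂ} {t : Params → Fin 4 → ℂ} (hc : ‖c‖ = 1) (ht : ∀ j, Differentiable ℂ fun p => t p j)
    (hb : ∀ p j, ‖t p j‖ ≤ 3 * ‖p‖) (k : Fin 4 × ℕ × ℕ) : linFac c t k ∈ polyGrowth (Params × ℂ) := by
  refine mem_polyGrowth_of_norm_le (C := (k.2.1 + 1 / 2) + (k.2.2 + 1 / 2) + (1 + 3)) ?_ fun q => ?_
  · have h2 : Differentiable ℂ fun q : Params × ℂ => t q.1 k.1 := (ht k.1).comp differentiable_fst
    unfold linFac poleA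
    fun_prop
  · have h1 := norm_fst_le q
    have h2 := norm_snd_le q
    have h3 : ∀ m : ℕ, ‖((m : ℂ) + 1 / 2)‖ = m + 1 / 2 := fun m => by
      have : ((m : ℂ) + 1 / 2) = ((m + 1 / 2 : ℝ) : ℂ) := by push_cast; rfl
      rw [this, norm_real, Real.norm_of_nonneg (by positivity)]
    have h4 : ‖poleA q.1.1 q.1.2.1 k.2‖ ≤ (k.2.1 + 1 / 2) * ‖q‖ + (k.2.2 + 1 / 2) * ‖q‖ := by
      refine (norm_add_le _ _).trans ?_
      rw [norm_mul, norm_mul, h3, h3]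
      gcongr
      · exact (norm_pW₁_le _).trans h1
      · exact (norm_pW₂_le _).trans h1
    have h5 : ‖c * (q.2 + t q.1 k.1)‖ ≤ ‖q‖ + 3 * ‖q‖ := by
      rw [norm_mul, hc, one_mul]
      refine (norm_add_le _ _).trans ?_
      have := hb q.1 k.1
      gcongr
      linarith
    refine (norm_add_le _ _).trans ?_
    linarith

theorem polePoly_eq (n : ℕ) (p : Params) (z : ℂ) (t : Params → Fin 4 → ℂ) :
    ∏ j, polePoly (truncLevel n) p.1 p.2.1 (z + t p j) = ∏ k ∈ facIdx n, linFac (-I) t k (p, z) := by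
  rw [facIdx, Finset.prod_product]
  refine Finset.prod_congr rfl fun j _ => Finset.prod_congr rfl fun i _ => ?_
  simp only [linFac]
  ring

theorem polePoly_neg_eq (n : ℕ) (p : Params) (z : ℂ) (t : Params → Fin 4 → ℂ) :
    ∏ j, polePoly (truncLevel n) p.1 p.2.1 (-(z + t p j)) = ∏ k ∈ facIdx n, linFac I t k (p, z) := by
  rw [facIdx, Finset.prod_product]
  refine Finset.prod_congr rfl fun j _ => Finset.prod_congr rfl fun i _ => ?_
  simp only [linFac]
  ring

theorem gammaQuot_eq (n : ℕ) {p : Params} (hp : p ∈ bigDomain) {z : ℂ}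
    (ha : ∀ j, |(z + numOff p j).im| < (wMean p.1 p.2.1).re)
    (hb : ∀ j, |(z + denOff p j).im| < (wMean p.1 p.2.1).re) :
    gammaQuot p.1 p.2.1 (numOff p) (denOff p) z =
      expQuot n (p, z) * ((∏ k ∈ facIdx n, linFac I numOff k (p, z)) *
        ∏ k ∈ facIdx n, linFac (-I) denOff k (p, z)) /
      ((∏ k ∈ facIdx n, linFac (-I) numOff k (p, z)) * ∏ k ∈ facIdx n, linFac I denOff k (p, z)) := by
  rw [gammaQuot, ← polePoly_eq, ← polePoly_eq, ← polePoly_neg_eq, ← polePoly_neg_eq, expQuot,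
    ← Finset.prod_mul_distrib, ← Finset.prod_mul_distrib, ← Finset.prod_mul_distrib,
    ← Finset.prod_div_distrib]
  refine Finset.prod_congr rfl fun j _ => ?_
  rw [hypGamma_eq_trunc (truncLevel n) hp.1 hp.2 (ha j), hypGamma_eq_trunc (truncLevel n) hp.1 hp.2 (hb j),
    mul_sub, Complex.exp_sub]
  have := Complex.exp_ne_zero (I * gTrunc (truncLevel n) p.1 p.2.1 (z + denOff p j))
  simp only [div_eq_mul_inv, mul_inv, inv_inv]
  ring

theorem re_linFac_neg_I {t : Params → Fin 4 → ℂ} {p : Params} (hp : p ∈ bigDomain) (k : Fin 4 × ℕ × ℕ)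
    (z : ℂ) : (wMean p.1 p.2.1).re + (z + t p k.1).im ≤ (linFac (-I) t k (p, z)).re := by
  have h := re_poleA_ge hp.1 hp.2 k.2
  simp only [linFac, add_re, mul_re, neg_re, I_re, neg_im, I_im]
  linarith

theorem re_linFac_I {t : Params → Fin 4 → ℂ} {p : Params} (hp : p ∈ bigDomain) (k : Fin 4 × ℕ × ℕ)
    (z : ℂ) : (wMean p.1 p.2.1).re - (z + t p k.1).im ≤ (linFac I t k (p, z)).re := by
  have h := re_poleA_ge hp.1 hp.2 k.2
  simp only [linFac, add_re, mul_re, I_re, I_im]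
  linarith

/-! ### Continuation of `ψ` and of the explicit formula to the bounded domains. -/

theorem pow_le_norm_prod {ι : Type*} (s : Finset ι) (f : ι → ℂ) {c : ℝ} (hc : 0 ≤ c)
    (h : ∀ i ∈ s, c ≤ (f i).re) : c ^ s.card ≤ ‖∏ i ∈ s, f i‖ := by
  rw [norm_prod, ← Finset.prod_const]
  exact Finset.prod_le_prod (fun _ _ => hc) fun i hi => (h i hi).trans (re_le_norm _)

/-- Since `a α + b β = R`, the integrand `E u / (α β)` times `R` equals `E u a / β + E u b / α`. On
the base domain `β` has no zeros for `Im z ≤ 0` and `α` has none for `Im z ≥ 0`, so the first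
integral may be moved down to height `-(3n + 1)` and the second up to `3n + 1`. On those lines the
denominators stay away from zero for all parameters in `bddDomain n`, base domain or not, so both
integrals are holomorphic there. The factor `R`, independent of `z`, becomes the denominator of the
continuation. -/
theorem exists_psi_continuation (n : ℕ) : ∃ F R : Params → ℂ, DifferentiableOn ℂ F (bddDomain n) ∧
    Differentiable ℂ R ∧ ∀ p ∈ baseDomain ∩ bddDomain n, R p ≠ 0 ∧
      psi p.1 p.2.1 (pγ p) (pX p) (pL p) * R p = F p := by
  have hI : ‖I‖ = 1 := norm_I
  have hI' : ‖-I‖ = 1 := by rw [norm_neg, norm_I]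
  have mα := fun k => linFac_mem hI' differentiable_numOff norm_numOff_le k
  have mβ := fun k => linFac_mem hI differentiable_denOff norm_denOff_le k
  have mα' := fun k => linFac_mem hI differentiable_numOff norm_numOff_le k
  have mβ' := fun k => linFac_mem hI' differentiable_denOff norm_denOff_le k
  -- Taking the identity in the ring of entire functions of polynomial growth ensures that
  -- multiplication by `a` and `b` does not destroy integrability against `expQuot`.
  obtain ⟨⟨a, ha⟩, ⟨b, hb⟩, hab⟩ := exists_bezout_prod (R := polyGrowth (Params × ℂ)) (facIdx n) (facIdx n)
    (fun k => ⟨_, mα k⟩) (fun k => ⟨_, mβ k⟩)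
  have hab' : ∀ q, a q * ∏ k ∈ facIdx n, linFac (-I) numOff k q +
      b q * ∏ k ∈ facIdx n, linFac I denOff k q =
      ∏ i ∈ facIdx n, ∏ j ∈ facIdx n, (linFac (-I) numOff i q + linFac I denOff j q) := by
    intro q
    have := congrFun (congrArg Subtype.val hab) q
    simpa [Finset.prod_apply] using this
  clear hab
  set α : Params × ℂ → ℂ := ∏ k ∈ facIdx n, linFac (-I) numOff k with hα
  set β : Params × ℂ → ℂ := ∏ k ∈ facIdx n, linFac I denOff k with hβ
  set u : Params × ℂ → ℂ := (∏ k ∈ facIdx n, linFac I numOff k) * ∏ k ∈ facIdx n, linFac (-I) denOff k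
    with hu
  have mA : α ∈ polyGrowth (Params × ℂ) := Subring.prod_mem _ fun k _ => mα k
  have mB : β ∈ polyGrowth (Params × ℂ) := Subring.prod_mem _ fun k _ => mβ k
  have mU : u ∈ polyGrowth (Params × ℂ) :=
    Subring.mul_mem _ (Subring.prod_mem _ fun k _ => mα' k) (Subring.prod_mem _ fun k _ => mβ' k)
  have eα : ∀ q, α q = ∏ k ∈ facIdx n, linFac (-I) numOff k q := fun q => by rw [hα, Finset.prod_apply]
  have eβ : ∀ q, β q = ∏ k ∈ facIdx n, linFac I denOff k q := fun q => by rw [hβ, Finset.prod_apply]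
  set R : Params × ℂ → ℂ := a * α + b * β with hR
  have eR : ∀ q, R q = ∏ i ∈ facIdx n, ∏ j ∈ facIdx n, (linFac (-I) numOff i q + linFac I denOff j q) := by
    intro q
    rw [← hab', ← eα, ← eβ]
    rfl
  have hRz : ∀ p z, R (p, z) = R (p, 0) := by
    intro p z
    rw [eR, eR]
    refine Finset.prod_congr rfl fun i _ => Finset.prod_congr rfl fun j _ => ?_
    simp only [linFac]
    ring
  have hRd : Differentiable ℂ R := (ha.1.mul mA.1).add (hb.1.mul mB.1)
  have hn0 : (0 : ℝ) ≤ n := by positivity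
  have hH : |(3 * n + 1 : ℝ)| ≤ 3 * n + 1 := (abs_of_nonneg (by positivity)).le
  have hH' : |(-(3 * n + 1) : ℝ)| ≤ 3 * n + 1 := by rw [abs_neg]; exact hH
  have h00 : |(0 : ℝ)| ≤ 3 * n + 1 := by rw [abs_zero]; positivity
  have hw0 : ∀ p ∈ bddDomain n, 0 < (wMean p.1 p.2.1).re := fun p hp => by
    have := bddDomain_subset n hp
    simp only [wMean, div_ofNat_re, add_re]
    linarith [this.1, this.2]
  refine ⟨fun p => lineInt n (u * a) β (-(3 * n + 1)) p + lineInt n (u * b) α (3 * n + 1) p,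
    fun p => R (p, 0), ?_, hRd.comp (by fun_prop), ?_⟩
  · refine (differentiableOn_lineInt (Subring.mul_mem _ mU ha) mB.1 hH' ?_).add
      (differentiableOn_lineInt (Subring.mul_mem _ mU hb) mA.1 hH ?_)
    · intro p hp z hz
      rw [eβ, ← one_pow (facIdx n).card]
      refine pow_le_norm_prod _ _ zero_le_one fun k _ => ?_
      -- The offsets have norm below `3n`, so at height `-(3n + 1)` every factor has real part at
      -- least `1`.
      refine le_trans ?_ (re_linFac_I (bddDomain_subset n hp) k z)
      have h1 := (abs_le.1 ((abs_im_le_norm _).trans (norm_denOff_le p k.1))).2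
      have h2 := hp.1
      have h3 := hw0 p hp
      rw [add_im, hz]
      linarith
    · intro p hp z hz
      rw [eα, ← one_pow (facIdx n).card]
      refine pow_le_norm_prod _ _ zero_le_one fun k _ => ?_
      refine le_trans ?_ (re_linFac_neg_I (bddDomain_subset n hp) k z)
      have h1 := (abs_le.1 ((abs_im_le_norm _).trans (norm_numOff_le p k.1))).1
      have h2 := hp.1
      have h3 := hw0 p hp
      rw [add_im, hz]
      linarith
  · rintro p ⟨hpb, hp⟩
    have hbig := bddDomain_subset n hp
    have hw := hw0 p hp
    set g := zeta p.1 p.2.1 (pγ p) (pL p) - |(pX p).im| with hg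
    have hg0 : 0 < g := gap_pos hpb
    have hα1 : ∀ z : ℂ, 0 ≤ z.im → ∀ k, g ≤ (linFac (-I) numOff k (p, z)).re := fun z hz k => by
      refine le_trans ?_ (re_linFac_neg_I hbig k z)
      have := (abs_le.1 (abs_im_numOff_le hpb k.1)).1
      rw [add_im]
      linarith
    have hβ1 : ∀ z : ℂ, z.im ≤ 0 → ∀ k, g ≤ (linFac I denOff k (p, z)).re := fun z hz k => by
      refine le_trans ?_ (re_linFac_I hbig k z)
      have := (abs_le.1 (abs_im_denOff_le hpb k.1)).2
      rw [add_im]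
      linarith
    have hα2 : ∀ z : ℂ, 0 ≤ z.im → g ^ (facIdx n).card ≤ ‖α (p, z)‖ := fun z hz => by
      rw [eα]
      exact pow_le_norm_prod _ _ hg0.le fun k _ => hα1 z hz k
    have hβ2 : ∀ z : ℂ, z.im ≤ 0 → g ^ (facIdx n).card ≤ ‖β (p, z)‖ := fun z hz => by
      rw [eβ]
      exact pow_le_norm_prod _ _ hg0.le fun k _ => hβ1 z hz k
    have hgc : 0 < g ^ (facIdx n).card := by positivity
    refine ⟨?_, ?_⟩ <;> beta_reduce
    · rw [eR, Finset.prod_ne_zero_iff]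
      intro i _
      rw [Finset.prod_ne_zero_iff]
      intro j _ h
      have h1 := hα1 0 (by simp) i
      have h2 := hβ1 0 (by simp) j
      have h3 := congrArg Complex.re h
      rw [add_re, zero_re] at h3
      linarith
    · have s1 : lineInt n (u * a) β (-(3 * n + 1)) p = lineInt n (u * a) β 0 p :=
        lineInt_eq (Subring.mul_mem _ mU ha) mB.1 hp (by linarith) hH' h00 hgc
          fun z hz => hβ2 z hz.2
      have s2 : lineInt n (u * b) α 0 p = lineInt n (u * b) α (3 * n + 1) p :=
        lineInt_eq (Subring.mul_mem _ mU hb) mA.1 hp (by linarith) h00 hH hgc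
          fun z hz => hα2 z hz.1
      rw [s1, ← s2, lineInt, lineInt, ← integral_add, psi, ← integral_mul_const]
      · refine integral_congr_ae (ae_of_all _ fun x => ?_)
        have hx : (x : ℂ) + (0 : ℝ) * I = x := by simp
        have hre : (wMean p.1 p.2.1).re - g < (wMean p.1 p.2.1).re := by linarith
        simp only [hx, Pi.mul_apply]
        rw [psiIntegrand_eq, gammaQuot_eq n hbig (z := x)
          (fun j => by
            rw [add_im, ofReal_im, zero_add]; exact (abs_im_numOff_le hpb j).trans_lt hre)
          (fun j => by
            rw [add_im, ofReal_im, zero_add]; exact (abs_im_denOff_le hpb j).trans_lt hre),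
          ← eα, ← eβ, ← hRz p x]
        have hα0 : α (p, x) ≠ 0 := norm_pos_iff.1 (hgc.trans_le (hα2 x (by simp)))
        have hβ0 : β (p, x) ≠ 0 := norm_pos_iff.1 (hgc.trans_le (hβ2 x (by simp)))
        have hu' : (∏ k ∈ facIdx n, linFac I numOff k (p, x)) *
            ∏ k ∈ facIdx n, linFac (-I) denOff k (p, x) = u (p, x) := by
          rw [hu, Pi.mul_apply, Finset.prod_apply, Finset.prod_apply]
        rw [hu', hR]
        simp only [Pi.add_apply, Pi.mul_apply]
        field_simp
      · exact integrable_line (Subring.mul_mem _ mU ha) mB.1 hp h00 hgc fun z hz => hβ2 z hz.le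
      · exact integrable_line (Subring.mul_mem _ mU hb) mA.1 hp h00 hgc fun z hz => hα2 z hz.ge

theorem differentiableOn_prod {V ι : Type*} [NormedAddCommGroup V] [NormedSpace ℂ V] (s : Finset ι)
    {f : ι → V → ℂ} {D : Set V} (h : ∀ i ∈ s, DifferentiableOn ℂ (f i) D) :
    DifferentiableOn ℂ (fun p => ∏ i ∈ s, f i p) D := by
  classical
  induction s using Finset.induction_on with
  | empty => simp
  | insert i s hi ih =>
    simp only [Finset.prod_insert hi]
    exact (h i (Finset.mem_insert_self _ _)).mul
      (ih fun j hj => h j (Finset.mem_insert_of_mem hj))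

/-- Two arguments in `(-π/2, π/2)` add up to one in `(-π, π)`. Hence the principal square root of
`w₁ w₂` is holomorphic on the whole parameter domain. -/
theorem mul_mem_slitPlane {w₁ w₂ : ℂ} (h₁ : 0 < w₁.re) (h₂ : 0 < w₂.re) : w₁ * w₂ ∈ slitPlane := by
  rw [mem_slitPlane_iff]
  by_contra! h
  obtain ⟨h3, h4⟩ := h
  rw [mul_re] at h3
  rw [mul_im] at h4
  have h5 : w₁.re * (w₁.re * w₂.re - w₁.im * w₂.im) ≤ 0 := mul_nonpos_of_nonneg_of_nonpos h₁.le h3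
  have h6 : w₁.re * w₂.im = -(w₁.im * w₂.re) := by linarith
  have h7 : 0 < w₁.re ^ 2 * w₂.re + w₁.im ^ 2 * w₂.re := by positivity
  have h8 : w₁.re * (w₁.re * w₂.re - w₁.im * w₂.im) = w₁.re ^ 2 * w₂.re - w₁.im * (w₁.re * w₂.im) := by
    ring
  rw [h8, h6] at h5
  linarith

theorem differentiable_polePoly (K : ℕ) {t : Params → ℂ} (ht : Differentiable ℂ t) :
    Differentiable ℂ fun p : Params => polePoly K p.1 p.2.1 (t p) := by
  rw [← differentiableOn_univ]
  refine differentiableOn_prod _ fun i _ => Differentiable.differentiableOn ?_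
  unfold poleA
  fun_prop

/-- The explicit formula is a quotient of holomorphic functions on each of the bounded domains. -/
theorem exists_sFormula_continuation (n : ℕ) : ∃ f g : Params → ℂ, DifferentiableOn ℂ f (bddDomain n) ∧
    DifferentiableOn ℂ g (bddDomain n) ∧ ∀ p ∈ baseDomain ∩ bddDomain n, g p ≠ 0 ∧
      sFormula p.1 p.2.1 (pγ p) (pX p) (pL p) * g p = f p := by
  obtain ⟨F, R, hF, hR, h⟩ := exists_psi_continuation n
  set K := truncLevel n with hK
  refine ⟨fun p => (∏ i, (Complex.exp (I * gTrunc K p.1 p.2.1 (preArg p i)) *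
      polePoly K p.1 p.2.1 (-preArg p i))) * ((p.1 * p.2.1) ^ (1 / 2 : ℂ))⁻¹ * F p,
    fun p => (∏ i, polePoly K p.1 p.2.1 (preArg p i)) * R p, ?_, ?_, ?_⟩
  · refine ((differentiableOn_prod _ fun i _ => ?_).mul ?_).mul hF
    · intro p hp
      refine DifferentiableAt.differentiableWithinAt ?_
      refine DifferentiableAt.mul (DifferentiableAt.cexp (DifferentiableAt.const_mul ?_ I)) ?_
      · refine differentiableAt_gTrunc_comp (one_le_of_mem_bddDomain hp) (by fun_prop) (by fun_prop)
          (differentiable_preArg i p) hp.2.1 hp.2.2 ?_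
        have := (abs_im_le_norm _).trans (norm_preArg_le p i)
        have h2 := hp.1
        have h3 := norm_nonneg p
        linarith
      · exact differentiable_polePoly K (differentiable_preArg i).neg p
    · intro p hp
      refine DifferentiableAt.differentiableWithinAt ?_
      have hb := bddDomain_subset n hp
      have hs := mul_mem_slitPlane hb.1 hb.2
      refine DifferentiableAt.inv (DifferentiableAt.cpow (by fun_prop) (by fun_prop) hs) ?_
      rw [Ne, cpow_eq_zero_iff]
      exact fun h => slitPlane_ne_zero hs h.1
  · exact ((differentiableOn_prod _ fun i _ =>
      (differentiable_polePoly K (differentiable_preArg i)).differentiableOn).mul hR.differentiableOn)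
  · intro p hp
    obtain ⟨hR0, hψ⟩ := h p hp
    have hb := bddDomain_subset n hp.2
    have hne : ∀ i, polePoly K p.1 p.2.1 (preArg p i) ≠ 0 := fun i =>
      polePoly_ne_zero hb.1 hb.2 K (abs_im_preArg_lt hp.1 i)
    refine ⟨mul_ne_zero (Finset.prod_ne_zero_iff.2 fun i _ => hne i) hR0, ?_⟩
    beta_reduce
    rw [sFormula_eq, ← hψ, Finset.prod_congr rfl fun i _ =>
      hypGamma_eq_trunc K hb.1 hb.2 (abs_im_preArg_lt hp.1 i)]
    have e : ∏ i, (Complex.exp (I * gTrunc K p.1 p.2.1 (preArg p i)) *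
        polePoly K p.1 p.2.1 (-preArg p i)) =
        (∏ i, Complex.exp (I * gTrunc K p.1 p.2.1 (preArg p i)) *
          (polePoly K p.1 p.2.1 (-preArg p i) / polePoly K p.1 p.2.1 (preArg p i))) *
        ∏ i, polePoly K p.1 p.2.1 (preArg p i) := by
      rw [← Finset.prod_mul_distrib]
      refine Finset.prod_congr rfl fun i _ => ?_
      rw [mul_assoc, div_mul_cancel₀ _ (hne i)]
    rw [e]
    ring

/-! ### The hyperbolic identity behind the telescoping. -/

theorem tel_quadratic (X Z σ cr : ℂ) :
    cosh X ^ 2 - 2 * cosh X * cosh σ * cr + cosh σ ^ 2 + cr ^ 2 - 1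
      - (cosh Z - cosh σ) * (cosh X * cr - cosh σ + sinh X * sinh (Z + X))
      = (cr - cosh (Z + X)) * (cr + cosh (Z + X) - cosh X * cosh σ - cosh X * cosh Z) := by
  rw [cosh_add, sinh_add]
  have h1 := cosh_sq X
  have h2 := cosh_sq Z
  generalize cosh σ = d at *
  generalize cosh X = a at *
  generalize sinh X = b at *
  generalize cosh Z = e at *
  generalize sinh Z = f at *
  linear_combination (1 - d * e) * h1 - b ^ 2 * h2

/-- This is what is left of the telescoping identity once the two quadratic coefficients have been
rewritten and the common factors removed. In terms of the exponentials of the six variables it is an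
identity of Laurent polynomials, with `cr` and `ct` free. -/
theorem tel_balance (P N Z m σ υ cr ct : ℂ) :
    (cosh (P - N) * ct - cosh υ) * (cosh Z - cosh σ) * sinh (P + N)
      + (cosh (P + N) * cr - cosh σ) * (cosh (Z + m) - cosh υ) * sinh (P - N)
      + (-(cosh (Z + P + N + m) - ct) * (cr + cosh (Z + P + N) - cosh (P + N) * cosh σ
            - cosh (P + N) * cosh Z)
          + (cosh Z - cosh σ) * sinh (P + N) * sinh (Z + P + N + m)) * sinh (P - N)
      + (-(cosh (Z + P - N) - cr) * (ct + cosh (Z + P - N + m) - cosh (P - N) * cosh υ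
            - cosh (P - N) * cosh (Z + m))
          + (cosh (Z + m) - cosh υ) * sinh (P - N) * sinh (Z + P - N)) * sinh (P + N)
    = (cosh (P + N + σ) - cr) * (cosh (P + N - υ) - ct) * sinh (P - N)
      + (cosh (P - N - σ) - cr) * (cosh (P - N + υ) - ct) * sinh (P + N)
      + 2 * sinh P * sinh (P + N) * sinh (P - N) * (cosh (m + N) - cosh (N + σ - υ)) := by
  simp only [Complex.cosh, Complex.sinh, sub_eq_add_neg, neg_add, neg_neg, exp_add, exp_neg]
  have hP := exp_ne_zero P
  have hN := exp_ne_zero N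
  have hZ := exp_ne_zero Z
  have hm := exp_ne_zero m
  have hσ := exp_ne_zero σ
  have hυ := exp_ne_zero υ
  generalize exp P = P at *
  generalize exp N = N at *
  generalize exp Z = Z at *
  generalize exp m = m at *
  generalize exp σ = σ at *
  generalize exp υ = υ at *
  field_simp
  ring

/-- The rational certificate of the telescoping identity. -/
def telQ (P N m σ υ cr ct V U : ℂ) : ℂ :=
  ((cosh (P + N) * cr - cosh σ) / (2 * sinh P * sinh (P + N)) * (cosh V - ct)
    - (cosh (P - N) * ct - cosh υ) / (2 * sinh P * sinh (P - N)) * (cosh U - cr)) / 2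
    + (sinh V * cr - sinh U * ct - sinh m) / (4 * sinh P)

/-- Up to the factor `π / w₂` the variables stand for `P = 2x`, `N = 2iw`, `Z = 2z - λ + iw`, `m =
2λ - 2iw`, with `2iσ`, `2iυ` for `σ`, `υ`, while `cr`, `ct` are the `cosh` of `2iρ`, `2iτ`. Dividing
the integrands of `ψ` at `x ± i w₁` and `x` by a common gamma product leaves the left side; the
right side is the difference of the certificate times shifted integrands. -/
theorem tel_identity {P N : ℂ} (Z m σ υ cr ct : ℂ) (hP : sinh P ≠ 0) (hX : sinh (P + N) ≠ 0)
    (hY : sinh (P - N) ≠ 0) :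
    (cosh (P + N) ^ 2 - 2 * cosh (P + N) * cosh σ * cr + cosh σ ^ 2 + cr ^ 2 - 1)
        / (4 * sinh P * sinh (P + N)) * (cosh (Z + P + N + m) - ct) * (cosh (Z + P - N + m) - ct)
      + (cosh (P - N) ^ 2 - 2 * cosh (P - N) * cosh υ * ct + cosh υ ^ 2 + ct ^ 2 - 1)
        / (4 * sinh P * sinh (P - N)) * (cosh (Z + P - N) - cr) * (cosh (Z + P + N) - cr)
      - ((cosh (P + N + σ) - cr) * (cosh (P + N - υ) - ct) / (4 * sinh P * sinh (P + N))
        + (cosh (P - N - σ) - cr) * (cosh (P - N + υ) - ct) / (4 * sinh P * sinh (P - N))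
        + (cosh (m + N) - cosh (N + σ - υ)) / 2)
        * (cosh (Z + P + N) - cr) * (cosh (Z + P - N + m) - ct)
    = telQ P N m σ υ cr ct (Z + P + N + m) (Z + P + N) * (cosh Z - cosh σ)
        * (cosh (Z + P - N + m) - ct)
      - telQ P N m σ υ cr ct (Z + P - N + m) (Z + P - N) * (cosh (Z + m) - cosh υ)
        * (cosh (Z + P + N) - cr) := by
  -- Modulo `cosh Z - cosh σ`, a factor of the right side, the quadratic coefficient is divisible by
  -- `cosh (Z + P + N) - cr`. The same holds for the second coefficient with `cosh (Z + m) - cosh υ`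
  -- and `cosh (Z + P - N + m) - ct`.
  have hK := tel_quadratic (P + N) Z σ cr
  have hK' := tel_quadratic (P - N) (Z + m) υ ct
  have hB := tel_balance P N Z m σ υ cr ct
  -- The two arguments of the certificate differ by `m`; the subtraction formula for `sinh m` turns
  -- its last term into a combination of `cosh V - ct` and `cosh U - cr`.
  have hT : sinh (Z + P + N + m) * cr - sinh (Z + P + N) * ct - sinh m
      = sinh (Z + P + N) * (cosh (Z + P + N + m) - ct)
        + sinh (Z + P + N + m) * (cr - cosh (Z + P + N)) := by
    have h := sinh_sub (Z + P + N + m) (Z + P + N)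
    rw [add_sub_cancel_left] at h
    rw [h]
    ring
  have hT' : sinh (Z + P - N + m) * cr - sinh (Z + P - N) * ct - sinh m
      = -sinh (Z + P - N + m) * (cosh (Z + P - N) - cr)
        + sinh (Z + P - N) * (cosh (Z + P - N + m) - ct) := by
    have h := sinh_sub (Z + P - N + m) (Z + P - N)
    rw [add_sub_cancel_left] at h
    rw [h]
    ring
  rw [telQ, telQ, hT, hT']
  have e1 : Z + (P + N) = Z + P + N := by ring
  have e2 : Z + m + (P - N) = Z + P - N + m := by ring
  rw [e1] at hK
  rw [e2] at hK'
  generalize cosh (Z + P + N + m) = cV1 at *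
  generalize sinh (Z + P + N + m) = sV1 at *
  generalize cosh (Z + P + N) = cU1 at *
  generalize sinh (Z + P + N) = sU1 at *
  generalize cosh (Z + P - N + m) = cU2 at *
  generalize sinh (Z + P - N + m) = sU2 at *
  generalize cosh (Z + P - N) = cV2 at *
  generalize sinh (Z + P - N) = sV2 at *
  generalize cosh (Z + m) = cZm at *
  generalize cosh Z = cZ at *
  generalize cosh (P + N + σ) = k1 at *
  generalize cosh (P + N - υ) = k2 at *
  generalize cosh (P - N - σ) = k3 at *
  generalize cosh (P - N + υ) = k4 at *
  generalize cosh (m + N) = k5 at *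
  generalize cosh (N + σ - υ) = k6 at *
  generalize cosh (P + N) = cX at *
  generalize sinh (P + N) = sX at *
  generalize cosh (P - N) = cY at *
  generalize sinh (P - N) = sY at *
  generalize cosh σ = cσ at *
  generalize cosh υ = cυ at *
  generalize sinh P = sP at *
  generalize sinh m = sm at *
  field_simp
  linear_combination 4 * ((cU2 - ct) * sY * (cV1 - ct) * hK + (cU1 - cr) * sX * (cV2 - cr) * hK'
    + (cU1 - cr) * (cU2 - ct) * hB)


/-! ### The difference equation for pairs of hyperbolic gamma functions -/

/-- `cosh (π v / w)`. -/
def cw (w v : ℂ) : ℂ := Complex.cosh (Real.pi * v / w)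

/-- `sinh (π v / w)`. -/
def sw (w v : ℂ) : ℂ := Complex.sinh (Real.pi * v / w)

theorem cw_neg (w v : ℂ) : cw w (-v) = cw w v := by
  rw [cw, cw, ← Complex.cosh_neg]
  ring_nf

theorem sw_neg (w v : ℂ) : sw w (-v) = -sw w v := by
  rw [sw, sw, ← Complex.sinh_neg]
  ring_nf

theorem cw_add_period {w : ℂ} (hw : w ≠ 0) (v : ℂ) : cw w (v + 2 * I * w) = cw w v := by
  have e : Real.pi * (v + 2 * I * w) / w = Real.pi * v / w + 2 * Real.pi * I := by field_simp
  rw [cw, cw, e, Complex.cosh_periodic]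

theorem sw_mul_sw (w a b : ℂ) : sw w a * sw w b = (cw w (a + b) - cw w (a - b)) / 2 := by
  have e1 : Real.pi * (a + b) / w = Real.pi * a / w + Real.pi * b / w := by ring
  have e2 : Real.pi * (a - b) / w = Real.pi * a / w - Real.pi * b / w := by ring
  rw [cw, cw, sw, sw, e1, e2, Complex.cosh_add, Complex.cosh_sub]
  ring

def InStrip (w₁ w₂ A b : ℂ) : Prop :=
  |(A + b).im| < (wMean w₁ w₂).re ∧ |(A - b).im| < (wMean w₁ w₂).re

/-- The constant in the difference equation of a pair of hyperbolic gamma functions. -/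
def pairConst (w₂ : ℂ) : ℂ := (-I * exp (-jFun w₂ 0)) ^ 2 / 2

theorem hypGammaPM_ne_zero (w₁ w₂ A b : ℂ) : hypGammaPM w₁ w₂ A b ≠ 0 :=
  mul_ne_zero (hypGamma_ne_zero _ _ _) (hypGamma_ne_zero _ _ _)

/-- The two `sinh` factors of a pair `G(A ± b)` combine into a difference of two `cosh`, in which
`A` and `b` are separated. -/
theorem hypGammaPM_add {w₁ w₂ A b : ℂ} (h₁ : 0 < w₁.re) (h₂ : 0 < w₂.re) (h : InStrip w₁ w₂ A b)
    (h' : InStrip w₁ w₂ (A + I * w₁) b) : hypGammaPM w₁ w₂ (A + I * w₁) b =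
      pairConst w₂ * (cw w₂ (2 * A + 2 * I * wMean w₁ w₂) - cw w₂ (2 * b)) * hypGammaPM w₁ w₂ A b := by
  have e1 : A + I * w₁ + b = A + b + I * w₁ := by ring
  have e2 : A + I * w₁ - b = A - b + I * w₁ := by ring
  have k1 := h'.1
  have k2 := h'.2
  rw [e1] at k1
  rw [e2] at k2
  rw [hypGammaPM, e1, e2, hypGamma_add h₁ h₂ h.1 k1, hypGamma_add h₁ h₂ h.2 k2, hypGammaPM, pairConst]
  have := sw_mul_sw w₂ (A + b + I * wMean w₁ w₂) (A - b + I * wMean w₁ w₂)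
  have e3 : A + b + I * wMean w₁ w₂ + (A - b + I * wMean w₁ w₂) = 2 * A + 2 * I * wMean w₁ w₂ := by ring
  have e4 : A + b + I * wMean w₁ w₂ - (A - b + I * wMean w₁ w₂) = 2 * b := by ring
  rw [e3, e4, sw, sw] at this
  linear_combination ((-I * exp (-jFun w₂ 0)) ^ 2 * hypGamma w₁ w₂ (A + b) * hypGamma w₁ w₂ (A - b)) * this

theorem hypGammaPM_eq_sub {w₁ w₂ A b : ℂ} (h₁ : 0 < w₁.re) (h₂ : 0 < w₂.re) (h : InStrip w₁ w₂ A b)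
    (h' : InStrip w₁ w₂ (A - I * w₁) b) : hypGammaPM w₁ w₂ A b =
      pairConst w₂ * (cw w₂ (2 * A - 2 * I * wMean w₁ w₂) - cw w₂ (2 * b)) *
        hypGammaPM w₁ w₂ (A - I * w₁) b := by
  have e : A - I * w₁ + I * w₁ = A := by ring
  have := hypGammaPM_add h₁ h₂ h' (by rwa [e])
  rw [e] at this
  -- The arguments `2 (A - i w₁) + 2iw` and `2A - 2iw` differ by the period `2 i w₂`.
  rw [this, ← cw_add_period (ne_zero_of_re_pos h₂) (2 * A - 2 * I * wMean w₁ w₂)]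
  congr 4
  rw [wMean]
  ring

theorem norm_cosh_le_exp (v : ℂ) : ‖Complex.cosh v‖ ≤ Real.exp |v.re| := by
  rw [Complex.cosh, norm_div, Complex.norm_ofNat]
  have h := norm_add_le (Complex.exp v) (Complex.exp (-v))
  rw [Complex.norm_exp, Complex.norm_exp, neg_re] at h
  have h1 := Real.exp_le_exp.2 (le_abs_self v.re)
  have h2 := Real.exp_le_exp.2 (neg_le_abs v.re)
  linarith

theorem norm_sinh_le_exp (v : ℂ) : ‖Complex.sinh v‖ ≤ Real.exp |v.re| := by
  rw [Complex.sinh, norm_div, Complex.norm_ofNat]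
  have h := norm_sub_le (Complex.exp v) (Complex.exp (-v))
  rw [Complex.norm_exp, Complex.norm_exp, neg_re] at h
  have h1 := Real.exp_le_exp.2 (le_abs_self v.re)
  have h2 := Real.exp_le_exp.2 (neg_le_abs v.re)
  linarith

/-! ### The base domain and its shifts in `x` -/

/-- Translation of the variable `x`. -/
def shX (c : ℂ) (p : Params) : Params := (p.1, p.2.1, p.2.2.1, p.2.2.2.1 + c, p.2.2.2.2)

/-- The parameters at which the telescoping argument is carried out. -/
structure TelGood (p : Params) : Prop where
  base : p ∈ baseDomain
  base_add : shX (I * p.1) p ∈ baseDomain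
  base_sub : shX (-(I * p.1)) p ∈ baseDomain
  num : InStrip p.1 p.2.1 (-pL p / 2 - I * wMean p.1 p.2.1 / 2 + I * p.1) (I * parSigma (pγ p))
  den : InStrip p.1 p.2.1 (pL p / 2 + I * wMean p.1 p.2.1 / 2 - I * p.1) (I * parUpsilon (pγ p))
  ne : sw p.2.1 (2 * pX p) ≠ 0
  ne_add : sw p.2.1 (2 * pX p + 2 * I * wMean p.1 p.2.1) ≠ 0
  ne_sub : sw p.2.1 (2 * pX p - 2 * I * wMean p.1 p.2.1) ≠ 0

theorem abs_im_numOff_lt {p : Params} (hp : p ∈ baseDomain) (j : Fin 4) :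
    |(numOff p j).im| < (wMean p.1 p.2.1).re := by
  linarith [abs_im_numOff_le hp j, gap_pos hp]

theorem abs_im_denOff_lt {p : Params} (hp : p ∈ baseDomain) (j : Fin 4) :
    |(denOff p j).im| < (wMean p.1 p.2.1).re := by
  linarith [abs_im_denOff_le hp j, gap_pos hp]

theorem inStrip_of_base {p : Params} (hp : p ∈ baseDomain) (z : ℝ) :
    InStrip p.1 p.2.1 (z + pX p + pL p / 2 - I * wMean p.1 p.2.1 / 2) (I * parTau (pγ p)) ∧
    InStrip p.1 p.2.1 (z - pL p / 2 - I * wMean p.1 p.2.1 / 2) (I * parSigma (pγ p)) ∧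
    InStrip p.1 p.2.1 (z + pX p - pL p / 2 + I * wMean p.1 p.2.1 / 2) (I * parRho (pγ p)) ∧
    InStrip p.1 p.2.1 (z + pL p / 2 + I * wMean p.1 p.2.1 / 2) (I * parUpsilon (pγ p)) := by
  have key : ∀ a b : ℂ, |b.im| < (wMean p.1 p.2.1).re → a = z + b → |a.im| < (wMean p.1 p.2.1).re := by
    rintro a b hb rfl
    rwa [add_im, ofReal_im, zero_add]
  refine ⟨⟨key _ _ (abs_im_numOff_lt hp 0) ?_, key _ _ (abs_im_numOff_lt hp 1) ?_⟩,
    ⟨key _ _ (abs_im_numOff_lt hp 2) ?_, key _ _ (abs_im_numOff_lt hp 3) ?_⟩,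
    ⟨key _ _ (abs_im_denOff_lt hp 0) ?_, key _ _ (abs_im_denOff_lt hp 1) ?_⟩,
    ⟨key _ _ (abs_im_denOff_lt hp 2) ?_, key _ _ (abs_im_denOff_lt hp 3) ?_⟩⟩ <;>
  simp only [numOff, denOff, Matrix.cons_val] <;> ring

theorem exists_norm_gammaQuot_le_exp_neg {w₁ w₂ : ℂ} {a b : Fin 4 → ℂ} (h₁ : 0 < w₁.re)
    (h₂ : 0 < w₂.re) {α β : ℝ} (hα : ∀ j, |α + (a j).im| < (wMean w₁ w₂).re)
    (hβ : ∀ j, |β + (a j).im| < (wMean w₁ w₂).re) (hα' : ∀ j, |α + (b j).im| < (wMean w₁ w₂).re)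
    (hβ' : ∀ j, |β + (b j).im| < (wMean w₁ w₂).re)
    (hs : ∑ j, (a j - b j) = -4 * I * wMean w₁ w₂) : ∃ C, ∀ z : ℂ, z.im ∈ Icc α β →
      ‖gammaQuot w₁ w₂ a b z‖ ≤
        Real.exp (C - 2 * Real.pi * ((w₁⁻¹).re + (w₂⁻¹).re) * |z.re|) := by
  obtain ⟨C, hC⟩ := exists_norm_gammaQuot_le h₁ h₂ hα hβ hα' hβ'
  refine ⟨C, fun z hz => (hC z hz).trans (le_of_eq ?_)⟩
  have e : -4 * I * wMean w₁ w₂ / (w₁ * w₂) = -2 * (I * (w₁⁻¹ + w₂⁻¹)) := by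
    have k1 : w₁ ≠ 0 := ne_zero_of_re_pos h₁
    have k2 : w₂ ≠ 0 := ne_zero_of_re_pos h₂
    rw [wMean]
    field_simp
    ring
  have e2 : (-2 * (I * (w₁⁻¹ + w₂⁻¹))).im = -2 * ((w₁⁻¹).re + (w₂⁻¹).re) := by
    simp [mul_im]
  rw [hs, e, e2]
  ring_nf

theorem re_inv_pos {w : ℂ} (h : 0 < w.re) : 0 < (w⁻¹).re := by
  rw [inv_re]
  exact div_pos h (normSq_pos.2 (ne_zero_of_re_pos h))

theorem integrable_psiIntegrand {p : Params} (hp : p ∈ baseDomain) :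
    Integrable fun z : ℝ => psiIntegrand p.1 p.2.1 (pγ p) (pX p) (pL p) z := by
  simp only [psiIntegrand_eq]
  obtain ⟨h₁, h₂, -⟩ := id hp
  have hn : ∀ j, |0 + (numOff p j).im| < (wMean p.1 p.2.1).re := fun j => by
    rw [zero_add]; exact abs_im_numOff_lt hp j
  have hd : ∀ j, |0 + (denOff p j).im| < (wMean p.1 p.2.1).re := fun j => by
    rw [zero_add]; exact abs_im_denOff_lt hp j
  obtain ⟨C, hC⟩ := exists_norm_gammaQuot_le_exp_neg h₁ h₂ hn hn hd hd (sum_numOff_sub_denOff p)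
  obtain ⟨C', -, hC'⟩ := exists_pow_mul_exp_le (A := 1)
    (c := 2 * Real.pi * ((p.1⁻¹).re + (p.2.1⁻¹).re)) le_rfl
    (by have := re_inv_pos h₁; have := re_inv_pos h₂; positivity) 0
  refine integrable_of_bound_inv_one_add_sq (C := Real.exp C * C') ?_ fun x => ?_
  · refine Continuous.aestronglyMeasurable (continuous_iff_continuousAt.2 fun x => ?_)
    have := (differentiableAt_gammaQuot (z := (x : ℂ)) h₁ h₂ (a := numOff p) (b := denOff p)
      (fun j => by rw [add_im, ofReal_im]; exact hn j)
      (fun j => by rw [add_im, ofReal_im]; exact hd j)).continuousAt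
    exact ContinuousAt.comp (f := fun x : ℝ => (x : ℂ)) this (by fun_prop)
  · refine (hC x (by simp)).trans ?_
    have := hC' |x| (abs_nonneg _)
    rw [pow_zero, one_mul, sq_abs] at this
    rw [ofReal_re, sub_eq_add_neg, Real.exp_add, mul_div_assoc]
    gcongr

/-! ### The telescoping identity for the integrand -/

/-- The certificate as a function of the arguments `V`, `U` before scaling by `π / w₂`. -/
def telCert (p : Params) (V U : ℂ) : ℂ :=
  telQ (Real.pi * (2 * pX p) / p.2.1) (Real.pi * (2 * I * wMean p.1 p.2.1) / p.2.1)
    (Real.pi * (2 * pL p - 2 * I * wMean p.1 p.2.1) / p.2.1)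
    (Real.pi * (2 * (I * parSigma (pγ p))) / p.2.1) (Real.pi * (2 * (I * parUpsilon (pγ p))) / p.2.1)
    (cw p.2.1 (2 * (I * parRho (pγ p)))) (cw p.2.1 (2 * (I * parTau (pγ p))))
    (Real.pi * V / p.2.1) (Real.pi * U / p.2.1)

/-- The function whose difference with step `i w₁` is the defect of the difference equation for the
integrand. -/
def telFun (p : Params) (z : ℂ) : ℂ :=
  telCert p (2 * (z + pX p) + pL p - 3 * I * wMean p.1 p.2.1)
      (2 * (z + pX p) - pL p - I * wMean p.1 p.2.1) *
    ((hypGammaPM p.1 p.2.1 (z + pX p + pL p / 2 - I * wMean p.1 p.2.1 / 2 - I * p.1) (I * parTau (pγ p))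
      * hypGammaPM p.1 p.2.1 (z - pL p / 2 - I * wMean p.1 p.2.1 / 2) (I * parSigma (pγ p)))
    / (hypGammaPM p.1 p.2.1 (z + pX p - pL p / 2 + I * wMean p.1 p.2.1 / 2) (I * parRho (pγ p))
      * hypGammaPM p.1 p.2.1 (z + pL p / 2 + I * wMean p.1 p.2.1 / 2 - I * p.1)
        (I * parUpsilon (pγ p))))

theorem telCert_add_period {p : Params} (hp : p.2.1 ≠ 0) (V U : ℂ) :
    telCert p (V + 2 * I * p.2.1) (U + 2 * I * p.2.1) = telCert p V U := by
  have e : ∀ v : ℂ, Real.pi * (v + 2 * I * p.2.1) / p.2.1 = Real.pi * v / p.2.1 + 2 * Real.pi * I :=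
    fun v => by field_simp
  simp only [telCert, telQ, e, Complex.cosh_periodic _, Complex.sinh_periodic _]

/-- The numerator factors as `(cw (Y + σ) - cw r) (cw (Y - σ) - cw r)` by `cw_sub_mul_cw_sub`; these
are the coefficients of the operator after conjugation by `Δ`. -/
def coefB (p : Params) (Y σ r : ℂ) : ℂ :=
  (cw p.2.1 Y ^ 2 - 2 * cw p.2.1 Y * cw p.2.1 σ * cw p.2.1 r + cw p.2.1 σ ^ 2 + cw p.2.1 r ^ 2 - 1)
    / (4 * sw p.2.1 (2 * pX p) * sw p.2.1 Y)

/-- Up to the factor `4 * coefE` these are the coefficients `A` of the Askey-Wilson operator. -/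
def coefC (p : Params) (Y σ r υ t : ℂ) : ℂ :=
  (cw p.2.1 (Y + σ) - cw p.2.1 r) * (cw p.2.1 (Y - υ) - cw p.2.1 t)
    / (4 * sw p.2.1 (2 * pX p) * sw p.2.1 Y)

/-- Every quotient shifts as many pairs in the numerator as in the denominator, or moves one pair in
opposite directions against another, so the constant `k` of the gamma difference equation cancels
and only the trigonometric factors remain. -/
theorem tel_of_factors {T S R U Tp Tm Rp Rm Sp Um k t₁ d₁ d₂ r₂ p₁ p₂ : ℂ} {bx bm cc Qp Qm : ℂ}
    (hT : T ≠ 0) (hR : R ≠ 0) (hU : U ≠ 0) (hRp : Rp ≠ 0) (eTp : Tp = k * t₁ * T)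
    (eRp : Rp = k * d₁ * R) (eT : T = k * d₂ * Tm) (eR : R = k * r₂ * Rm) (eSp : Sp = k * p₁ * S)
    (eU : U = k * p₂ * Um)
    (h : bx * t₁ * d₂ + bm * r₂ * d₁ - cc * d₁ * d₂ = Qp * p₁ * d₂ - Qm * p₂ * d₁) :
    bx * (Tp * S / (Rp * U)) + bm * (Tm * S / (Rm * U)) - cc * (T * S / (R * U))
      = Qp * (T * Sp / (Rp * U)) - Qm * (Tm * S / (R * Um)) := by
  subst eTp eRp eT eR eSp eU
  simp only [ne_eq, mul_eq_zero, not_or] at hT hR hU hRp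
  obtain ⟨⟨hk, hd2⟩, hTm⟩ := hT
  obtain ⟨⟨-, hr2⟩, hRm⟩ := hR
  obtain ⟨⟨-, hp2⟩, hUm⟩ := hU
  obtain ⟨⟨-, hd1⟩, -⟩ := hRp
  field_simp
  linear_combination S * h

theorem telFun_add_sub {p : Params} (hp : TelGood p) (z : ℝ) :
    coefB p (2 * pX p + 2 * I * wMean p.1 p.2.1) (2 * (I * parSigma (pγ p))) (2 * (I * parRho (pγ p)))
        * psiIntegrand p.1 p.2.1 (pγ p) (pX p + I * p.1) (pL p) z
      + coefB p (2 * pX p - 2 * I * wMean p.1 p.2.1) (2 * (I * parUpsilon (pγ p)))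
          (2 * (I * parTau (pγ p)))
        * psiIntegrand p.1 p.2.1 (pγ p) (pX p - I * p.1) (pL p) z
      - (coefC p (2 * pX p + 2 * I * wMean p.1 p.2.1) (2 * (I * parSigma (pγ p)))
            (2 * (I * parRho (pγ p))) (2 * (I * parUpsilon (pγ p))) (2 * (I * parTau (pγ p)))
          + coefC p (2 * pX p - 2 * I * wMean p.1 p.2.1) (-(2 * (I * parSigma (pγ p))))
            (2 * (I * parRho (pγ p))) (-(2 * (I * parUpsilon (pγ p)))) (2 * (I * parTau (pγ p)))
          + (cw p.2.1 (2 * pL p) - cw p.2.1 (2 * I * wMean p.1 p.2.1 + 2 * (I * parSigma (pγ p))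
              - 2 * (I * parUpsilon (pγ p)))) / 2)
        * psiIntegrand p.1 p.2.1 (pγ p) (pX p) (pL p) z
      = telFun p (z + I * p.1) - telFun p z := by
  obtain ⟨hb, hba, hbs, hnum, hden, hne, hnea, hnes⟩ := hp
  obtain ⟨h₁, h₂, -⟩ := id hb
  have hw2 : p.2.1 ≠ 0 := ne_zero_of_re_pos h₂
  obtain ⟨a1, a2, b1, b2⟩ := inStrip_of_base hb z
  obtain ⟨a1p, -, b1p, -⟩ := inStrip_of_base hba z
  obtain ⟨a1m, -, b1m, -⟩ := inStrip_of_base hbs z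
  have hA2 : InStrip p.1 p.2.1 (z - pL p / 2 - I * wMean p.1 p.2.1 / 2 + I * p.1)
      (I * parSigma (pγ p)) := by
    have e : ∀ b : ℂ, (z - pL p / 2 - I * wMean p.1 p.2.1 / 2 + I * p.1 + b).im =
        (-pL p / 2 - I * wMean p.1 p.2.1 / 2 + I * p.1 + b).im := fun b => by
      simp [neg_div]
    exact ⟨by rw [e]; exact hnum.1, by rw [sub_eq_add_neg, e, ← sub_eq_add_neg]; exact hnum.2⟩
  have hB2 : InStrip p.1 p.2.1 (z + pL p / 2 + I * wMean p.1 p.2.1 / 2 - I * p.1)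
      (I * parUpsilon (pγ p)) := by
    have e : ∀ b : ℂ, (z + pL p / 2 + I * wMean p.1 p.2.1 / 2 - I * p.1 + b).im =
        (pL p / 2 + I * wMean p.1 p.2.1 / 2 - I * p.1 + b).im := fun b => by
      simp
    exact ⟨by rw [e]; exact hden.1, by rw [sub_eq_add_neg, e, ← sub_eq_add_neg]; exact hden.2⟩
  simp only [shX, pX, pL, pγ] at *
  set w₁ := p.1
  set w₂ := p.2.1
  set w := wMean w₁ w₂ with hw
  set x := p.2.2.2.1
  set l := p.2.2.2.2
  have hww : w = (w₁ + w₂) / 2 := hw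
  have n1 : (z : ℂ) + (x + I * w₁) + l / 2 - I * w / 2 = z + x + l / 2 - I * w / 2 + I * w₁ := by ring
  have n2 : (z : ℂ) + (x + I * w₁) - l / 2 + I * w / 2 = z + x - l / 2 + I * w / 2 + I * w₁ := by ring
  have n3 : (z : ℂ) + (x + -(I * w₁)) + l / 2 - I * w / 2 = z + x + l / 2 - I * w / 2 - I * w₁ := by ring
  have n4 : (z : ℂ) + (x + -(I * w₁)) - l / 2 + I * w / 2 = z + x - l / 2 + I * w / 2 - I * w₁ := by ring
  have n3' : (z : ℂ) + (x - I * w₁) + l / 2 - I * w / 2 = z + x + l / 2 - I * w / 2 - I * w₁ := by ring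
  have n4' : (z : ℂ) + (x - I * w₁) - l / 2 + I * w / 2 = z + x - l / 2 + I * w / 2 - I * w₁ := by ring
  rw [n1] at a1p
  rw [n2] at b1p
  rw [n3] at a1m
  rw [n4] at b1m
  have f1 := hypGammaPM_add h₁ h₂ a1 a1p
  have f2 := hypGammaPM_add h₁ h₂ b1 b1p
  have f3 := hypGammaPM_eq_sub h₁ h₂ a1 a1m
  have f4 := hypGammaPM_eq_sub h₁ h₂ b1 b1m
  have f5 := hypGammaPM_add h₁ h₂ a2 hA2
  have f6 := hypGammaPM_eq_sub h₁ h₂ b2 hB2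
  have m1 : (z : ℂ) + I * w₁ + x + l / 2 - I * w / 2 - I * w₁ = z + x + l / 2 - I * w / 2 := by ring
  have m2 : (z : ℂ) + I * w₁ - l / 2 - I * w / 2 = z - l / 2 - I * w / 2 + I * w₁ := by ring
  have m3 : (z : ℂ) + I * w₁ + x - l / 2 + I * w / 2 = z + x - l / 2 + I * w / 2 + I * w₁ := by ring
  have m4 : (z : ℂ) + I * w₁ + l / 2 + I * w / 2 - I * w₁ = z + l / 2 + I * w / 2 := by ring
  -- Moving `z` by `i w₁` adds `2 i w₁ = 4iw - 2 i w₂` to both arguments; modulo the period `2 i w₂`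
  -- this is a shift by `4iw`.
  have hc : telCert p (2 * ((z : ℂ) + I * w₁ + x) + l - 3 * I * w) (2 * ((z : ℂ) + I * w₁ + x) - l - I * w)
      = telCert p (2 * (z + x) + l + I * w) (2 * (z + x) - l + 3 * I * w) := by
    rw [← telCert_add_period hw2]
    congr 1 <;> rw [hww] <;> ring
  have key := tel_of_factors (k := pairConst w₂)
    (bx := coefB p (2 * x + 2 * I * w) (2 * (I * parSigma p.2.2.1)) (2 * (I * parRho p.2.2.1)))
    (bm := coefB p (2 * x - 2 * I * w) (2 * (I * parUpsilon p.2.2.1)) (2 * (I * parTau p.2.2.1)))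
    (cc := coefC p (2 * x + 2 * I * w) (2 * (I * parSigma p.2.2.1)) (2 * (I * parRho p.2.2.1))
        (2 * (I * parUpsilon p.2.2.1)) (2 * (I * parTau p.2.2.1))
      + coefC p (2 * x - 2 * I * w) (-(2 * (I * parSigma p.2.2.1))) (2 * (I * parRho p.2.2.1))
        (-(2 * (I * parUpsilon p.2.2.1))) (2 * (I * parTau p.2.2.1))
      + (cw w₂ (2 * l) - cw w₂ (2 * I * w + 2 * (I * parSigma p.2.2.1)
          - 2 * (I * parUpsilon p.2.2.1))) / 2)
    (Qp := telCert p (2 * (z + x) + l + I * w) (2 * (z + x) - l + 3 * I * w))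
    (Qm := telCert p (2 * (z + x) + l - 3 * I * w) (2 * (z + x) - l - I * w))
    (hypGammaPM_ne_zero _ _ _ _) (hypGammaPM_ne_zero _ _ _ _) (hypGammaPM_ne_zero _ _ _ _)
    (hypGammaPM_ne_zero _ _ _ _) f1 f2 f3 f4 f5 f6 ?_
  · simp only [psiIntegrand, telFun, pX, pL, pγ]
    rw [hc, n1, n2, n3', n4', m1, m2, m3, m4]
    exact key
  · have g1 : Real.pi * (2 * z - l + I * w) / w₂ + Real.pi * (2 * x) / w₂ + Real.pi * (2 * I * w) / w₂ + Real.pi * (2 * l - 2 * I * w) / w₂ = Real.pi * (2 * (z + x) + l + I * w) / w₂ := by ring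
    have g2 : Real.pi * (2 * z - l + I * w) / w₂ + Real.pi * (2 * x) / w₂ - Real.pi * (2 * I * w) / w₂ + Real.pi * (2 * l - 2 * I * w) / w₂ = Real.pi * (2 * (z + x) + l - 3 * I * w) / w₂ := by ring
    have g3 : Real.pi * (2 * z - l + I * w) / w₂ + Real.pi * (2 * x) / w₂ + Real.pi * (2 * I * w) / w₂ = Real.pi * (2 * (z + x) - l + 3 * I * w) / w₂ := by ring
    have g4 : Real.pi * (2 * z - l + I * w) / w₂ + Real.pi * (2 * x) / w₂ - Real.pi * (2 * I * w) / w₂ = Real.pi * (2 * (z + x) - l - I * w) / w₂ := by ring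
    have g5 : Real.pi * (2 * x) / w₂ + Real.pi * (2 * I * w) / w₂ + Real.pi * (2 * (I * parSigma p.2.2.1)) / w₂ = Real.pi * (2 * x + 2 * I * w + 2 * (I * parSigma p.2.2.1)) / w₂ := by ring
    have g6 : Real.pi * (2 * x) / w₂ + Real.pi * (2 * I * w) / w₂ - Real.pi * (2 * (I * parUpsilon p.2.2.1)) / w₂ = Real.pi * (2 * x + 2 * I * w - 2 * (I * parUpsilon p.2.2.1)) / w₂ := by ring
    have g7 : Real.pi * (2 * x) / w₂ - Real.pi * (2 * I * w) / w₂ - Real.pi * (2 * (I * parSigma p.2.2.1)) / w₂ = Real.pi * (2 * x - 2 * I * w + -(2 * (I * parSigma p.2.2.1))) / w₂ := by ring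
    have g8 : Real.pi * (2 * x) / w₂ - Real.pi * (2 * I * w) / w₂ + Real.pi * (2 * (I * parUpsilon p.2.2.1)) / w₂ = Real.pi * (2 * x - 2 * I * w - -(2 * (I * parUpsilon p.2.2.1))) / w₂ := by ring
    have g9 : Real.pi * (2 * l - 2 * I * w) / w₂ + Real.pi * (2 * I * w) / w₂ = Real.pi * (2 * l) / w₂ := by ring
    have g10 : Real.pi * (2 * I * w) / w₂ + Real.pi * (2 * (I * parSigma p.2.2.1)) / w₂ - Real.pi * (2 * (I * parUpsilon p.2.2.1)) / w₂ = Real.pi * (2 * I * w + 2 * (I * parSigma p.2.2.1) - 2 * (I * parUpsilon p.2.2.1)) / w₂ := by ring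
    have g11 : Real.pi * (2 * z - l + I * w) / w₂ + Real.pi * (2 * l - 2 * I * w) / w₂ = Real.pi * (2 * z + l - I * w) / w₂ := by ring
    have g12 : Real.pi * (2 * x) / w₂ + Real.pi * (2 * I * w) / w₂ = Real.pi * (2 * x + 2 * I * w) / w₂ := by ring
    have g13 : Real.pi * (2 * x) / w₂ - Real.pi * (2 * I * w) / w₂ = Real.pi * (2 * x - 2 * I * w) / w₂ := by ring
    have k1 : 2 * ((z : ℂ) + x + l / 2 - I * w / 2) + 2 * I * w = 2 * (z + x) + l + I * w := by ring
    have k2 : 2 * ((z : ℂ) + x - l / 2 + I * w / 2) + 2 * I * w = 2 * (z + x) - l + 3 * I * w := by ring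
    have k3 : 2 * ((z : ℂ) + x + l / 2 - I * w / 2) - 2 * I * w = 2 * (z + x) + l - 3 * I * w := by ring
    have k4 : 2 * ((z : ℂ) + x - l / 2 + I * w / 2) - 2 * I * w = 2 * (z + x) - l - I * w := by ring
    have k5 : 2 * ((z : ℂ) - l / 2 - I * w / 2) + 2 * I * w = 2 * z - l + I * w := by ring
    have k6 : 2 * ((z : ℂ) + l / 2 + I * w / 2) - 2 * I * w = 2 * z + l - I * w := by ring
    have hI := tel_identity (P := Real.pi * (2 * x) / w₂) (N := Real.pi * (2 * I * w) / w₂)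
      (Real.pi * (2 * z - l + I * w) / w₂) (Real.pi * (2 * l - 2 * I * w) / w₂)
      (Real.pi * (2 * (I * parSigma p.2.2.1)) / w₂) (Real.pi * (2 * (I * parUpsilon p.2.2.1)) / w₂)
      (cw w₂ (2 * (I * parRho p.2.2.1))) (cw w₂ (2 * (I * parTau p.2.2.1))) hne
      (by rw [g12]; exact hnea) (by rw [g13]; exact hnes)
    rw [g1, g2, g3, g4, g5, g6, g7, g8, g9, g10, g11, g12, g13] at hI
    rw [k1, k2, k3, k4, k5, k6]
    exact hI

/-! ### Integration of the telescoping identity -/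

def telNum (p : Params) : Fin 4 → ℂ :=
  ![numOff p 0 - I * p.1, numOff p 1 - I * p.1, numOff p 2, numOff p 3]

def telDen (p : Params) : Fin 4 → ℂ :=
  ![denOff p 0, denOff p 1, denOff p 2 - I * p.1, denOff p 3 - I * p.1]

theorem telFun_eq (p : Params) (z : ℂ) : telFun p z =
    telCert p (2 * (z + pX p) + pL p - 3 * I * wMean p.1 p.2.1)
      (2 * (z + pX p) - pL p - I * wMean p.1 p.2.1) *
    gammaQuot p.1 p.2.1 (telNum p) (telDen p) z := by
  simp only [telFun, gammaQuot, hypGammaPM, Fin.prod_univ_four, telNum, telDen, numOff, denOff,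
    Matrix.cons_val]
  ring_nf

theorem sum_telNum_sub_telDen (p : Params) :
    ∑ j, (telNum p j - telDen p j) = -4 * I * wMean p.1 p.2.1 := by
  rw [← sum_numOff_sub_denOff]
  simp only [Fin.sum_univ_four, telNum, telDen, Matrix.cons_val]
  ring

/-- On the edges of the strip `0 ≤ Im z ≤ Re w₁` the arguments have the imaginary parts of those of
the integrand at `x`, at `x - i w₁`, or of those in the field `num`. Imaginary parts are monotone in
between, so control of the edges is enough for holomorphy inside. -/
theorem TelGood.telNum_lt {p : Params} (hp : TelGood p) (j : Fin 4) :
    |0 + (telNum p j).im| < (wMean p.1 p.2.1).re ∧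
      |p.1.re + (telNum p j).im| < (wMean p.1 p.2.1).re := by
  have h0 := abs_im_numOff_lt hp.base
  have h1 := abs_im_numOff_lt hp.base_sub
  fin_cases j
  · refine ⟨lt_of_eq_of_lt ?_ (h1 0), lt_of_eq_of_lt ?_ (h0 0)⟩ <;>
      congr 1 <;> simp [telNum, numOff, shX, pX, pL, pγ]; ring
  · refine ⟨lt_of_eq_of_lt ?_ (h1 1), lt_of_eq_of_lt ?_ (h0 1)⟩ <;>
      congr 1 <;> simp [telNum, numOff, shX, pX, pL, pγ]; ring
  · refine ⟨lt_of_eq_of_lt ?_ (h0 2), lt_of_eq_of_lt ?_ hp.num.1⟩ <;>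
      congr 1 <;> simp [telNum, numOff]; ring
  · refine ⟨lt_of_eq_of_lt ?_ (h0 3), lt_of_eq_of_lt ?_ hp.num.2⟩ <;>
      congr 1 <;> simp [telNum, numOff]; ring

theorem TelGood.telDen_lt {p : Params} (hp : TelGood p) (j : Fin 4) :
    |0 + (telDen p j).im| < (wMean p.1 p.2.1).re ∧
      |p.1.re + (telDen p j).im| < (wMean p.1 p.2.1).re := by
  have h0 := abs_im_denOff_lt hp.base
  have h1 := abs_im_denOff_lt hp.base_add
  fin_cases j
  · refine ⟨lt_of_eq_of_lt ?_ (h0 0), lt_of_eq_of_lt ?_ (h1 0)⟩ <;>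
      congr 1 <;> simp [telDen, denOff, shX, pX, pL, pγ]; ring
  · refine ⟨lt_of_eq_of_lt ?_ (h0 1), lt_of_eq_of_lt ?_ (h1 1)⟩ <;>
      congr 1 <;> simp [telDen, denOff, shX, pX, pL, pγ]; ring
  · refine ⟨lt_of_eq_of_lt ?_ hp.den.1, lt_of_eq_of_lt ?_ (h0 2)⟩ <;>
      congr 1 <;> simp [telDen, denOff]; ring
  · refine ⟨lt_of_eq_of_lt ?_ hp.den.2, lt_of_eq_of_lt ?_ (h0 3)⟩ <;>
      congr 1 <;> simp [telDen, denOff]; ring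

theorem exists_norm_telQ_le (P N m σ υ cr ct : ℂ) : ∃ C, 0 ≤ C ∧ ∀ (V U : ℂ) (M : ℝ), 0 ≤ M →
    |V.re| ≤ M → |U.re| ≤ M → ‖telQ P N m σ υ cr ct V U‖ ≤ C * Real.exp M := by
  set f := (Complex.cosh (P + N) * cr - Complex.cosh σ) / (2 * Complex.sinh P * Complex.sinh (P + N))
  set h := (Complex.cosh (P - N) * ct - Complex.cosh υ) / (2 * Complex.sinh P * Complex.sinh (P - N))
  refine ⟨(‖f‖ * (1 + ‖ct‖) + ‖h‖ * (1 + ‖cr‖)) / 2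
    + (‖cr‖ + ‖ct‖ + ‖Complex.sinh m‖) / ‖4 * Complex.sinh P‖, by positivity, fun V U M hM hV hU => ?_⟩
  have hE : 1 ≤ Real.exp M := Real.one_le_exp hM
  have b1 := (norm_cosh_le_exp V).trans (Real.exp_le_exp.2 hV)
  have b2 := (norm_cosh_le_exp U).trans (Real.exp_le_exp.2 hU)
  have b3 := (norm_sinh_le_exp V).trans (Real.exp_le_exp.2 hV)
  have b4 := (norm_sinh_le_exp U).trans (Real.exp_le_exp.2 hU)
  set E := Real.exp M
  have c1 : ‖Complex.cosh V - ct‖ ≤ (1 + ‖ct‖) * E := by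
    have := norm_sub_le (Complex.cosh V) ct
    nlinarith [norm_nonneg ct]
  have c2 : ‖Complex.cosh U - cr‖ ≤ (1 + ‖cr‖) * E := by
    have := norm_sub_le (Complex.cosh U) cr
    nlinarith [norm_nonneg cr]
  have c3 : ‖Complex.sinh V * cr - Complex.sinh U * ct - Complex.sinh m‖
      ≤ (‖cr‖ + ‖ct‖ + ‖Complex.sinh m‖) * E := by
    have h1 := norm_sub_le (Complex.sinh V * cr - Complex.sinh U * ct) (Complex.sinh m)
    have h2 := norm_sub_le (Complex.sinh V * cr) (Complex.sinh U * ct)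
    rw [norm_mul, norm_mul] at h2
    have h3 := mul_le_mul_of_nonneg_right b3 (norm_nonneg cr)
    have h4 := mul_le_mul_of_nonneg_right b4 (norm_nonneg ct)
    have h5 := mul_le_mul_of_nonneg_left hE (norm_nonneg (Complex.sinh m))
    linarith
  have t1 : ‖(f * (Complex.cosh V - ct) - h * (Complex.cosh U - cr)) / 2‖
      ≤ (‖f‖ * (1 + ‖ct‖) + ‖h‖ * (1 + ‖cr‖)) / 2 * E := by
    rw [norm_div, Complex.norm_ofNat]
    have h1 := norm_sub_le (f * (Complex.cosh V - ct)) (h * (Complex.cosh U - cr))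
    rw [norm_mul, norm_mul] at h1
    have h2 := mul_le_mul_of_nonneg_left c1 (norm_nonneg f)
    have h3 := mul_le_mul_of_nonneg_left c2 (norm_nonneg h)
    linarith
  have t2 : ‖(Complex.sinh V * cr - Complex.sinh U * ct - Complex.sinh m) / (4 * Complex.sinh P)‖
      ≤ (‖cr‖ + ‖ct‖ + ‖Complex.sinh m‖) / ‖4 * Complex.sinh P‖ * E := by
    rw [norm_div, div_mul_eq_mul_div]
    gcongr
  rw [telQ]
  refine (norm_add_le _ _).trans ?_
  linarith

theorem abs_re_scaled_le {w c z : ℂ} (hw : 0 < w.re) {h : ℝ} (hz : z.im ∈ Icc 0 h) :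
    |(Real.pi * (2 * z + c) / w).re| ≤ 2 * Real.pi * (w⁻¹).re * |z.re|
      + (2 * Real.pi * |(w⁻¹).im| * h + |(Real.pi * c / w).re|) := by
  have e : Real.pi * (2 * z + c) / w = ((2 * Real.pi : ℝ) : ℂ) * (z * w⁻¹) + Real.pi * c / w := by
    push_cast
    ring
  have hi := re_inv_pos hw
  rw [e, add_re, re_ofReal_mul, mul_re]
  refine (abs_add_le _ _).trans ?_
  rw [abs_mul, abs_of_pos Real.two_pi_pos, ← add_assoc]
  have h1 := abs_sub (z.re * (w⁻¹).re) (z.im * (w⁻¹).im)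
  rw [abs_mul, abs_mul, abs_of_pos hi, abs_of_nonneg hz.1] at h1
  have h2 := mul_le_mul_of_nonneg_right hz.2 (abs_nonneg (w⁻¹).im)
  have h3 := mul_le_mul_of_nonneg_left (h1.trans (add_le_add_right h2 _)) Real.two_pi_pos.le
  linarith

/-- The gamma quotient decays at rate `2π Re (1 / w₁ + 1 / w₂)` and the certificate grows at rate at
most `2π Re (1 / w₂)`. The surplus `2π Re (1 / w₁)` is positive. -/
theorem exists_norm_telFun_le {p : Params} (hp : TelGood p) : ∃ C, ∀ z : ℂ, z.im ∈ Icc 0 p.1.re →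
    ‖telFun p z‖ ≤ C / (1 + z.re ^ 2) := by
  obtain ⟨h₁, h₂, -⟩ := id hp.base
  have r1 := re_inv_pos h₁
  have r2 := re_inv_pos h₂
  obtain ⟨C₁, hC₁⟩ := exists_norm_gammaQuot_le_exp_neg h₁ h₂ (fun j => (hp.telNum_lt j).1)
    (fun j => (hp.telNum_lt j).2) (fun j => (hp.telDen_lt j).1) (fun j => (hp.telDen_lt j).2)
    (sum_telNum_sub_telDen p)
  obtain ⟨C₂, hC₂, hQ⟩ := exists_norm_telQ_le (Real.pi * (2 * pX p) / p.2.1)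
    (Real.pi * (2 * I * wMean p.1 p.2.1) / p.2.1)
    (Real.pi * (2 * pL p - 2 * I * wMean p.1 p.2.1) / p.2.1)
    (Real.pi * (2 * (I * parSigma (pγ p))) / p.2.1) (Real.pi * (2 * (I * parUpsilon (pγ p))) / p.2.1)
    (cw p.2.1 (2 * (I * parRho (pγ p)))) (cw p.2.1 (2 * (I * parTau (pγ p))))
  obtain ⟨C₃, hC₃, hexp⟩ := exists_pow_mul_exp_le (A := 1) (c := 2 * Real.pi * (p.1⁻¹).re) le_rfl
    (by positivity) 0
  set c₁ := 2 * pX p + pL p - 3 * I * wMean p.1 p.2.1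
  set c₂ := 2 * pX p - pL p - I * wMean p.1 p.2.1
  set D : ℝ := 2 * Real.pi * |((p.2.1)⁻¹).im| * p.1.re
    + (|(Real.pi * c₁ / p.2.1).re| + |(Real.pi * c₂ / p.2.1).re|) with hD
  refine ⟨C₂ * Real.exp (D + C₁) * C₃, fun z hz => ?_⟩
  have e1 : 2 * (z + pX p) + pL p - 3 * I * wMean p.1 p.2.1 = 2 * z + c₁ := by ring
  have e2 : 2 * (z + pX p) - pL p - I * wMean p.1 p.2.1 = 2 * z + c₂ := by ring
  rw [telFun_eq, norm_mul, telCert, e1, e2]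
  have a1 := abs_re_scaled_le (c := c₁) h₂ hz
  have a2 := abs_re_scaled_le (c := c₂) h₂ hz
  have n1 := abs_nonneg (Real.pi * c₁ / p.2.1).re
  have n2 := abs_nonneg (Real.pi * c₂ / p.2.1).re
  have b := hQ _ _ (2 * Real.pi * ((p.2.1)⁻¹).re * |z.re| + D) (by positivity)
    (a1.trans (by rw [hD]; linarith)) (a2.trans (by rw [hD]; linarith))
  have hx := hexp |z.re| (abs_nonneg _)
  rw [pow_zero, one_mul, sq_abs] at hx
  calc _ ≤ (C₂ * Real.exp (2 * Real.pi * ((p.2.1)⁻¹).re * |z.re| + D)) *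
        Real.exp (C₁ - 2 * Real.pi * ((p.1⁻¹).re + ((p.2.1)⁻¹).re) * |z.re|) :=
        mul_le_mul b (hC₁ z hz) (norm_nonneg _) (by positivity)
    _ = C₂ * Real.exp (D + C₁) * Real.exp (-(2 * Real.pi * (p.1⁻¹).re * |z.re|)) := by
        rw [mul_assoc C₂, mul_assoc C₂, ← Real.exp_add, ← Real.exp_add]
        ring_nf
    _ ≤ C₂ * Real.exp (D + C₁) * (C₃ / (1 + z.re ^ 2)) := by gcongr
    _ = _ := by ring

theorem differentiableAt_telFun {p : Params} (hp : TelGood p) {z : ℂ} (hz : z.im ∈ Icc 0 p.1.re) :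
    DifferentiableAt ℂ (telFun p) z := by
  obtain ⟨h₁, h₂, -⟩ := id hp.base
  have hd : DifferentiableAt ℂ (gammaQuot p.1 p.2.1 (telNum p) (telDen p)) z :=
    differentiableAt_gammaQuot h₁ h₂
      (fun j => abs_im_add_lt_of_mem_Icc (hp.telNum_lt j).1 (hp.telNum_lt j).2 hz rfl)
      (fun j => abs_im_add_lt_of_mem_Icc (hp.telDen_lt j).1 (hp.telDen_lt j).2 hz rfl)
  have e : telFun p = fun z => telCert p (2 * (z + pX p) + pL p - 3 * I * wMean p.1 p.2.1)
      (2 * (z + pX p) - pL p - I * wMean p.1 p.2.1) *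
      gammaQuot p.1 p.2.1 (telNum p) (telDen p) z := funext (telFun_eq p)
  rw [e]
  refine DifferentiableAt.fun_mul ?_ hd
  unfold telCert telQ
  fun_prop

/-- As `w₁` may be complex, the shift by `i w₁` has two parts: a contour shift by `Re w₁` upwards,
and a real translation by `-Im w₁`, under which the integral is invariant. -/
theorem integral_telFun_add {p : Params} (hp : TelGood p) :
    ∫ x : ℝ, telFun p (x + I * p.1) = ∫ x : ℝ, telFun p x := by
  obtain ⟨h₁, h₂, -⟩ := id hp.base
  obtain ⟨C, hC⟩ := exists_norm_telFun_le hp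
  have h := integral_horizontal_eq (f := telFun p) h₁.le
    (fun z hz => (differentiableAt_telFun hp hz).differentiableWithinAt) hC
  have e : (fun x : ℝ => telFun p (x + I * p.1))
      = fun x : ℝ => (fun y : ℝ => telFun p (y + p.1.re * I)) (x + -p.1.im) := by
    funext x
    congr 1
    apply Complex.ext <;> simp
  rw [e]
  refine (integral_add_right_eq_self (μ := volume) (fun y : ℝ => telFun p (y + p.1.re * I))
    (-p.1.im)).trans (h.symm.trans ?_)
  simp

theorem integrable_telFun {p : Params} (hp : TelGood p) : Integrable fun x : ℝ => telFun p x := by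
  obtain ⟨h₁, h₂, -⟩ := id hp.base
  obtain ⟨C, hC⟩ := exists_norm_telFun_le hp
  have hz : ∀ x : ℝ, (x : ℂ).im ∈ Icc 0 p.1.re := fun x => by simpa using h₁.le
  refine integrable_of_bound_inv_one_add_sq (C := C) ?_ fun x => ?_
  · refine Continuous.aestronglyMeasurable (continuous_iff_continuousAt.2 fun x => ?_)
    exact ContinuousAt.comp (f := fun x : ℝ => (x : ℂ)) (differentiableAt_telFun hp (hz x)).continuousAt
      (by fun_prop)
  · have := hC x (hz x)
    rwa [ofReal_re] at this

theorem integral_mul_add_mul_sub_mul {f g h : ℝ → ℂ} (hf : Integrable f) (hg : Integrable g)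
    (hh : Integrable h) (a b c : ℂ) :
    ∫ x, (a * f x + b * g x - c * h x) = a * (∫ x, f x) + b * (∫ x, g x) - c * ∫ x, h x := by
  rw [integral_sub (f := fun x => a * f x + b * g x) ((hf.const_mul a).add (hg.const_mul b))
    (hh.const_mul c), integral_add (hf.const_mul a) (hg.const_mul b), integral_const_mul,
    integral_const_mul, integral_const_mul]

theorem psi_difference {p : Params} (hp : TelGood p) :
    coefB p (2 * pX p + 2 * I * wMean p.1 p.2.1) (2 * (I * parSigma (pγ p))) (2 * (I * parRho (pγ p)))
        * psi p.1 p.2.1 (pγ p) (pX p + I * p.1) (pL p)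
      + coefB p (2 * pX p - 2 * I * wMean p.1 p.2.1) (2 * (I * parUpsilon (pγ p)))
          (2 * (I * parTau (pγ p)))
        * psi p.1 p.2.1 (pγ p) (pX p - I * p.1) (pL p)
      = (coefC p (2 * pX p + 2 * I * wMean p.1 p.2.1) (2 * (I * parSigma (pγ p)))
            (2 * (I * parRho (pγ p))) (2 * (I * parUpsilon (pγ p))) (2 * (I * parTau (pγ p)))
          + coefC p (2 * pX p - 2 * I * wMean p.1 p.2.1) (-(2 * (I * parSigma (pγ p))))
            (2 * (I * parRho (pγ p))) (-(2 * (I * parUpsilon (pγ p)))) (2 * (I * parTau (pγ p)))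
          + (cw p.2.1 (2 * pL p) - cw p.2.1 (2 * I * wMean p.1 p.2.1 + 2 * (I * parSigma (pγ p))
              - 2 * (I * parUpsilon (pγ p)))) / 2)
        * psi p.1 p.2.1 (pγ p) (pX p) (pL p) := by
  have i0 := integrable_psiIntegrand hp.base
  have i1 := integrable_psiIntegrand hp.base_add
  have i2 := integrable_psiIntegrand hp.base_sub
  simp only [shX, pX, pL, pγ] at i1 i2
  rw [← sub_eq_add_neg] at i2
  simp only [psi]
  rw [← sub_eq_zero, ← integral_mul_add_mul_sub_mul i1 i2 i0,
    integral_congr_ae (ae_of_all _ (telFun_add_sub hp))]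
  -- Integrability of the shifted function is read off from the telescoping identity, whose other
  -- terms are integrable.
  have hadd : Integrable fun x : ℝ => telFun p (x + I * p.1) := by
    have h := (((i1.const_mul _).add (i2.const_mul _)).sub (i0.const_mul _)).congr
      (ae_of_all _ (telFun_add_sub hp))
    refine (h.add (integrable_telFun hp)).congr (ae_of_all _ fun x => ?_)
    simp
  rw [integral_sub hadd (integrable_telFun hp), integral_telFun_add hp, sub_self]

/-! ### The difference equation on part of the base domain -/

theorem one_sub_exp_two_mul (v : ℂ) : 1 - Complex.exp (2 * v) = -2 * Complex.exp v * Complex.sinh v := by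
  have h : Complex.exp v * Complex.exp (-v) = 1 := by rw [← Complex.exp_add, add_neg_cancel, Complex.exp_zero]
  rw [two_mul, Complex.exp_add, Complex.sinh]
  linear_combination -h

theorem coeffDen_eq (w₁ w₂ x : ℂ) : coeffDen w₁ w₂ x = 4 * Complex.exp (2 * Real.pi * (2 * x +
    I * wMean w₁ w₂) / w₂) * (sw w₂ (2 * x) * sw w₂ (2 * x + 2 * I * wMean w₁ w₂)) := by
  have e1 : 4 * Real.pi * x / w₂ = 2 * (Real.pi * (2 * x) / w₂) := by ring
  have e2 : 4 * Real.pi * (x + I * wMean w₁ w₂) / w₂ =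
      2 * (Real.pi * (2 * x + 2 * I * wMean w₁ w₂) / w₂) := by ring
  have e3 : 2 * Real.pi * (2 * x + I * wMean w₁ w₂) / w₂ = Real.pi * (2 * x) / w₂ +
      Real.pi * (2 * x + 2 * I * wMean w₁ w₂) / w₂ := by ring
  rw [coeffDen, e1, e2, e3, one_sub_exp_two_mul, one_sub_exp_two_mul, Complex.exp_add, sw, sw]
  ring

/-- The exponential prefactor of the coefficients and of the eigenvalue. -/
def coefE (w₁ w₂ : ℂ) (γ : Fin 4 → ℂ) : ℂ :=
  Complex.exp (2 * Real.pi * (I * wMean w₁ w₂ + I * dualPar γ 0) / w₂)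

/-- The four `sinh` are paired as `γ₀, γ₁` and `γ₂, γ₃`, so that sums and differences give `σ, ρ`
and `υ, τ`. Of the exponential factors, the part depending on `x` cancels against the denominator
and `coefE` remains. -/
theorem coeffA_eq (w₁ w₂ : ℂ) (γ : Fin 4 → ℂ) (x : ℂ) : coeffA w₁ w₂ γ x = 4 * coefE w₁ w₂ γ *
    ((cw w₂ (2 * x + 2 * I * wMean w₁ w₂ + 2 * (I * parSigma γ)) - cw w₂ (2 * (I * parRho γ))) *
      (cw w₂ (2 * x + 2 * I * wMean w₁ w₂ - 2 * (I * parUpsilon γ)) - cw w₂ (2 * (I * parTau γ)))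
      / (4 * sw w₂ (2 * x) * sw w₂ (2 * x + 2 * I * wMean w₁ w₂))) := by
  have e : ∀ j, 2 * Real.pi * (I * wMean w₁ w₂ + I * γ j + x) / w₂ =
      2 * (Real.pi * (I * wMean w₁ w₂ + I * γ j + x) / w₂) := fun j => by ring
  have p1 := sw_mul_sw w₂ (I * wMean w₁ w₂ + I * γ 1 + x) (I * wMean w₁ w₂ + I * γ 0 + x)
  have p2 := sw_mul_sw w₂ (I * wMean w₁ w₂ + I * γ 3 + x) (I * wMean w₁ w₂ + I * γ 2 + x)
  have q1 : I * wMean w₁ w₂ + I * γ 1 + x + (I * wMean w₁ w₂ + I * γ 0 + x) =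
      2 * x + 2 * I * wMean w₁ w₂ + 2 * (I * parSigma γ) := by rw [parSigma]; ring
  have q2 : I * wMean w₁ w₂ + I * γ 1 + x - (I * wMean w₁ w₂ + I * γ 0 + x) =
      2 * (I * parRho γ) := by rw [parRho]; ring
  have q3 : I * wMean w₁ w₂ + I * γ 3 + x + (I * wMean w₁ w₂ + I * γ 2 + x) =
      2 * x + 2 * I * wMean w₁ w₂ - 2 * (I * parUpsilon γ) := by rw [parUpsilon]; ring
  have q4 : I * wMean w₁ w₂ + I * γ 3 + x - (I * wMean w₁ w₂ + I * γ 2 + x) =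
      2 * (I * parTau γ) := by rw [parTau]; ring
  rw [q1, q2] at p1
  rw [q3, q4] at p2
  have hE : Complex.exp (Real.pi * (I * wMean w₁ w₂ + I * γ 0 + x) / w₂) *
      Complex.exp (Real.pi * (I * wMean w₁ w₂ + I * γ 1 + x) / w₂) *
      Complex.exp (Real.pi * (I * wMean w₁ w₂ + I * γ 2 + x) / w₂) *
      Complex.exp (Real.pi * (I * wMean w₁ w₂ + I * γ 3 + x) / w₂) =
      coefE w₁ w₂ γ * Complex.exp (2 * Real.pi * (2 * x + I * wMean w₁ w₂) / w₂) := by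
    rw [coefE, ← Complex.exp_add, ← Complex.exp_add, ← Complex.exp_add, ← Complex.exp_add,
      dualPar_zero]
    ring_nf
  simp only [coeffA, Fin.prod_univ_four, e, one_sub_exp_two_mul, coeffDen_eq]
  have hx := Complex.exp_ne_zero (2 * Real.pi * (2 * x + I * wMean w₁ w₂) / w₂)
  simp only [sw] at p1 p2 ⊢
  generalize Complex.exp (2 * Real.pi * (2 * x + I * wMean w₁ w₂) / w₂) = X at *
  generalize Complex.sinh (Real.pi * (2 * x) / w₂) = s1 at *
  generalize Complex.sinh (Real.pi * (2 * x + 2 * I * wMean w₁ w₂) / w₂) = s2 at *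
  generalize Complex.exp (Real.pi * (I * wMean w₁ w₂ + I * γ 0 + x) / w₂) = e0 at *
  generalize Complex.exp (Real.pi * (I * wMean w₁ w₂ + I * γ 1 + x) / w₂) = e1 at *
  generalize Complex.exp (Real.pi * (I * wMean w₁ w₂ + I * γ 2 + x) / w₂) = e2 at *
  generalize Complex.exp (Real.pi * (I * wMean w₁ w₂ + I * γ 3 + x) / w₂) = e3 at *
  generalize Complex.sinh (Real.pi * (I * wMean w₁ w₂ + I * γ 0 + x) / w₂) = t0 at *
  generalize Complex.sinh (Real.pi * (I * wMean w₁ w₂ + I * γ 1 + x) / w₂) = t1 at *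
  generalize Complex.sinh (Real.pi * (I * wMean w₁ w₂ + I * γ 2 + x) / w₂) = t2 at *
  generalize Complex.sinh (Real.pi * (I * wMean w₁ w₂ + I * γ 3 + x) / w₂) = t3 at *
  have hn : -2 * e0 * t0 * (-2 * e1 * t1) * (-2 * e2 * t2) * (-2 * e3 * t3) =
      16 * (e0 * e1 * e2 * e3) * ((t1 * t0) * (t3 * t2)) := by ring
  rw [hn, hE, p1, p2]
  have hXX : X * X⁻¹ = 1 := mul_inv_cancel₀ hx
  generalize cw w₂ (2 * x + 2 * I * wMean w₁ w₂ + 2 * (I * parSigma γ)) - cw w₂ (2 * (I * parRho γ)) = A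
  generalize cw w₂ (2 * x + 2 * I * wMean w₁ w₂ - 2 * (I * parUpsilon γ)) - cw w₂ (2 * (I * parTau γ)) = B
  simp only [div_eq_mul_inv, mul_inv]
  linear_combination (coefE w₁ w₂ γ * A * B * s1⁻¹ * s2⁻¹) * hXX

theorem eigenV_eq {w₁ w₂ : ℂ} (h₂ : w₂ ≠ 0) (γ : Fin 4 → ℂ) (l : ℂ) : eigenV w₁ w₂ γ l =
    4 * coefE w₁ w₂ γ * ((cw w₂ (2 * l) - cw w₂ (2 * I * wMean w₁ w₂ + 2 * (I * parSigma γ)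
      - 2 * (I * parUpsilon γ))) / 2) := by
  -- Replacing `w₁` by `2w - w₂` shifts the argument by `-π i`, which changes the sign of both `exp`
  -- and `cosh`.
  have e : Real.pi * I * w₁ / w₂ + 2 * Real.pi * I * dualPar γ 0 / w₂ =
      2 * Real.pi * (I * wMean w₁ w₂ + I * dualPar γ 0) / w₂ - Real.pi * I := by
    rw [wMean]
    field_simp
    ring
  have e1 : 2 * Real.pi * l / w₂ = Real.pi * (2 * l) / w₂ := by ring
  have e2 : Real.pi * (2 * I * wMean w₁ w₂ + 2 * (I * parSigma γ) - 2 * (I * parUpsilon γ)) / w₂ =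
      2 * Real.pi * (I * wMean w₁ w₂ + I * dualPar γ 0) / w₂ := by
    rw [dualPar_zero, parSigma, parUpsilon]
    ring
  rw [eigenV, e, Complex.cosh_sub_pi_mul_I, Complex.exp_sub, Complex.exp_pi_mul_I, e1, cw, cw, e2, coefE]
  ring

theorem Delta_eq (w₁ w₂ : ℂ) (γ : Fin 4 → ℂ) (x : ℂ) : Delta w₁ w₂ γ x =
    hypGammaPM w₁ w₂ (x - I * parUpsilon γ) (I * parTau γ) /
      hypGammaPM w₁ w₂ (x - I * parSigma γ) (I * parRho γ) := by
  rw [Delta, hypGammaPM, hypGammaPM, parUpsilon, parTau, parSigma, parRho]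
  ring_nf

theorem cw_sub_mul_cw_sub (w Y σ r : ℂ) : (cw w (Y + σ) - r) * (cw w (Y - σ) - r) =
    cw w Y ^ 2 - 2 * cw w Y * cw w σ * r + cw w σ ^ 2 + r ^ 2 - 1 := by
  have e1 : Real.pi * (Y + σ) / w = Real.pi * Y / w + Real.pi * σ / w := by ring
  have e2 : Real.pi * (Y - σ) / w = Real.pi * Y / w - Real.pi * σ / w := by ring
  have h1 := Complex.cosh_sq (Real.pi * Y / w)
  have h2 := Complex.cosh_sq (Real.pi * σ / w)
  simp only [cw, e1, e2, Complex.cosh_add, Complex.cosh_sub]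
  generalize Complex.cosh (Real.pi * Y / w) = a at *
  generalize Complex.sinh (Real.pi * Y / w) = b at *
  generalize Complex.cosh (Real.pi * σ / w) = c at *
  generalize Complex.sinh (Real.pi * σ / w) = d at *
  linear_combination (c ^ 2 - 1) * h1 + b ^ 2 * h2

theorem inStrip_Delta {p : Params} (hp : p ∈ baseDomain) :
    InStrip p.1 p.2.1 (pX p - I * parUpsilon (pγ p)) (I * parTau (pγ p)) ∧
      InStrip p.1 p.2.1 (pX p - I * parSigma (pγ p)) (I * parRho (pγ p)) := by
  have h := fun j => abs_im_preArg_lt hp (Sum.inr (Sum.inl j))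
  have key : ∀ (a b : ℂ), |b.im| < (wMean p.1 p.2.1).re → a = b ∨ a = -b →
      |a.im| < (wMean p.1 p.2.1).re := by
    rintro a b hb (rfl | rfl)
    · exact hb
    · rwa [neg_im, abs_neg]
  refine ⟨⟨key _ _ (h 3) (Or.inr ?_), key _ _ (h 2) (Or.inr ?_)⟩,
    ⟨key _ _ (h 0) (Or.inl ?_), key _ _ (h 1) (Or.inl ?_)⟩⟩ <;>
  simp only [preArg, Sum.elim_inl, Sum.elim_inr, deltaArg, Matrix.cons_val, parUpsilon, parTau,
    parSigma, parRho] <;> ring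

theorem mul_div_pair_ratio {a b c s k q r : ℂ} (hb : b ≠ 0) (hc : c ≠ 0) (hk : k ≠ 0) (hq : q ≠ 0)
    (hr : r ≠ 0) : a * b / s / (k * b * q / (k * c * r)) = a * c / s / (q / r) := by
  field_simp

/-- The ratio `Δ(x + i w₁) / Δ(x)` is `(cw (Y - υ) - cw t) / (cw (Y - σ) - cw r)` with doubled
parameters, which exchanges one factor of `coefC` for the missing factor of `coefB`. -/
theorem coefC_mul_Delta {p : Params} (hp : p ∈ baseDomain) (hq : shX (I * p.1) p ∈ baseDomain) :
    coefC p (2 * pX p + 2 * I * wMean p.1 p.2.1) (2 * (I * parSigma (pγ p)))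
      (2 * (I * parRho (pγ p))) (2 * (I * parUpsilon (pγ p))) (2 * (I * parTau (pγ p)))
      / Delta p.1 p.2.1 (pγ p) (pX p + I * p.1) =
    coefB p (2 * pX p + 2 * I * wMean p.1 p.2.1) (2 * (I * parSigma (pγ p))) (2 * (I * parRho (pγ p)))
      / Delta p.1 p.2.1 (pγ p) (pX p) := by
  obtain ⟨h₁, h₂, -⟩ := id hp
  obtain ⟨a, b⟩ := inStrip_Delta hp
  obtain ⟨a', b'⟩ := inStrip_Delta hq
  simp only [shX, pX, pγ] at *
  have e : ∀ u : ℂ, p.2.2.2.1 + I * p.1 - u = p.2.2.2.1 - u + I * p.1 := fun u => by ring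
  rw [e] at a' b'
  have f1 := hypGammaPM_add h₁ h₂ a a'
  have f2 := hypGammaPM_add h₁ h₂ b b'
  have n1 := hypGammaPM_ne_zero p.1 p.2.1 (p.2.2.2.1 - I * parUpsilon p.2.2.1 + I * p.1) (I * parTau p.2.2.1)
  have n2 := hypGammaPM_ne_zero p.1 p.2.1 (p.2.2.2.1 - I * parSigma p.2.2.1 + I * p.1) (I * parRho p.2.2.1)
  have g1 : 2 * (p.2.2.2.1 - I * parUpsilon p.2.2.1) + 2 * I * wMean p.1 p.2.1 =
      2 * p.2.2.2.1 + 2 * I * wMean p.1 p.2.1 - 2 * (I * parUpsilon p.2.2.1) := by ring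
  have g2 : 2 * (p.2.2.2.1 - I * parSigma p.2.2.1) + 2 * I * wMean p.1 p.2.1 =
      2 * p.2.2.2.1 + 2 * I * wMean p.1 p.2.1 - 2 * (I * parSigma p.2.2.1) := by ring
  rw [f1, g1] at n1
  rw [f2, g2] at n2
  rw [Delta_eq, Delta_eq, e, e, f1, f2, g1, g2, coefC, coefB, ← cw_sub_mul_cw_sub]
  simp only [ne_eq, mul_eq_zero, not_or] at n1 n2
  exact mul_div_pair_ratio n1.1.2 n2.1.2 n1.1.1 n1.2 n2.2

theorem coefC_mul_Delta' {p : Params} (hp : p ∈ baseDomain) (hq : shX (-(I * p.1)) p ∈ baseDomain) :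
    coefC p (2 * pX p - 2 * I * wMean p.1 p.2.1) (-(2 * (I * parSigma (pγ p))))
      (2 * (I * parRho (pγ p))) (-(2 * (I * parUpsilon (pγ p)))) (2 * (I * parTau (pγ p)))
      / Delta p.1 p.2.1 (pγ p) (pX p - I * p.1) =
    coefB p (2 * pX p - 2 * I * wMean p.1 p.2.1) (2 * (I * parUpsilon (pγ p))) (2 * (I * parTau (pγ p)))
      / Delta p.1 p.2.1 (pγ p) (pX p) := by
  obtain ⟨h₁, h₂, -⟩ := id hp
  obtain ⟨a, b⟩ := inStrip_Delta hp
  obtain ⟨a', b'⟩ := inStrip_Delta hq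
  simp only [shX, pX, pγ] at *
  have e : ∀ u : ℂ, p.2.2.2.1 + -(I * p.1) - u = p.2.2.2.1 - u - I * p.1 := fun u => by ring
  have e' : ∀ u : ℂ, p.2.2.2.1 - I * p.1 - u = p.2.2.2.1 - u - I * p.1 := fun u => by ring
  rw [e] at a' b'
  have f1 := hypGammaPM_eq_sub h₁ h₂ a a'
  have f2 := hypGammaPM_eq_sub h₁ h₂ b b'
  have n1 := hypGammaPM_ne_zero p.1 p.2.1 (p.2.2.2.1 - I * parUpsilon p.2.2.1) (I * parTau p.2.2.1)
  have n2 := hypGammaPM_ne_zero p.1 p.2.1 (p.2.2.2.1 - I * parSigma p.2.2.1) (I * parRho p.2.2.1)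
  have g1 : 2 * (p.2.2.2.1 - I * parUpsilon p.2.2.1) - 2 * I * wMean p.1 p.2.1 =
      2 * p.2.2.2.1 - 2 * I * wMean p.1 p.2.1 - 2 * (I * parUpsilon p.2.2.1) := by ring
  have g2 : 2 * (p.2.2.2.1 - I * parSigma p.2.2.1) - 2 * I * wMean p.1 p.2.1 =
      2 * p.2.2.2.1 - 2 * I * wMean p.1 p.2.1 - 2 * (I * parSigma p.2.2.1) := by ring
  rw [f1, g1] at n1
  rw [f2, g2] at n2
  rw [Delta_eq, Delta_eq, e', e', f1, f2, g1, g2, coefC, coefB, ← cw_sub_mul_cw_sub, sub_neg_eq_add,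
    ← sub_eq_add_neg]
  simp only [ne_eq, mul_eq_zero, not_or] at n1 n2
  rw [mul_div_pair_ratio n1.1.2 n2.1.2 n1.1.1 n1.2 n2.2, mul_comm]

/-- Collecting the terms in `S(x)`, the claim reads `A(x) S(x + i w₁) + A(-x) S(x - i w₁) = (A(x) +
A(-x) + v) S(x)`, and the bracket on the right is `4 * coefE` times the one in `psi_difference`. -/
theorem awOperator_sFormula {p : Params} (hp : TelGood p) :
    awOperator p.1 p.2.1 (pγ p) (fun x => sFormula p.1 p.2.1 (pγ p) x (pL p)) (pX p) =
      eigenV p.1 p.2.1 (pγ p) (pL p) * sFormula p.1 p.2.1 (pγ p) (pX p) (pL p) := by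
  have h₂ : p.2.1 ≠ 0 := ne_zero_of_re_pos hp.base.2.1
  have d1 := coefC_mul_Delta hp.base hp.base_add
  have d2 := coefC_mul_Delta' hp.base hp.base_sub
  have hψ := psi_difference hp
  have a1 := coeffA_eq p.1 p.2.1 (pγ p) (pX p)
  have a2 : coeffA p.1 p.2.1 (pγ p) (-pX p) = 4 * coefE p.1 p.2.1 (pγ p) *
      coefC p (2 * pX p - 2 * I * wMean p.1 p.2.1) (-(2 * (I * parSigma (pγ p))))
        (2 * (I * parRho (pγ p))) (-(2 * (I * parUpsilon (pγ p)))) (2 * (I * parTau (pγ p))) := by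
    rw [coeffA_eq, coefC]
    have e1 : 2 * -pX p + 2 * I * wMean p.1 p.2.1 + 2 * (I * parSigma (pγ p)) =
        -(2 * pX p - 2 * I * wMean p.1 p.2.1 + -(2 * (I * parSigma (pγ p)))) := by ring
    have e2 : 2 * -pX p + 2 * I * wMean p.1 p.2.1 - 2 * (I * parUpsilon (pγ p)) =
        -(2 * pX p - 2 * I * wMean p.1 p.2.1 - -(2 * (I * parUpsilon (pγ p)))) := by ring
    have e3 : 2 * -pX p = -(2 * pX p) := by ring
    have e4 : -(2 * pX p) + 2 * I * wMean p.1 p.2.1 = -(2 * pX p - 2 * I * wMean p.1 p.2.1) := by ring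
    rw [e1, e2, e3, e4, cw_neg, cw_neg, sw_neg, sw_neg]
    congr 2
    ring
  have a1' : coeffA p.1 p.2.1 (pγ p) (pX p) = 4 * coefE p.1 p.2.1 (pγ p) *
      coefC p (2 * pX p + 2 * I * wMean p.1 p.2.1) (2 * (I * parSigma (pγ p)))
      (2 * (I * parRho (pγ p))) (2 * (I * parUpsilon (pγ p))) (2 * (I * parTau (pγ p))) := a1
  rw [awOperator, a1', a2, eigenV_eq h₂]
  simp only [sFormula, div_eq_mul_inv, mul_inv] at d1 d2 hψ ⊢
  linear_combination (4 * coefE p.1 p.2.1 (pγ p) * normN p.1 p.2.1 (pγ p) * ((p.1 * p.2.1) ^ (1 * 2⁻¹ : ℂ))⁻¹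
    * (Delta p.1 p.2.1 (dualPar (pγ p)) (pL p))⁻¹) *
    (psi p.1 p.2.1 (pγ p) (pX p + I * p.1) (pL p) * d1
    + psi p.1 p.2.1 (pγ p) (pX p - I * p.1) (pL p) * d2
    + (Delta p.1 p.2.1 (pγ p) (pX p))⁻¹ * hψ)

/-! ### A point near which the telescoping argument applies -/

/-- The conditions on the arguments of `N` require `γ₀ + γⱼ` to have negative real part, so `γ = 0`
is not allowed; a slightly negative `γ₀` suffices. -/
def refGamma (j : Fin 4) : ℂ := if j = 0 then -1 / 100 else 0

theorem refGamma_zero : refGamma 0 = -1 / 100 := rfl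
theorem refGamma_one : refGamma 1 = 0 := rfl
theorem refGamma_two : refGamma 2 = 0 := rfl
theorem refGamma_three : refGamma 3 = 0 := rfl

/-- The period `w₁ = 1/10` is small compared with `w₂ = 1`, so that the shifts of `x` by `± i w₁`
remain in the base domain, and `x = 1` has nonzero real part, which keeps the denominators of the
coefficients from vanishing. -/
def refPoint : Params := (1 / 10, 1, refGamma, 1, 0)

theorem isOpen_baseDomain : IsOpen baseDomain := by
  have h : baseDomain = {p : Params | 0 < p.1.re} ∩ {p : Params | 0 < p.2.1.re} ∩
      {p : Params | |p.2.2.2.1.im| < zeta p.1 p.2.1 p.2.2.1 p.2.2.2.2} ∩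
      ⋂ j : Fin 3, {p : Params | |(I * p.2.2.1 0 + I * p.2.2.1 j.succ + I * wMean p.1 p.2.1).im|
        < (wMean p.1 p.2.1).re} := by
    ext ⟨w₁, w₂, γ, x, l⟩
    simp [baseDomain, and_assoc]
  rw [h]
  have o1 : IsOpen {p : Params | 0 < p.1.re} := isOpen_lt (by fun_prop) (by fun_prop)
  have o2 : IsOpen {p : Params | 0 < p.2.1.re} := isOpen_lt (by fun_prop) (by fun_prop)
  have o3 : IsOpen {p : Params | |p.2.2.2.1.im| < zeta p.1 p.2.1 p.2.2.1 p.2.2.2.2} := by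
    simp only [zeta, xi, wMean, parRho, parSigma, parTau, parUpsilon]
    exact isOpen_lt (by fun_prop) (by fun_prop)
  have o4 : ∀ j : Fin 3, IsOpen {p : Params | |(I * p.2.2.1 0 + I * p.2.2.1 j.succ
      + I * wMean p.1 p.2.1).im| < (wMean p.1 p.2.1).re} := fun j => by
    simp only [wMean]
    exact isOpen_lt (by fun_prop) (by fun_prop)
  exact ((o1.inter o2).inter o3).inter (isOpen_iInter_of_finite o4)

theorem eventually_telGood : ∀ᶠ p in 𝓝 refPoint, TelGood p := by
  have hb : ∀ t : ℝ, |t| ≤ 1 / 10 → shX (I * t) refPoint ∈ baseDomain := by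
    intro t ht
    have hξ : xi refGamma ≤ 1 / 100 := by
      refine max_le (max_le ?_ ?_) (max_le ?_ ?_) <;>
        norm_num [parRho, parSigma, parTau, parUpsilon, abs_le, refGamma_zero, refGamma_one, refGamma_two, refGamma_three]
    refine ⟨by norm_num [refPoint], by norm_num [refPoint], ?_, fun j => ?_⟩
    · have h1 : (1 + I * (t : ℂ)).im = t := by simp
      have h2 : (wMean (1 / 10) 1).re = 11 / 20 := by norm_num [wMean]
      change |(1 + I * (t : ℂ)).im| < zeta (1 / 10) 1 refGamma 0
      rw [h1, zeta, h2]
      norm_num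
      linarith
    · have g : ∀ j : Fin 3, refGamma j.succ = 0 := by
        intro j
        fin_cases j <;> rfl
      change |(I * (refGamma 0) + I * refGamma j.succ
        + I * wMean (1 / 10) 1).im| < (wMean (1 / 10) 1).re
      rw [g]
      norm_num [wMean, abs_lt, refGamma_zero]
  have c1 : Continuous fun p : Params => shX (I * p.1) p := by unfold shX; fun_prop
  have c2 : Continuous fun p : Params => shX (-(I * p.1)) p := by unfold shX; fun_prop
  have e0 : ∀ᶠ p in 𝓝 refPoint, p ∈ baseDomain := by
    refine isOpen_baseDomain.mem_nhds ?_
    have := hb 0 (by norm_num)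
    simpa [shX] using this
  have e1 : ∀ᶠ p in 𝓝 refPoint, shX (I * p.1) p ∈ baseDomain := by
    refine c1.continuousAt.eventually_mem (isOpen_baseDomain.mem_nhds ?_)
    have := hb (1 / 10) (by norm_num [abs_of_pos])
    simpa [refPoint] using this
  have e2 : ∀ᶠ p in 𝓝 refPoint, shX (-(I * p.1)) p ∈ baseDomain := by
    refine c2.continuousAt.eventually_mem (isOpen_baseDomain.mem_nhds ?_)
    have := hb (-1 / 10) (by norm_num [abs_of_pos])
    simpa [refPoint, neg_div] using this
  have strip : ∀ a : Params → ℂ, Continuous a → |(a refPoint).im| < 11 / 20 →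
      ∀ᶠ p in 𝓝 refPoint, |(a p).im| < (wMean p.1 p.2.1).re := by
    intro a ha h
    have hw : (wMean refPoint.1 refPoint.2.1).re = 11 / 20 := by
      norm_num [refPoint, wMean]
    refine ContinuousAt.eventually_lt (f := fun p => |(a p).im|) (g := fun p => (wMean p.1 p.2.1).re)
      (by fun_prop) (by unfold wMean; fun_prop) ?_
    rwa [hw]
  have e3 := strip (fun p => -pL p / 2 - I * wMean p.1 p.2.1 / 2 + I * p.1 + I * parSigma (pγ p))
    (by unfold wMean parSigma; fun_prop) (by norm_num [refPoint, wMean, parSigma, parUpsilon, pL, pγ,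
      abs_lt, refGamma_zero, refGamma_one, refGamma_two, refGamma_three])
  have e4 := strip (fun p => -pL p / 2 - I * wMean p.1 p.2.1 / 2 + I * p.1 - I * parSigma (pγ p))
    (by unfold wMean parSigma; fun_prop) (by norm_num [refPoint, wMean, parSigma, parUpsilon, pL, pγ,
      abs_lt, refGamma_zero, refGamma_one, refGamma_two, refGamma_three])
  have e5 := strip (fun p => pL p / 2 + I * wMean p.1 p.2.1 / 2 - I * p.1 + I * parUpsilon (pγ p))
    (by unfold wMean parUpsilon; fun_prop) (by norm_num [refPoint, wMean, parSigma, parUpsilon, pL, pγ,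
      abs_lt, refGamma_zero, refGamma_one, refGamma_two, refGamma_three])
  have e6 := strip (fun p => pL p / 2 + I * wMean p.1 p.2.1 / 2 - I * p.1 - I * parUpsilon (pγ p))
    (by unfold wMean parUpsilon; fun_prop) (by norm_num [refPoint, wMean, parSigma, parUpsilon, pL, pγ,
      abs_lt, refGamma_zero, refGamma_one, refGamma_two, refGamma_three])
  have hsw : ∀ a : Params → ℂ, Continuous a → 0 < (a refPoint).re →
      ∀ᶠ p in 𝓝 refPoint, sw p.2.1 (a p) ≠ 0 := by
    intro a ha h
    have hc : ContinuousAt (fun p : Params => sw p.2.1 (a p)) refPoint := by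
      unfold sw
      have : refPoint.2.1 ≠ 0 := by simp [refPoint]
      fun_prop (disch := assumption)
    refine hc.eventually_ne fun h0 => ?_
    have h1 := sinh_re_le_norm_sinh (Real.pi * a refPoint / refPoint.2.1)
    rw [sw] at h0
    rw [h0, norm_zero] at h1
    have h2 : (Real.pi * a refPoint / refPoint.2.1).re = Real.pi * (a refPoint).re := by
      simp [refPoint]
    rw [h2] at h1
    exact absurd h1 (not_le.2 (Real.sinh_pos_iff.2 (by positivity)))
  filter_upwards [e0, e1, e2, e3, e4, e5, e6, hsw (fun p => 2 * pX p) (by fun_prop) (by simp [refPoint, pX]),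
    hsw (fun p => 2 * pX p + 2 * I * wMean p.1 p.2.1) (by unfold wMean; fun_prop)
      (by simp [refPoint, wMean, pX]),
    hsw (fun p => 2 * pX p - 2 * I * wMean p.1 p.2.1) (by unfold wMean; fun_prop)
      (by simp [refPoint, wMean, pX])] with p a1 a2 a3 a4 a5 a6 a7 a8 a9 a10
  exact ⟨a1, a2, a3, ⟨a4, a5⟩, ⟨a6, a7⟩, a8, a9, a10⟩

/-! ### Existence of the meromorphic continuation -/

theorem refPoint_mem_baseDomain : refPoint ∈ baseDomain := eventually_telGood.self_of_nhds.base

theorem baseDomain_subset : baseDomain ⊆ bigDomain := fun _ hp => ⟨hp.1, hp.2.1⟩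

theorem isOpen_bigDomain : IsOpen bigDomain :=
  (isOpen_lt (f := fun _ : Params => (0 : ℝ)) (g := fun p : Params => p.1.re) (by fun_prop)
    (by fun_prop)).inter
  (isOpen_lt (f := fun _ : Params => (0 : ℝ)) (g := fun p : Params => p.2.1.re) (by fun_prop)
    (by fun_prop))

theorem convex_bigDomain : Convex ℝ bigDomain := by
  have h2 : Convex ℝ {p : Params | 0 < p.1.re} :=
    convex_halfSpace_gt (f := fun p : Params => p.1.re) ⟨fun p q => by simp, fun c p => by simp⟩ _
  have h3 : Convex ℝ {p : Params | 0 < p.2.1.re} :=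
    convex_halfSpace_gt (f := fun p : Params => p.2.1.re) ⟨fun p q => by simp, fun c p => by simp⟩ _
  exact h2.inter h3

/-- Numerator of the continuation on `bddDomain n`. -/
def sNum (n : ℕ) : Params → ℂ := (exists_sFormula_continuation n).choose

/-- Denominator of the continuation on `bddDomain n`. -/
def sDen (n : ℕ) : Params → ℂ := (exists_sFormula_continuation n).choose_spec.choose

theorem differentiableOn_sNum (n : ℕ) : DifferentiableOn ℂ (sNum n) (bddDomain n) :=
  (exists_sFormula_continuation n).choose_spec.choose_spec.1

theorem differentiableOn_sDen (n : ℕ) : DifferentiableOn ℂ (sDen n) (bddDomain n) :=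
  (exists_sFormula_continuation n).choose_spec.choose_spec.2.1

theorem sDen_ne_zero {n : ℕ} {p : Params} (hp : p ∈ baseDomain) (hn : p ∈ bddDomain n) : sDen n p ≠ 0 :=
  ((exists_sFormula_continuation n).choose_spec.choose_spec.2.2 p ⟨hp, hn⟩).1

theorem sFormula_mul_sDen {n : ℕ} {p : Params} (hp : p ∈ baseDomain) (hn : p ∈ bddDomain n) :
    sFormula p.1 p.2.1 (pγ p) (pX p) (pL p) * sDen n p = sNum n p :=
  ((exists_sFormula_continuation n).choose_spec.choose_spec.2.2 p ⟨hp, hn⟩).2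

/-- Near `refPoint` both quotients equal the explicit formula; cross-multiplied, this is an identity
of holomorphic functions and spreads over the convex intersection. It makes the continuation
independent of the level. -/
theorem sNum_mul_sDen_comm {n m : ℕ} (hn : refPoint ∈ bddDomain n) (hm : refPoint ∈ bddDomain m)
    {q : Params} (hqn : q ∈ bddDomain n) (hqm : q ∈ bddDomain m) :
    sNum n q * sDen m q = sNum m q * sDen n q := by
  rw [← sub_eq_zero]
  refine eqOn_zero_of_convex ((isOpen_bddDomain n).inter (isOpen_bddDomain m))
    ((convex_bddDomain n).inter (convex_bddDomain m)) (f := fun q => sNum n q * sDen m q - sNum m q * sDen n q)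
    (p := refPoint) ?_ ⟨hn, hm⟩ ?_ q ⟨hqn, hqm⟩
  · exact (((differentiableOn_sNum n).mono inter_subset_left).mul
      ((differentiableOn_sDen m).mono inter_subset_right)).sub
      (((differentiableOn_sNum m).mono inter_subset_right).mul
      ((differentiableOn_sDen n).mono inter_subset_left))
  · filter_upwards [isOpen_baseDomain.mem_nhds refPoint_mem_baseDomain,
      (isOpen_bddDomain n).mem_nhds hn, (isOpen_bddDomain m).mem_nhds hm] with p h1 h2 h3
    rw [← sFormula_mul_sDen h1 h2, ← sFormula_mul_sDen h1 h3]
    ring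

theorem exists_level {p : Params} (hp : p ∈ bigDomain) :
    ∃ n₀ : ℕ, ∀ n ≥ n₀, refPoint ∈ bddDomain n ∧ p ∈ bddDomain n := by
  obtain ⟨a, ha⟩ := exists_forall_mem_bddDomain (baseDomain_subset refPoint_mem_baseDomain)
  obtain ⟨b, hb⟩ := exists_forall_mem_bddDomain hp
  exact ⟨max a b, fun n hn => ⟨ha n (le_of_max_le_left hn), hb n (le_of_max_le_right hn)⟩⟩

theorem frequently_sDen_ne_zero {n : ℕ} (hn : refPoint ∈ bddDomain n) {p : Params} (hp : p ∈ bddDomain n) :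
    ∃ᶠ q in 𝓝 p, sDen n q ≠ 0 :=
  frequently_ne_zero_of_convex (isOpen_bddDomain n) (convex_bddDomain n) (differentiableOn_sDen n)
    ⟨refPoint, hn, sDen_ne_zero refPoint_mem_baseDomain hn⟩ hp

open Classical in
/-- The meromorphic continuation of the explicit formula. -/
def sCont (p : Params) : ℂ :=
  -- On the base domain the formula itself is used, so the required equality there holds by
  -- definition. Elsewhere any level with nonvanishing denominator gives the same value.
  if p ∈ baseDomain then sFormula p.1 p.2.1 (pγ p) (pX p) (pL p)
  else if h : ∃ n, refPoint ∈ bddDomain n ∧ p ∈ bddDomain n ∧ sDen n p ≠ 0 then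
    sNum h.choose p / sDen h.choose p
  else 0

theorem isAskeyWilsonS_sCont : IsAskeyWilsonS sCont := by
  refine ⟨fun p hp => ?_, fun w₁ w₂ γ x l h => if_pos h⟩
  obtain ⟨n, hn⟩ := exists_level hp
  obtain ⟨hr, hpn⟩ := hn n le_rfl
  obtain ⟨r, hr0, hball⟩ := Metric.isOpen_iff.1 (isOpen_bddDomain n) p hpn
  refine ⟨r, hr0, sNum n, sDen n, (differentiableOn_sNum n).mono hball,
    (differentiableOn_sDen n).mono hball, ?_, fun q hq hq0 => ?_⟩
  · obtain ⟨q, h1, h2⟩ := ((frequently_sDen_ne_zero hr hpn).and_eventually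
      (Metric.ball_mem_nhds p hr0)).exists
    exact ⟨q, h2, h1⟩
  · by_cases hqb : q ∈ baseDomain
    · rw [sCont, if_pos hqb, eq_div_iff hq0, sFormula_mul_sDen hqb (hball hq)]
    · have hex : ∃ n, refPoint ∈ bddDomain n ∧ q ∈ bddDomain n ∧ sDen n q ≠ 0 :=
        ⟨n, hr, hball hq, hq0⟩
      obtain ⟨h1, h2, h3⟩ := hex.choose_spec
      rw [sCont, if_neg hqb, dif_pos hex, div_eq_div_iff h3 hq0]
      exact sNum_mul_sDen_comm h1 hr h2 (hball hq)

/-! ### Uniqueness of the meromorphic continuation -/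

theorem eq_zero_of_frequently {V : Type*} [TopologicalSpace V] {f : V → ℂ} {p : V}
    (hc : ContinuousAt f p) (h : ∃ᶠ q in 𝓝 p, f q = 0) : f p = 0 :=
  by_contra fun hne => h (hc.eventually_ne hne)

theorem HolomorphicAt.continuousAt {S : Params → ℂ} {p : Params} (h : HolomorphicAt S p) :
    ContinuousAt S p := h.self_of_nhds.continuousAt

theorem holomorphicAt_of_eq_div {S f g : Params → ℂ} {U : Set Params} (hU : IsOpen U)
    (hf : DifferentiableOn ℂ f U) (hg : DifferentiableOn ℂ g U)
    (h : ∀ q ∈ U, g q ≠ 0 → S q = f q / g q) {p : Params} (hp : p ∈ U) (hp0 : g p ≠ 0) :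
    HolomorphicAt S p := by
  have hgc : ∀ q ∈ U, ContinuousAt g q := fun q hq => (hg.differentiableAt (hU.mem_nhds hq)).continuousAt
  have h1 : ∀ᶠ q in 𝓝 p, q ∈ U ∧ g q ≠ 0 := by
    filter_upwards [hU.mem_nhds hp, (hgc p hp).eventually_ne hp0] with q h h' using ⟨h, h'⟩
  filter_upwards [h1.eventually_nhds] with q hq
  obtain ⟨hqU, hq0⟩ := hq.self_of_nhds
  have hd : DifferentiableAt ℂ (fun q => f q * (g q)⁻¹) q :=
    (hf.differentiableAt (hU.mem_nhds hqU)).mul ((hg.differentiableAt (hU.mem_nhds hqU)).inv hq0)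
  refine hd.congr_of_eventuallyEq ?_
  filter_upwards [hq] with q' hq'
  rw [h q' hq'.1 hq'.2, div_eq_mul_inv]

theorem frequently_holomorphicAt {S : Params → ℂ} {U : Set Params} (hS : IsMeromorphicOn S U) {p : Params}
    (hp : p ∈ U) : ∃ᶠ q in 𝓝 p, HolomorphicAt S q := by
  obtain ⟨r, hr, f, g, hf, hg, hne, h⟩ := hS p hp
  have := frequently_ne_zero_of_convex Metric.isOpen_ball (convex_ball p r) hg hne
    (Metric.mem_ball_self hr)
  refine (this.and_eventually (Metric.ball_mem_nhds p hr)).mono fun q hq => ?_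
  exact holomorphicAt_of_eq_div Metric.isOpen_ball hf hg h hq.2 hq.1

theorem IsAskeyWilsonS.eq_sFormula {S : Params → ℂ} (hS : IsAskeyWilsonS S) {p : Params}
    (hp : p ∈ baseDomain) : S p = sFormula p.1 p.2.1 (pγ p) (pX p) (pL p) :=
  hS.2 p.1 p.2.1 p.2.2.1 p.2.2.2.1 p.2.2.2.2 hp

/-- Values of `S` on polar sets are arbitrary, so the relation can only be asserted at points of
holomorphy. The points near which it holds in this sense form an open set that is also relatively
closed in the connected `bddDomain n` and contains `refPoint`. -/
theorem IsAskeyWilsonS.mul_sDen {S : Params → ℂ} (hS : IsAskeyWilsonS S) {n : ℕ}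
    (hn : refPoint ∈ bddDomain n) {q : Params} (hq : q ∈ bddDomain n) (hh : HolomorphicAt S q) :
    S q * sDen n q = sNum n q := by
  set A : Set Params := {q | ∀ᶠ q' in 𝓝 q, HolomorphicAt S q' → S q' * sDen n q' = sNum n q'} with hA
  have hAo : IsOpen A := isOpen_iff_mem_nhds.2 fun q hq => hq.eventually_nhds
  have hsub : bddDomain n ⊆ A := by
    refine (convex_bddDomain n).isPreconnected.subset_of_closure_inter_subset hAo
      ⟨refPoint, hn, ?_⟩ ?_
    · filter_upwards [isOpen_baseDomain.mem_nhds refPoint_mem_baseDomain,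
        (isOpen_bddDomain n).mem_nhds hn] with p h1 h2 _
      rw [hS.eq_sFormula h1, sFormula_mul_sDen h1 h2]
    · rintro p ⟨hpc, hpn⟩
      obtain ⟨r, hr, F, G, hF, hG, hne, hFG⟩ := hS.1 p (bddDomain_subset n hpn)
      obtain ⟨r', hr', hball⟩ := Metric.isOpen_iff.1 (isOpen_bddDomain n) p hpn
      set D := Metric.ball p (min r r') with hD
      have hD1 : D ⊆ Metric.ball p r := Metric.ball_subset_ball (min_le_left _ _)
      have hD2 : D ⊆ bddDomain n := (Metric.ball_subset_ball (min_le_right _ _)).trans hball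
      have hDo : IsOpen D := Metric.isOpen_ball
      have hpD : p ∈ D := Metric.mem_ball_self (lt_min hr hr')
      obtain ⟨a, haD, haA⟩ := mem_closure_iff_nhds.1 hpc D (hDo.mem_nhds hpD)
      -- The extra factor `G q` makes the expression vanish on the zero set of `G` as well, where
      -- nothing is known about `S`, so the identity theorem applies on all of `D`.
      have hzero : ∀ q ∈ D, G q * (F q * sDen n q - sNum n q * G q) = 0 := by
        refine eqOn_zero_of_convex hDo (convex_ball _ _) ?_ haD ?_
        · exact (hG.mono hD1).mul (((hF.mono hD1).mul ((differentiableOn_sDen n).mono hD2)).sub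
            (((differentiableOn_sNum n).mono hD2).mul (hG.mono hD1)))
        · filter_upwards [haA, hDo.mem_nhds haD] with q h1 h2
          by_cases hq : G q = 0
          · rw [hq, zero_mul]
          · have h3 := h1 (holomorphicAt_of_eq_div Metric.isOpen_ball hF hG hFG (hD1 h2) hq)
            rw [hFG q (hD1 h2) hq] at h3
            rw [← h3]
            field_simp
            ring
      filter_upwards [hDo.mem_nhds hpD] with q hqD hqh
      have hc1 : ContinuousAt (fun q => S q * sDen n q - sNum n q) q :=
        (hqh.continuousAt.mul ((differentiableOn_sDen n).differentiableAt
          ((isOpen_bddDomain n).mem_nhds (hD2 hqD))).continuousAt).sub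
          ((differentiableOn_sNum n).differentiableAt
          ((isOpen_bddDomain n).mem_nhds (hD2 hqD))).continuousAt
      refine sub_eq_zero.1 (eq_zero_of_frequently (f := fun q => S q * sDen n q - sNum n q) hc1 ?_)
      refine ((frequently_ne_zero_of_convex Metric.isOpen_ball (convex_ball p r) hG hne
        (hD1 hqD)).and_eventually (hDo.mem_nhds hqD)).mono fun q' hq' => ?_
      have h1 := (mul_eq_zero.1 (hzero q' hq'.2)).resolve_left hq'.1
      rw [hFG q' (hD1 hq'.2) hq'.1]
      have := hq'.1
      field_simp
      linear_combination h1
  exact (hsub hq).self_of_nhds hh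

/-! ### The difference equation for the continuation -/

/-- The numerator of the coefficient `A`. -/
def coeffNum (w₁ w₂ : ℂ) (γ : Fin 4 → ℂ) (x : ℂ) : ℂ :=
  ∏ j : Fin 4, (1 - Complex.exp (2 * Real.pi * (I * wMean w₁ w₂ + I * γ j + x) / w₂))

/-- The difference equation multiplied by the denominators of its coefficients. -/
def awDefect (p : Params) (s₀ s₁ s₂ : ℂ) : ℂ :=
  coeffNum p.1 p.2.1 (pγ p) (pX p) * coeffDen p.1 p.2.1 (-pX p) * (s₁ - s₀)
    + coeffNum p.1 p.2.1 (pγ p) (-pX p) * coeffDen p.1 p.2.1 (pX p) * (s₂ - s₀)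
    - eigenV p.1 p.2.1 (pγ p) (pL p) * coeffDen p.1 p.2.1 (pX p) * coeffDen p.1 p.2.1 (-pX p) * s₀

theorem awOperator_eq_iff {p : Params} (f : ℂ → ℂ) (h₁ : coeffDen p.1 p.2.1 (pX p) ≠ 0)
    (h₂ : coeffDen p.1 p.2.1 (-pX p) ≠ 0) :
    awOperator p.1 p.2.1 (pγ p) f (pX p) = eigenV p.1 p.2.1 (pγ p) (pL p) * f (pX p) ↔
      awDefect p (f (pX p)) (f (pX p + I * p.1)) (f (pX p - I * p.1)) = 0 := by
  have e : ∀ x, coeffA p.1 p.2.1 (pγ p) x = coeffNum p.1 p.2.1 (pγ p) x / coeffDen p.1 p.2.1 x :=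
    fun _ => rfl
  rw [awOperator, awDefect, e, e, ← sub_eq_zero]
  generalize coeffNum p.1 p.2.1 (pγ p) (pX p) = a
  generalize coeffNum p.1 p.2.1 (pγ p) (-pX p) = b
  generalize coeffDen p.1 p.2.1 (pX p) = c at *
  generalize coeffDen p.1 p.2.1 (-pX p) = d at *
  have : a * d * (f (pX p + I * p.1) - f (pX p)) + b * c * (f (pX p - I * p.1) - f (pX p))
      - eigenV p.1 p.2.1 (pγ p) (pL p) * c * d * f (pX p) =
      (c * d) * (a / c * (f (pX p + I * p.1) - f (pX p)) + b / d * (f (pX p - I * p.1) - f (pX p))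
      - eigenV p.1 p.2.1 (pγ p) (pL p) * f (pX p)) := by
    field_simp
  rw [this, mul_eq_zero, or_iff_right (mul_ne_zero h₁ h₂)]

theorem differentiableAt_awDefect {p : Params} (hp : p ∈ bigDomain) {s₀ s₁ s₂ : Params → ℂ}
    (h₀ : DifferentiableAt ℂ s₀ p) (h₁ : DifferentiableAt ℂ s₁ p) (h₂ : DifferentiableAt ℂ s₂ p) :
    DifferentiableAt ℂ (fun p => awDefect p (s₀ p) (s₁ p) (s₂ p)) p := by
  have hw : p.2.1 ≠ 0 := ne_zero_of_re_pos hp.2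
  simp only [awDefect, coeffNum, coeffDen, eigenV, wMean, dualPar_zero, Fin.prod_univ_four]
  fun_prop (disch := assumption)

theorem continuousAt_awDefect {p : Params} (hp : p ∈ bigDomain) {s₀ s₁ s₂ : Params → ℂ}
    (h₀ : ContinuousAt s₀ p) (h₁ : ContinuousAt s₁ p) (h₂ : ContinuousAt s₂ p) :
    ContinuousAt (fun p => awDefect p (s₀ p) (s₁ p) (s₂ p)) p := by
  have hw : p.2.1 ≠ 0 := ne_zero_of_re_pos hp.2
  simp only [awDefect, coeffNum, coeffDen, eigenV, wMean, dualPar_zero, Fin.prod_univ_four]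
  fun_prop (disch := assumption)

def shiftUp (p : Params) : Params := shX (I * p.1) p
def shiftDown (p : Params) : Params := shX (-(I * p.1)) p

theorem differentiable_shiftUp : Differentiable ℂ shiftUp := by
  unfold shiftUp shX
  fun_prop

theorem differentiable_shiftDown : Differentiable ℂ shiftDown := by
  unfold shiftDown shX
  fun_prop

/-- The step `i w₁` is itself linear in a coordinate, so the shift is a linear map of the parameter
space and preimages of convex domains remain convex. -/
theorem isLinearMap_shiftUp : IsLinearMap ℝ shiftUp := by
  constructor
  · intro p q
    simp only [shiftUp, shX, Prod.fst_add, Prod.snd_add, Prod.mk_add_mk]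
    ring_nf
  · intro c p
    simp only [shiftUp, shX, Prod.smul_fst, Prod.smul_snd, Prod.smul_mk, smul_add, mul_smul_comm]

theorem isLinearMap_shiftDown : IsLinearMap ℝ shiftDown := by
  constructor
  · intro p q
    simp only [shiftDown, shX, Prod.fst_add, Prod.snd_add, Prod.mk_add_mk]
    ring_nf
  · intro c p
    simp only [shiftDown, shX, Prod.smul_fst, Prod.smul_snd, Prod.smul_mk, smul_add, mul_smul_comm,
      smul_neg]

/-- The points which stay in `bddDomain n` under both shifts. -/
def shiftDomain (n : ℕ) : Set Params := bddDomain n ∩ (shiftUp ⁻¹' bddDomain n ∩ shiftDown ⁻¹' bddDomain n)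

theorem isOpen_shiftDomain (n : ℕ) : IsOpen (shiftDomain n) :=
  (isOpen_bddDomain n).inter (((isOpen_bddDomain n).preimage differentiable_shiftUp.continuous).inter
    ((isOpen_bddDomain n).preimage differentiable_shiftDown.continuous))

theorem convex_shiftDomain (n : ℕ) : Convex ℝ (shiftDomain n) :=
  (convex_bddDomain n).inter (((convex_bddDomain n).is_linear_preimage isLinearMap_shiftUp).inter
    ((convex_bddDomain n).is_linear_preimage isLinearMap_shiftDown))

def sDenProd (n : ℕ) (p : Params) : ℂ := sDen n p * sDen n (shiftUp p) * sDen n (shiftDown p)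

/-- The difference equation for the continuation multiplied by all denominators. -/
def sDefect (n : ℕ) (p : Params) : ℂ :=
  awDefect p (sNum n p * sDen n (shiftUp p) * sDen n (shiftDown p))
    (sNum n (shiftUp p) * sDen n p * sDen n (shiftDown p))
    (sNum n (shiftDown p) * sDen n p * sDen n (shiftUp p))

theorem differentiableAt_comp_shift {n : ℕ} {f : Params → ℂ} (hf : DifferentiableOn ℂ f (bddDomain n))
    {p : Params} (hp : p ∈ shiftDomain n) : DifferentiableAt ℂ f p ∧
      DifferentiableAt ℂ (fun p => f (shiftUp p)) p ∧ DifferentiableAt ℂ (fun p => f (shiftDown p)) p :=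
  ⟨hf.differentiableAt ((isOpen_bddDomain n).mem_nhds hp.1),
    DifferentiableAt.comp p (hf.differentiableAt ((isOpen_bddDomain n).mem_nhds hp.2.1))
      (differentiable_shiftUp p),
    DifferentiableAt.comp p (hf.differentiableAt ((isOpen_bddDomain n).mem_nhds hp.2.2))
      (differentiable_shiftDown p)⟩

theorem awDefect_mul (p : Params) (s₀ s₁ s₂ c : ℂ) :
    awDefect p (s₀ * c) (s₁ * c) (s₂ * c) = awDefect p s₀ s₁ s₂ * c := by
  rw [awDefect, awDefect]
  ring

theorem sDefect_eq_of_mul {n : ℕ} {p : Params} {S : Params → ℂ} (h₀ : S p * sDen n p = sNum n p)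
    (h₁ : S (shiftUp p) * sDen n (shiftUp p) = sNum n (shiftUp p))
    (h₂ : S (shiftDown p) * sDen n (shiftDown p) = sNum n (shiftDown p)) :
    sDefect n p = awDefect p (S p) (S (shiftUp p)) (S (shiftDown p)) * sDenProd n p := by
  rw [sDefect, ← h₀, ← h₁, ← h₂, ← awDefect_mul, sDenProd]
  congr 1 <;> ring

/-- Near `refPoint` the telescoping argument applies to the explicit formula. Since all denominators
have been cleared, the defect is holomorphic on the convex `shiftDomain n` and vanishes throughout.
-/
theorem sDefect_eq_zero {n : ℕ} (hn : refPoint ∈ shiftDomain n) {p : Params} (hp : p ∈ shiftDomain n) :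
    sDefect n p = 0 := by
  refine eqOn_zero_of_convex (isOpen_shiftDomain n) (convex_shiftDomain n) (p := refPoint) ?_ hn ?_ p hp
  · intro p hp
    obtain ⟨a0, a1, a2⟩ := differentiableAt_comp_shift (differentiableOn_sNum n) hp
    obtain ⟨b0, b1, b2⟩ := differentiableAt_comp_shift (differentiableOn_sDen n) hp
    exact (differentiableAt_awDefect (bddDomain_subset n hp.1) ((a0.mul b1).mul b2) ((a1.mul b0).mul b2)
      ((a2.mul b0).mul b1)).differentiableWithinAt
  · filter_upwards [eventually_telGood, (isOpen_shiftDomain n).mem_nhds hn] with p hT hp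
    rw [sDefect_eq_of_mul (S := fun p => sFormula p.1 p.2.1 (pγ p) (pX p) (pL p))
      (sFormula_mul_sDen hT.base hp.1) (sFormula_mul_sDen hT.base_add hp.2.1)
      (sFormula_mul_sDen hT.base_sub hp.2.2)]
    have e := Complex.exp_ne_zero (2 * Real.pi * (2 * pX p + I * wMean p.1 p.2.1) / p.2.1)
    have e' := Complex.exp_ne_zero (2 * Real.pi * (2 * -pX p + I * wMean p.1 p.2.1) / p.2.1)
    have k1 : coeffDen p.1 p.2.1 (pX p) ≠ 0 := by
      rw [coeffDen_eq]
      exact mul_ne_zero (mul_ne_zero (by norm_num) e) (mul_ne_zero hT.ne hT.ne_add)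
    have k2 : coeffDen p.1 p.2.1 (-pX p) ≠ 0 := by
      rw [coeffDen_eq]
      refine mul_ne_zero (mul_ne_zero (by norm_num) e') (mul_ne_zero ?_ ?_)
      · rw [mul_neg, sw_neg]
        exact neg_ne_zero.2 hT.ne
      · have : 2 * -pX p + 2 * I * wMean p.1 p.2.1 = -(2 * pX p - 2 * I * wMean p.1 p.2.1) := by ring
        rw [this, sw_neg]
        exact neg_ne_zero.2 hT.ne_sub
    have h := (awOperator_eq_iff _ k1 k2).1 (awOperator_sFormula hT)
    rw [sub_eq_add_neg] at h
    exact mul_eq_zero_of_left h _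

theorem exists_level_shift {p : Params} (hp : p ∈ bigDomain) :
    ∃ n : ℕ, refPoint ∈ bddDomain n ∧ refPoint ∈ shiftDomain n ∧ p ∈ shiftDomain n := by
  have hr := baseDomain_subset refPoint_mem_baseDomain
  obtain ⟨n₁, h₁⟩ := exists_forall_mem_bddDomain hr
  obtain ⟨n₂, h₂⟩ := exists_forall_mem_bddDomain (p := shiftUp refPoint) hr
  obtain ⟨n₃, h₃⟩ := exists_forall_mem_bddDomain (p := shiftDown refPoint) hr
  obtain ⟨n₄, h₄⟩ := exists_forall_mem_bddDomain hp
  obtain ⟨n₅, h₅⟩ := exists_forall_mem_bddDomain (p := shiftUp p) hp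
  obtain ⟨n₆, h₆⟩ := exists_forall_mem_bddDomain (p := shiftDown p) hp
  refine ⟨n₁ + n₂ + n₃ + n₄ + n₅ + n₆, h₁ _ (by omega), ⟨h₁ _ (by omega), h₂ _ (by omega), h₃ _ (by omega)⟩,
    ⟨h₄ _ (by omega), h₅ _ (by omega), h₆ _ (by omega)⟩⟩

/-- The denominators are nonzero at points arbitrarily close to `p`, where the cleared equation
yields the equation for `S`; continuity of the three terms at `p` then gives it at `p`. -/
theorem IsAskeyWilsonS.awDefect_eq_zero {S : Params → ℂ} (hS : IsAskeyWilsonS S) {p : Params}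
    (hp : p ∈ bigDomain) (h₀ : HolomorphicAt S p) (h₁ : HolomorphicAt S (shiftUp p))
    (h₂ : HolomorphicAt S (shiftDown p)) : awDefect p (S p) (S (shiftUp p)) (S (shiftDown p)) = 0 := by
  obtain ⟨n, hn, hrn, hpn⟩ := exists_level_shift hp
  have c1 := differentiable_shiftUp.continuous.continuousAt (x := p)
  have c2 := differentiable_shiftDown.continuous.continuousAt (x := p)
  have t1 : ContinuousAt (fun p => S (shiftUp p)) p := ContinuousAt.comp (g := S) h₁.continuousAt c1
  have t2 : ContinuousAt (fun p => S (shiftDown p)) p := ContinuousAt.comp (g := S) h₂.continuousAt c2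
  have hc := continuousAt_awDefect hp h₀.continuousAt t1 t2
  refine eq_zero_of_frequently (f := fun p => awDefect p (S p) (S (shiftUp p)) (S (shiftDown p))) hc ?_
  have hG : DifferentiableOn ℂ (sDenProd n) (shiftDomain n) := fun p hp => by
    obtain ⟨b0, b1, b2⟩ := differentiableAt_comp_shift (differentiableOn_sDen n) hp
    exact ((b0.mul b1).mul b2).differentiableWithinAt
  have hT := eventually_telGood.self_of_nhds
  have hne : sDenProd n refPoint ≠ 0 := mul_ne_zero (mul_ne_zero (sDen_ne_zero hT.base hrn.1)
    (sDen_ne_zero hT.base_add hrn.2.1)) (sDen_ne_zero hT.base_sub hrn.2.2)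
  have hev : ∀ᶠ q in 𝓝 p, q ∈ shiftDomain n ∧ HolomorphicAt S q ∧ HolomorphicAt S (shiftUp q) ∧
      HolomorphicAt S (shiftDown q) := by
    have e0 : ∀ᶠ q in 𝓝 p, HolomorphicAt S q := eventually_eventually_nhds.2 h₀
    have e1 : ∀ᶠ q in 𝓝 (shiftUp p), HolomorphicAt S q := eventually_eventually_nhds.2 h₁
    have e2 : ∀ᶠ q in 𝓝 (shiftDown p), HolomorphicAt S q := eventually_eventually_nhds.2 h₂
    filter_upwards [(isOpen_shiftDomain n).mem_nhds hpn, e0, c1.eventually e1, c2.eventually e2]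
      with q a b c d using ⟨a, b, c, d⟩
  refine ((frequently_ne_zero_of_convex (isOpen_shiftDomain n) (convex_shiftDomain n) hG
    ⟨refPoint, hrn, hne⟩ hpn).and_eventually hev).mono ?_
  rintro q ⟨hq0, hqD, k0, k1, k2⟩
  have h := sDefect_eq_of_mul (hS.mul_sDen hn hqD.1 k0) (hS.mul_sDen hn hqD.2.1 k1)
    (hS.mul_sDen hn hqD.2.2 k2)
  rw [sDefect_eq_zero hrn hqD] at h
  exact (mul_eq_zero.1 h.symm).resolve_right hq0

theorem IsAskeyWilsonS.awOperator_eq {S : Params → ℂ} (hS : IsAskeyWilsonS S) {w₁ w₂ : ℂ}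
    {γ : Fin 4 → ℂ} {x l : ℂ} (h₁ : 0 < w₁.re) (h₂ : 0 < w₂.re)
    (h : IsRegularPoint S w₁ w₂ w₁ w₂ γ x l) :
    awOperator w₁ w₂ γ (fun x' => S (w₁, w₂, γ, x', l)) x = eigenV w₁ w₂ γ l * S (w₁, w₂, γ, x, l) := by
  obtain ⟨k0, k1, k2, d1, d2⟩ := h
  refine (awOperator_eq_iff (p := (w₁, w₂, γ, x, l)) (fun x' => S (w₁, w₂, γ, x', l)) d1 d2).2 ?_
  rw [sub_eq_add_neg] at k2 ⊢
  exact hS.awDefect_eq_zero (p := (w₁, w₂, γ, x, l)) ⟨h₁, h₂⟩ k0 k1 k2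

/-! ### Interchanging the periods -/

def swapW (p : Params) : Params := (p.2.1, p.1, p.2.2)

theorem differentiable_swapW : Differentiable ℂ swapW := by
  unfold swapW
  fun_prop

theorem wMean_comm (w₁ w₂ : ℂ) : wMean w₁ w₂ = wMean w₂ w₁ := by rw [wMean, wMean, add_comm]

theorem hypGamma_comm (w₁ w₂ z : ℂ) : hypGamma w₁ w₂ z = hypGamma w₂ w₁ z := by
  rw [hypGamma, hypGamma, hypG, hypG]
  congr 2
  refine integral_congr_ae (ae_of_all _ fun y => ?_)
  simp only [mul_right_comm 2 (Complex.sinh (w₁ * y)), mul_comm w₁ w₂]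

theorem sFormula_comm (w₁ w₂ : ℂ) (γ : Fin 4 → ℂ) (x l : ℂ) :
    sFormula w₁ w₂ γ x l = sFormula w₂ w₁ γ x l := by
  simp only [sFormula, normN, psi, psiIntegrand, Delta, hypGammaPM, hypGamma_comm w₁ w₂,
    wMean_comm w₁ w₂, mul_comm w₁ w₂]

theorem swapW_mem_baseDomain {p : Params} (h : p ∈ baseDomain) : swapW p ∈ baseDomain := by
  obtain ⟨h₁, h₂, h₃, h₄⟩ := h
  refine ⟨h₂, h₁, ?_, ?_⟩
  · rw [zeta, wMean_comm]
    exact h₃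
  · intro j
    have := h₄ j
    rw [wMean_comm] at this
    exact this

theorem HolomorphicAt.comp_swapW {S : Params → ℂ} {p : Params} (h : HolomorphicAt S (swapW p)) :
    HolomorphicAt (S ∘ swapW) p := by
  filter_upwards [differentiable_swapW.continuous.continuousAt.eventually h] with q hq
  exact hq.comp q (differentiable_swapW q)

/-- Because the formula and its domain are symmetric in the periods, the swapped function is another
representative of the same continuation. The equation with step `i w₂` for `S` is thus the one with
step `i w₁` for it. -/
theorem IsAskeyWilsonS.comp_swapW {S : Params → ℂ} (hS : IsAskeyWilsonS S) : IsAskeyWilsonS (S ∘ swapW) := by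
  refine ⟨fun p hp => ?_, fun w₁ w₂ γ x l h => ?_⟩
  · obtain ⟨r, hr, f, g, hf, hg, ⟨q, hq, hq0⟩, h⟩ := hS.1 (swapW p) ⟨hp.2, hp.1⟩
    have hd : ∀ q, dist (swapW q) (swapW p) = dist q p := fun q => by
      simp only [swapW, Prod.dist_eq]
      exact max_left_comm _ _ _
    have hm : MapsTo swapW (Metric.ball p r) (Metric.ball (swapW p) r) := fun q hq => by
      rw [Metric.mem_ball, hd]
      exact hq
    refine ⟨r, hr, f ∘ swapW, g ∘ swapW, hf.comp differentiable_swapW.differentiableOn hm,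
      hg.comp differentiable_swapW.differentiableOn hm, ⟨swapW q, ?_, hq0⟩, fun q hq h0 => h _ (hm hq) h0⟩
    rw [Metric.mem_ball, ← hd]
    exact hq
  · exact (hS.2 _ _ _ _ _ (swapW_mem_baseDomain h)).trans (sFormula_comm _ _ _ _ _)

theorem IsAskeyWilsonS.awOperator_eq_swap {S : Params → ℂ} (hS : IsAskeyWilsonS S) {w₁ w₂ : ℂ}
    {γ : Fin 4 → ℂ} {x l : ℂ} (h₁ : 0 < w₁.re) (h₂ : 0 < w₂.re)
    (h : IsRegularPoint S w₂ w₁ w₁ w₂ γ x l) :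
    awOperator w₂ w₁ γ (fun x' => S (w₁, w₂, γ, x', l)) x = eigenV w₂ w₁ γ l * S (w₁, w₂, γ, x, l) := by
  obtain ⟨k0, k1, k2, d1, d2⟩ := h
  exact hS.comp_swapW.awOperator_eq h₂ h₁ ⟨HolomorphicAt.comp_swapW k0, HolomorphicAt.comp_swapW k1,
    HolomorphicAt.comp_swapW k2, d1, d2⟩

/-! ### Density of the regular points -/

def DenseOpenIn (U : Set Params) : Prop := IsOpen U ∧ bigDomain ⊆ closure U

theorem DenseOpenIn.inter {U V : Set Params} (hU : DenseOpenIn U) (hV : DenseOpenIn V) :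
    DenseOpenIn (U ∩ V) := by
  refine ⟨hU.1.inter hV.1, fun p hp => mem_closure_iff.2 fun O hO hpO => ?_⟩
  obtain ⟨q, ⟨hqO, hqB⟩, hqU⟩ := mem_closure_iff.1 (hU.2 hp) (O ∩ bigDomain) (hO.inter isOpen_bigDomain)
    ⟨hpO, hp⟩
  obtain ⟨q', ⟨h1, h2⟩, h3⟩ := mem_closure_iff.1 (hV.2 hqB) (O ∩ U) (hO.inter hU.1) ⟨hqO, hqU⟩
  exact ⟨q', h1, h2, h3⟩

theorem continuous_shX : Continuous fun q : ℂ × Params => shX q.1 q.2 := by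
  unfold shX
  fun_prop

/-- As `c` does not depend on `x`, the translation by `c p` is a homeomorphism with inverse the
translation by `-c p`. -/
theorem DenseOpenIn.preimage_shX {U : Set Params} (hU : DenseOpenIn U) {c : Params → ℂ} (hc : Continuous c)
    (hcx : ∀ p t, c (shX t p) = c p) : DenseOpenIn {p | shX (c p) p ∈ U} := by
  have h1 : Continuous fun p => shX (c p) p := continuous_shX.comp (hc.prodMk continuous_id)
  have h2 : Continuous fun p => shX (-c p) p := continuous_shX.comp (hc.neg.prodMk continuous_id)
  refine ⟨hU.1.preimage h1, fun p hp => mem_closure_iff.2 fun O hO hpO => ?_⟩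
  have inv : ∀ p, shX (-c (shX (c p) p)) (shX (c p) p) = p := fun p => by
    rw [hcx]
    simp [shX]
  have inv' : ∀ p, shX (c (shX (-c p) p)) (shX (-c p) p) = p := fun p => by
    rw [hcx]
    simp [shX]
  obtain ⟨q, hqO, hqU⟩ := mem_closure_iff.1 (hU.2 (show shX (c p) p ∈ bigDomain from hp))
    ((fun p => shX (-c p) p) ⁻¹' O) (hO.preimage h2) (by rw [mem_preimage, inv]; exact hpO)
  exact ⟨shX (-c q) q, hqO, by rw [mem_ofPred_eq, inv']; exact hqU⟩

theorem denseOpenIn_holomorphicAt {S : Params → ℂ} (hS : IsMeromorphicOn S bigDomain) :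
    DenseOpenIn {p | HolomorphicAt S p} :=
  ⟨isOpen_iff_mem_nhds.2 fun _ hp => hp.eventually_nhds,
    fun _ hp => mem_closure_iff_frequently.2 (frequently_holomorphicAt hS hp)⟩

theorem denseOpenIn_ne_zero {f : Params → ℂ} (hf : DifferentiableOn ℂ f bigDomain)
    (h : ∃ q ∈ bigDomain, f q ≠ 0) : DenseOpenIn {p | p ∈ bigDomain ∧ f p ≠ 0} := by
  refine ⟨isOpen_iff_mem_nhds.2 fun p hp => ?_, fun p hp => mem_closure_iff_frequently.2 ?_⟩
  · filter_upwards [isOpen_bigDomain.mem_nhds hp.1,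
      (hf.differentiableAt (isOpen_bigDomain.mem_nhds hp.1)).continuousAt.eventually_ne hp.2]
      with q h h' using ⟨h, h'⟩
  · exact ((frequently_ne_zero_of_convex isOpen_bigDomain convex_bigDomain hf h hp).and_eventually
      (isOpen_bigDomain.mem_nhds hp)).mono fun q hq => ⟨hq.2, hq.1⟩

theorem coeffDen_one_ne_zero {x : ℂ} (hx : x.re ≠ 0) : coeffDen 1 1 x ≠ 0 := by
  have key : ∀ v : ℂ, v.re ≠ 0 → 1 - Complex.exp v ≠ 0 := fun v hv h => by
    have h1 : ‖Complex.exp v‖ = 1 := by rw [← sub_eq_zero.1 h, norm_one]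
    rw [Complex.norm_exp, Real.exp_eq_one_iff] at h1
    exact hv h1
  have hπ := Real.pi_ne_zero
  refine mul_ne_zero (key _ ?_) (key _ ?_)
  · have : (4 * Real.pi * x / 1).re = 4 * Real.pi * x.re := by simp [mul_re]
    rw [this]
    positivity
  · have : (4 * Real.pi * (x + I * wMean 1 1) / 1).re = 4 * Real.pi * x.re := by simp [wMean, mul_re]
    rw [this]
    positivity

theorem denseOpenIn_coeffDen (s : ℂ) (hs : s = 1 ∨ s = -1) :
    DenseOpenIn {p | p ∈ bigDomain ∧ coeffDen p.1 p.2.1 (s * pX p) ≠ 0} ∧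
      DenseOpenIn {p | p ∈ bigDomain ∧ coeffDen p.2.1 p.1 (s * pX p) ≠ 0} := by
  have hsr : (s * 1).re ≠ 0 := by
    rcases hs with rfl | rfl <;> simp
  have hpt : ((1, 1, 0, 1, 0) : Params) ∈ bigDomain := ⟨by simp, by simp⟩
  refine ⟨denseOpenIn_ne_zero ?_ ⟨(1, 1, 0, 1, 0), hpt, coeffDen_one_ne_zero hsr⟩,
    denseOpenIn_ne_zero ?_ ⟨(1, 1, 0, 1, 0), hpt, coeffDen_one_ne_zero hsr⟩⟩
  all_goals
    intro p hp
    have hw : p.2.1 ≠ 0 := ne_zero_of_re_pos hp.2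
    have hw' : p.1 ≠ 0 := ne_zero_of_re_pos hp.1
    refine DifferentiableAt.differentiableWithinAt ?_
    simp only [coeffDen, wMean]
    fun_prop (disch := assumption)

theorem bigDomain_subset_closure_regular {S : Params → ℂ} (hS : IsMeromorphicOn S bigDomain) :
    bigDomain ⊆ closure {(w₁, w₂, γ, x, l) : Params |
        (w₁, w₂, γ, x, l) ∈ bigDomain ∧
        IsRegularPoint S w₁ w₂ w₁ w₂ γ x l ∧ IsRegularPoint S w₂ w₁ w₁ w₂ γ x l} := by
  have hH := denseOpenIn_holomorphicAt hS
  have a1 := hH.preimage_shX (c := fun p => I * p.1) (by fun_prop) fun _ _ => rfl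
  have a2 := hH.preimage_shX (c := fun p => -(I * p.1)) (by fun_prop) fun _ _ => rfl
  have a3 := hH.preimage_shX (c := fun p => I * p.2.1) (by fun_prop) fun _ _ => rfl
  have a4 := hH.preimage_shX (c := fun p => -(I * p.2.1)) (by fun_prop) fun _ _ => rfl
  obtain ⟨b1, b2⟩ := denseOpenIn_coeffDen 1 (Or.inl rfl)
  obtain ⟨b3, b4⟩ := denseOpenIn_coeffDen (-1) (Or.inr rfl)
  have h := ((((((((hH.inter a1).inter a2).inter a3).inter a4).inter b1).inter b2).inter b3).inter b4).2
  refine h.trans (closure_mono ?_)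
  rintro ⟨w₁, w₂, γ, x, l⟩ ⟨⟨⟨⟨⟨⟨⟨⟨k0, k1⟩, k2⟩, k3⟩, k4⟩, d1⟩, d2⟩, d3⟩, d4⟩
  simp only [mem_ofPred_eq, shX, ← sub_eq_add_neg, one_mul, neg_mul, pX] at k0 k1 k2 k3 k4 d1 d2 d3 d4
  exact ⟨d1.1, ⟨k0, k1, k2, d1.2, d3.2⟩, ⟨k0, k3, k4, d2.2, d4.2⟩⟩

/-! ### Nonvanishing -/

/-- For real periods `hypG` commutes with conjugation; the factor `i` in the exponent changes sign,
whence the inverse. -/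
theorem conj_hypGamma {w₁ w₂ : ℝ} (z : ℂ) : (starRingEnd ℂ) (hypGamma w₁ w₂ z) =
    (hypGamma w₁ w₂ ((starRingEnd ℂ) z))⁻¹ := by
  have h : hypG w₁ w₂ ((starRingEnd ℂ) z) = (starRingEnd ℂ) (hypG w₁ w₂ z) := by
    rw [hypG, hypG, ← integral_conj]
    refine integral_congr_ae (ae_of_all _ fun y => ?_)
    simp only [map_div₀, map_sub, map_mul, ← Complex.sin_conj, ← Complex.sinh_conj, conj_ofReal,
      Complex.conj_ofNat]
  rw [hypGamma, hypGamma, h, ← Complex.exp_conj, ← Complex.exp_neg, map_mul, conj_I, neg_mul]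

theorem conj_hypGammaPM {w₁ w₂ : ℝ} (z a : ℂ) : (starRingEnd ℂ) (hypGammaPM w₁ w₂ z a) =
    (hypGammaPM w₁ w₂ ((starRingEnd ℂ) z) ((starRingEnd ℂ) a))⁻¹ := by
  simp only [hypGammaPM, map_mul, conj_hypGamma, map_add, map_sub, mul_inv]

/-- A point of the base domain at which the integrand is positive. -/
def posPoint : Params := (((1 / 10 : ℝ) : ℂ), ((1 : ℝ) : ℂ), refGamma, 0, 0)

theorem posPoint_mem_baseDomain : posPoint ∈ baseDomain := by
  obtain ⟨h₁, h₂, h₃, h₄⟩ := refPoint_mem_baseDomain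
  have e1 : ((1 / 10 : ℝ) : ℂ) = 1 / 10 := by push_cast; rfl
  have e2 : ((1 : ℝ) : ℂ) = 1 := ofReal_one
  rw [posPoint, e1, e2]
  refine ⟨h₁, h₂, ?_, h₄⟩
  have h : (0 : ℂ).im = (1 : ℂ).im := by simp
  rw [h]
  exact h₃

/-- Here `τ = υ = 0`, `ρ = -σ` is real and `x = λ = 0`, so the arguments in the denominator are the
conjugates of those in the numerator. By `conj_hypGammaPM` the reciprocal of the denominator is the
conjugate of the numerator, and the integrand is a squared modulus. -/
theorem psiIntegrand_posPoint (z : ℝ) : psiIntegrand posPoint.1 posPoint.2.1 (pγ posPoint) (pX posPoint)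
    (pL posPoint) z = (‖psiIntegrand posPoint.1 posPoint.2.1 (pγ posPoint) (pX posPoint)
    (pL posPoint) z‖ : ℂ) := by
  have hρ : I * parRho refGamma = (starRingEnd ℂ) (I * parSigma refGamma) := by
    rw [parRho, parSigma, refGamma_zero, refGamma_one]
    simp only [map_mul, map_div₀, map_add, map_neg, map_one, map_zero, conj_I,
      Complex.conj_ofNat]
    ring
  have hυ : I * parUpsilon refGamma = (starRingEnd ℂ) (I * parTau refGamma) := by
    rw [parUpsilon, parTau, refGamma_two, refGamma_three]
    simp
  have hw : wMean ((1 / 10 : ℝ) : ℂ) ((1 : ℝ) : ℂ) = ((11 / 20 : ℝ) : ℂ) := by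
    rw [wMean]
    push_cast
    norm_num
  have h1 : (z : ℂ) + 0 - 0 / 2 + I * ((11 / 20 : ℝ) : ℂ) / 2 =
      (starRingEnd ℂ) (z - 0 / 2 - I * ((11 / 20 : ℝ) : ℂ) / 2) := by
    simp only [map_sub, map_mul, map_div₀, conj_ofReal, conj_I, map_zero, Complex.conj_ofNat]
    ring
  have h2 : (z : ℂ) + 0 / 2 + I * ((11 / 20 : ℝ) : ℂ) / 2 =
      (starRingEnd ℂ) (z + 0 + 0 / 2 - I * ((11 / 20 : ℝ) : ℂ) / 2) := by
    simp only [map_sub, map_add, map_mul, map_div₀, conj_ofReal, conj_I, map_zero, Complex.conj_ofNat]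
    ring
  have key : ∀ u : ℂ, u * (starRingEnd ℂ) u = (‖u * (starRingEnd ℂ) u‖ : ℂ) := fun u => by
    rw [mul_conj, norm_real, Real.norm_of_nonneg (normSq_nonneg u)]
  have e : psiIntegrand posPoint.1 posPoint.2.1 (pγ posPoint) (pX posPoint) (pL posPoint) z =
      (hypGammaPM ((1 / 10 : ℝ) : ℂ) ((1 : ℝ) : ℂ) (z + 0 + 0 / 2 - I * ((11 / 20 : ℝ) : ℂ) / 2)
          (I * parTau refGamma) *
        hypGammaPM ((1 / 10 : ℝ) : ℂ) ((1 : ℝ) : ℂ) (z - 0 / 2 - I * ((11 / 20 : ℝ) : ℂ) / 2)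
          (I * parSigma refGamma)) *
      (starRingEnd ℂ) (hypGammaPM ((1 / 10 : ℝ) : ℂ) ((1 : ℝ) : ℂ)
          (z + 0 + 0 / 2 - I * ((11 / 20 : ℝ) : ℂ) / 2) (I * parTau refGamma) *
        hypGammaPM ((1 / 10 : ℝ) : ℂ) ((1 : ℝ) : ℂ) (z - 0 / 2 - I * ((11 / 20 : ℝ) : ℂ) / 2)
          (I * parSigma refGamma)) := by
    rw [map_mul, conj_hypGammaPM, conj_hypGammaPM, ← h1, ← h2, ← hρ, ← hυ, ← hw, ← mul_inv,
      ← div_eq_mul_inv, mul_comm (hypGammaPM _ _ (z + 0 / 2 + _) _)]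
    rfl
  rw [e]
  exact key _

theorem psi_posPoint_ne_zero :
    psi posPoint.1 posPoint.2.1 (pγ posPoint) (pX posPoint) (pL posPoint) ≠ 0 := by
  have hi := (integrable_psiIntegrand posPoint_mem_baseDomain).norm
  rw [psi, integral_congr_ae (ae_of_all _ psiIntegrand_posPoint), integral_complex_ofReal, Ne,
    ofReal_eq_zero]
  refine ne_of_gt ((integral_pos_iff_support_of_nonneg (fun _ => norm_nonneg _) hi).2 ?_)
  have hs : Function.support (fun z : ℝ => ‖psiIntegrand posPoint.1 posPoint.2.1 (pγ posPoint)
      (pX posPoint) (pL posPoint) z‖) = univ := by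
    refine eq_univ_of_forall fun z => ?_
    rw [Function.mem_support, norm_ne_zero_iff, psiIntegrand]
    exact div_ne_zero (mul_ne_zero (hypGammaPM_ne_zero _ _ _ _) (hypGammaPM_ne_zero _ _ _ _))
      (mul_ne_zero (hypGammaPM_ne_zero _ _ _ _) (hypGammaPM_ne_zero _ _ _ _))
  rw [hs]
  simp

theorem IsAskeyWilsonS.exists_ne_zero {S : Params → ℂ} (hS : IsAskeyWilsonS S) :
    ∃ p ∈ bigDomain, HolomorphicAt S p ∧ S p ≠ 0 := by
  have hb := posPoint_mem_baseDomain
  have hbig := baseDomain_subset hb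
  refine ⟨posPoint, hbig, ?_, ?_⟩
  · obtain ⟨n, hn⟩ := exists_forall_mem_bddDomain hbig
    have hpn := hn n le_rfl
    refine holomorphicAt_of_eq_div (isOpen_baseDomain.inter (isOpen_bddDomain n))
      ((differentiableOn_sNum n).mono inter_subset_right)
      ((differentiableOn_sDen n).mono inter_subset_right) (fun q hq hq0 => ?_) ⟨hb, hpn⟩
      (sDen_ne_zero hb hpn)
    rw [hS.eq_sFormula hq.1, eq_div_iff hq0, sFormula_mul_sDen hq.1 hq.2]
  · rw [hS.eq_sFormula hb, sFormula_eq]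
    refine mul_ne_zero (mul_ne_zero (Finset.prod_ne_zero_iff.2 fun i _ => hypGamma_ne_zero _ _ _)
      (inv_ne_zero ?_)) psi_posPoint_ne_zero
    rw [Ne, cpow_eq_zero_iff]
    exact fun h => slitPlane_ne_zero (mul_mem_slitPlane hbig.1 hbig.2) h.1

end AskeyWilson

end

/-- The meromorphic function `S(γ; x, λ)` on `ℂ₊² × ℂ⁶` exists, is not identically zero, and
satisfies both Askey-Wilson second order difference equations in `x`, as identities of meromorphic
functions: at all points where the terms are holomorphic, and these points are dense. -/
theorem theorem6p4 :
    (∃ S : AskeyWilson.Params → ℂ, AskeyWilson.IsAskeyWilsonS S) ∧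
    ∀ S : AskeyWilson.Params → ℂ, AskeyWilson.IsAskeyWilsonS S →
      (∃ p ∈ AskeyWilson.bigDomain, AskeyWilson.HolomorphicAt S p ∧ S p ≠ 0) ∧
      AskeyWilson.bigDomain ⊆ closure {(w₁, w₂, γ, x, l) : AskeyWilson.Params |
        (w₁, w₂, γ, x, l) ∈ AskeyWilson.bigDomain ∧
        AskeyWilson.IsRegularPoint S w₁ w₂ w₁ w₂ γ x l ∧
        AskeyWilson.IsRegularPoint S w₂ w₁ w₁ w₂ γ x l} ∧
      ∀ (w₁ w₂ : ℂ) (γ : Fin 4 → ℂ) (x l : ℂ), 0 < w₁.re → 0 < w₂.re →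
        (AskeyWilson.IsRegularPoint S w₁ w₂ w₁ w₂ γ x l →
          AskeyWilson.awOperator w₁ w₂ γ (fun x' => S (w₁, w₂, γ, x', l)) x
            = AskeyWilson.eigenV w₁ w₂ γ l * S (w₁, w₂, γ, x, l)) ∧
        (AskeyWilson.IsRegularPoint S w₂ w₁ w₁ w₂ γ x l →
          AskeyWilson.awOperator w₂ w₁ γ (fun x' => S (w₁, w₂, γ, x', l)) x
            = AskeyWilson.eigenV w₂ w₁ γ l * S (w₁, w₂, γ, x, l)) := by
  refine ⟨⟨AskeyWilson.sCont, AskeyWilson.isAskeyWilsonS_sCont⟩, fun S hS => ⟨hS.exists_ne_zero,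
    AskeyWilson.bigDomain_subset_closure_regular hS.1, fun w₁ w₂ γ x l h₁ h₂ =>
    ⟨fun h => hS.awOperator_eq h₁ h₂ h, fun h => hS.awOperator_eq_swap h₁ h₂ h⟩⟩⟩
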